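/- Let $I=[0,1]$ and let $PL_2(I)$ (Thompson's group $F$) be the group, under composition, of all orientation-preserving homeomorphisms of $I$ that are piecewise linear with finitely many breakpoints, all breakpoints lying in $\mathbb{Z}[\frac12]$ and all slopes being integral powers of $2$. An element $f\in PL_2(I)$ is presented to an algorithm by a breakpoint table: a finite list of points $(x_0,y_0),\dots,(x_n,y_n)$ with dyadic rational coordinates, $0=x_0<x_1<\dots<x_n=1$, $y_0=0$, $y_n=1$, such that on each $[x_i,x_{i+1}]$ the map $f$ is the affine interpolation from $y_i$ to $y_{i+1}$. **Theorem.** The group $PL_2(I)$ has solvable conjugacy problem, with an effective solution: there is an algorithm (a total computable function) which, given breakpoint tables of any two elements $x,y\in PL_2(I)$, determines whether or not there is a $g\in PL_2(I)$ with $g^{-1}xg=y$, and, whenever such a $g$ exists, outputs a breakpoint table of one such $g$. -/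

import Mathlib

noncomputable section

/-- Membership in `ℤ[1/2]`, the ring of dyadic rational numbers. -/
def IsDyadic (x : ℝ) : Prop := ∃ (m : ℤ) (n : ℕ), x = m / 2 ^ n

/-- `f : [0,1] → [0,1]` is piecewise linear with finitely many breakpoints, all of them in
`ℤ[1/2]`, and with all slopes integral powers of `2`: there is a finite set `S` of dyadic points
such that `f` is affine with slope some `2 ^ k`, `k ∈ ℤ`, on every interval `[a, b] ⊆ [0,1]` whose
interior does not meet `S`. -/
def IsDyadicPL (f : unitInterval → unitInterval) : Prop :=
  ∃ S : Finset unitInterval, (∀ s ∈ S, IsDyadic (s : ℝ)) ∧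
    ∀ a b : unitInterval, a ≤ b → (∀ s ∈ S, ¬ (a < s ∧ s < b)) →
      ∃ k : ℤ, ∀ t : unitInterval, a ≤ t → t ≤ b →
        (f t : ℝ) = (f a : ℝ) + (2 : ℝ) ^ k * ((t : ℝ) - (a : ℝ))

theorem IsDyadic.add_zpow_mul_sub {x y z : ℝ} (hx : IsDyadic x) (hy : IsDyadic y)
    (hz : IsDyadic z) (k : ℤ) : IsDyadic (x + (2 : ℝ) ^ k * (y - z)) := by
  obtain ⟨m, n, rfl⟩ := hx
  obtain ⟨p, q, rfl⟩ := hy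
  obtain ⟨u, v, rfl⟩ := hz
  obtain ⟨j, rfl | rfl⟩ := k.eq_nat_or_neg
  · refine ⟨m * 2 ^ (q + v) + 2 ^ (j + n) * (p * 2 ^ v - u * 2 ^ q), n + q + v, ?_⟩
    push_cast
    rw [zpow_natCast]
    field_simp
    ring
  · refine ⟨m * 2 ^ (q + v + j) + 2 ^ n * (p * 2 ^ v - u * 2 ^ q), n + q + v + j, ?_⟩
    push_cast
    rw [zpow_neg, zpow_natCast]
    field_simp
    ring

/-- Such a homeomorphism maps dyadic points, and no others, to dyadic points. -/
theorem IsDyadicPL.isDyadic_iff {f : unitInterval → unitInterval} (hf : IsDyadicPL f)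
    (h0 : f 0 = 0) (d : unitInterval) : IsDyadic (f d : ℝ) ↔ IsDyadic (d : ℝ) := by
  obtain ⟨S, hS, haff⟩ := hf
  have hz : IsDyadic (0 : ℝ) := ⟨0, 0, by simp⟩
  have hall : ∀ s ∈ insert 0 S, IsDyadic (s : ℝ) := by
    intro s hs
    rcases Finset.mem_insert.1 hs with rfl | hs
    · simpa using hz
    · exact hS s hs
  have step : ∀ (n : ℕ) (d : unitInterval), ((insert 0 S).filter (· < d)).card = n →
      (IsDyadic (f d : ℝ) ↔ IsDyadic (d : ℝ)) := by
    intro n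
    induction n using Nat.strong_induction_on with
    | _ n ih =>
      intro d hd
      rcases eq_or_lt_of_le (show (0 : unitInterval) ≤ d from d.2.1) with h | h
      · subst h; rw [h0]
      · have hne : ((insert 0 S).filter (· < d)).Nonempty := ⟨0, by simp [h]⟩
        set a := ((insert 0 S).filter (· < d)).max' hne with ha
        have hmem : a ∈ (insert 0 S).filter (· < d) := Finset.max'_mem _ _
        have had : a < d := (Finset.mem_filter.1 hmem).2
        have hada : IsDyadic (a : ℝ) := hall a (Finset.mem_filter.1 hmem).1
        have hlt : ((insert 0 S).filter (· < a)).card < n := by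
          rw [← hd]
          apply Finset.card_lt_card
          refine ⟨fun s hs => ?_, fun hsub => ?_⟩
          · rw [Finset.mem_filter] at hs ⊢
            exact ⟨hs.1, hs.2.trans had⟩
          · exact lt_irrefl a (Finset.mem_filter.1 (hsub hmem)).2
        have hfa : IsDyadic (f a : ℝ) := (ih _ hlt a rfl).2 hada
        obtain ⟨k, hk⟩ := haff a d had.le (by
          rintro s hs ⟨h1, h2⟩
          exact absurd (Finset.le_max' _ s (Finset.mem_filter.2
            ⟨Finset.mem_insert_of_mem hs, h2⟩)) (not_le.2 h1))
        have hk' := hk d had.le le_rfl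
        constructor
        · intro h
          have := hada.add_zpow_mul_sub h hfa (-k)
          convert this using 1
          rw [hk', zpow_neg]
          field_simp
          ring
        · intro h
          rw [hk']
          exact hfa.add_zpow_mul_sub h hada k
  exact step _ d rfl

theorem unitInterval.homeomorph_zero {f : unitInterval ≃ₜ unitInterval} (hf : StrictMono f) :
    f 0 = 0 := by
  refine le_antisymm ?_ (f 0).2.1
  have h : f 0 ≤ f (f.symm 0) := hf.monotone (f.symm 0).2.1
  simpa using h

theorem unitInterval.homeomorph_one {f : unitInterval ≃ₜ unitInterval} (hf : StrictMono f) :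
    f 1 = 1 := by
  refine le_antisymm (f 1).2.2 ?_
  have h : f (f.symm 1) ≤ f 1 := hf.monotone (f.symm 1).2.2
  simpa using h

/-- The group `PL₂(I)`, `I = [0,1]` (Thompson's group `F`): the orientation-preserving
homeomorphisms of `[0,1]` that are piecewise linear with finitely many breakpoints, all
breakpoints in `ℤ[1/2]`, and all slopes integral powers of `2`. The product is composition. -/
def PLTwo : Subgroup (unitInterval ≃ₜ unitInterval) where
  carrier := {f | StrictMono f ∧ IsDyadicPL f}
  one_mem' := by
    refine ⟨fun a b h => h, ∅, by simp, fun a b _ _ => ⟨0, fun t _ _ => ?_⟩⟩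
    simp
  mul_mem' := by
    rintro f g ⟨hfm, S, hS, hf⟩ ⟨hgm, T, hT, hg⟩
    refine ⟨fun a b h => hfm (hgm h), T ∪ S.image g.symm, ?_, ?_⟩
    · intro s hs
      rcases Finset.mem_union.1 hs with hs | hs
      · exact hT s hs
      · obtain ⟨r, hr, rfl⟩ := Finset.mem_image.1 hs
        rw [← IsDyadicPL.isDyadic_iff ⟨T, hT, hg⟩ (unitInterval.homeomorph_zero hgm)]
        simpa using hS r hr
    · intro a b hab hfree
      obtain ⟨k, hk⟩ := hg a b hab fun s hs => hfree s (Finset.mem_union_left _ hs)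
      obtain ⟨l, hl⟩ := hf (g a) (g b) (hgm.monotone hab) (by
        rintro s hs ⟨h1, h2⟩
        refine hfree (g.symm s) (Finset.mem_union_right _ (Finset.mem_image_of_mem _ hs)) ⟨?_, ?_⟩
        · rw [← hgm.lt_iff_lt]; simpa using h1
        · rw [← hgm.lt_iff_lt]; simpa using h2)
      refine ⟨l + k, fun t h1 h2 => ?_⟩
      have e1 := hl (g t) (hgm.monotone h1) (hgm.monotone h2)
      have e2 := hk t h1 h2
      change (f (g t) : ℝ) = (f (g a) : ℝ) + _
      rw [e1, e2, zpow_add₀ two_ne_zero]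
      ring
  inv_mem' := by
    rintro f ⟨hfm, S, hS, hf⟩
    have hinv : StrictMono (f⁻¹ : unitInterval ≃ₜ unitInterval) := by
      intro a b h
      change f.symm a < f.symm b
      rw [← hfm.lt_iff_lt]; simpa using h
    refine ⟨hinv, S.image f, ?_, ?_⟩
    · intro s hs
      obtain ⟨r, hr, rfl⟩ := Finset.mem_image.1 hs
      exact (IsDyadicPL.isDyadic_iff ⟨S, hS, hf⟩ (unitInterval.homeomorph_zero hfm) r).2 (hS r hr)
    · intro a b hab hfree
      obtain ⟨k, hk⟩ := hf (f.symm a) (f.symm b) (hinv.monotone hab) (by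
        rintro s hs ⟨h1, h2⟩
        refine hfree (f s) (Finset.mem_image_of_mem _ hs) ⟨?_, ?_⟩
        · rw [← hfm.lt_iff_lt] at h1; simpa using h1
        · rw [← hfm.lt_iff_lt] at h2; simpa using h2)
      refine ⟨-k, fun t h1 h2 => ?_⟩
      have e := hk (f.symm t) (hinv.monotone h1) (hinv.monotone h2)
      simp only [Homeomorph.apply_symm_apply] at e
      change (f.symm t : ℝ) = (f.symm a : ℝ) + _
      rw [e, zpow_neg]
      field_simp
      ring

/-- The pair `(m, n)` of natural numbers denotes the dyadic rational `m / 2 ^ n ≥ 0`. -/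
def dyadicValue (p : ℕ × ℕ) : ℝ := (p.1 : ℝ) / 2 ^ p.2

/-- The finite data by which an algorithm is given an element of `PL₂(I)`: a list of points
`(x, y)` of the plane with dyadic coordinates, each coordinate written as a pair `(m, n)`. -/
abbrev BreakpointTable : Type := List ((ℕ × ℕ) × (ℕ × ℕ))

/-- `c` is a breakpoint table of `f`: it lists points `(x₀, y₀), …, (xₙ, yₙ)` with
`0 = x₀ < x₁ < … < xₙ = 1`, `y₀ = 0`, `yₙ = 1`, and on each `[xᵢ, xᵢ₊₁]` the function `f` is the
affine interpolation from `yᵢ` to `yᵢ₊₁`. -/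
def IsBreakpointTable (c : BreakpointTable) (f : PLTwo) : Prop :=
  (∃ p ∈ c.head?, dyadicValue p.1 = 0 ∧ dyadicValue p.2 = 0) ∧
  (∃ p ∈ c.getLast?, dyadicValue p.1 = 1 ∧ dyadicValue p.2 = 1) ∧
  c.IsChain fun p q =>
    dyadicValue p.1 < dyadicValue q.1 ∧
    ∀ t : unitInterval, dyadicValue p.1 ≤ (t : ℝ) → (t : ℝ) ≤ dyadicValue q.1 →
      (f.1 t : ℝ) = dyadicValue p.2 + (dyadicValue q.2 - dyadicValue p.2) /
        (dyadicValue q.1 - dyadicValue p.1) * ((t : ℝ) - dyadicValue p.1)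

/-- Every element of `PL₂(I)` has a breakpoint table. -/
theorem exists_isBreakpointTable (f : PLTwo) : ∃ c, IsBreakpointTable c f := by
  obtain ⟨f, hfm, S, hS, haff⟩ := f
  have h0 := unitInterval.homeomorph_zero hfm
  have h1 := unitInterval.homeomorph_one hfm
  have hd : ∀ x : unitInterval, ∃ p : ℕ × ℕ, IsDyadic (x : ℝ) → dyadicValue p = x := by
    intro x
    by_cases h : IsDyadic (x : ℝ)
    · obtain ⟨m, n, hmn⟩ := h
      have hm : 0 ≤ m := by
        have := x.2.1
        rw [hmn, le_div_iff₀ (by positivity), zero_mul] at this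
        exact_mod_cast this
      lift m to ℕ using hm
      exact ⟨(m, n), fun _ => by rw [hmn]; simp [dyadicValue]⟩
    · exact ⟨(0, 0), fun h' => absurd h' h⟩
  choose w hw using hd
  let T : Finset unitInterval := insert 0 (insert 1 S)
  have hT : ∀ s ∈ T, IsDyadic (s : ℝ) := by
    intro s hs
    simp only [T, Finset.mem_insert] at hs
    rcases hs with rfl | rfl | hs
    · exact ⟨0, 0, by simp⟩
    · exact ⟨1, 0, by simp⟩
    · exact hS s hs
  have hfT : ∀ s ∈ T, IsDyadic (f s : ℝ) := fun s hs =>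
    (IsDyadicPL.isDyadic_iff ⟨S, hS, haff⟩ h0 s).2 (hT s hs)
  have hl : ∀ s, s ∈ T.sort (· ≤ ·) ↔ s ∈ T := fun s => Finset.mem_sort _
  have hsorted := T.sortedLT_sort
  generalize T.sort (· ≤ ·) = l at hl hsorted
  have hne : l ≠ [] := by
    rintro rfl
    simpa [T] using hl 0
  have hmono : StrictMono l.get := hsorted.strictMono_get
  have hhead : l.head hne = 0 := by
    refine le_antisymm ?_ (l.head hne).2.1
    obtain ⟨i, hi⟩ := List.get_of_mem ((hl 0).2 (by simp [T]))
    rw [← hi, List.head_eq_getElem]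
    exact hmono.monotone (Fin.mk_le_of_le_val (Nat.zero_le _))
  have hlast : l.getLast hne = 1 := by
    refine le_antisymm (l.getLast hne).2.2 ?_
    obtain ⟨i, hi⟩ := List.get_of_mem ((hl 1).2 (by simp [T]))
    rw [← hi, List.getLast_eq_getElem]
    exact hmono.monotone (Fin.le_def.2 (Nat.le_sub_one_of_lt i.2))
  refine ⟨l.map fun x => (w x, w (f x)), ⟨(w 0, w (f 0)), ?_, ?_, ?_⟩,
    ⟨(w 1, w (f 1)), ?_, ?_, ?_⟩, ?_⟩
  · rw [List.head?_map, List.head?_eq_some_head hne, hhead]; simp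
  · simpa using hw 0 (hT 0 (by simp [T]))
  · simpa [h0] using hw (f 0) (hfT 0 (by simp [T]))
  · rw [List.getLast?_map, List.getLast?_eq_some_getLast hne, hlast]; simp
  · simpa using hw 1 (hT 1 (by simp [T]))
  · simpa [h1] using hw (f 1) (hfT 1 (by simp [T]))
  · rw [List.isChain_map, List.isChain_iff_getElem]
    intro i hi
    have hlt : l[i] < l[i + 1] :=
      hmono (a := ⟨i, by omega⟩) (b := ⟨i + 1, hi⟩) (Fin.mk_lt_mk.2 (Nat.lt_succ_self i))
    have ha := (hl _).1 (List.getElem_mem (show i < l.length by omega))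
    have hb := (hl _).1 (List.getElem_mem hi)
    dsimp only
    rw [hw _ (hT _ ha), hw _ (hT _ hb), hw _ (hfT _ ha), hw _ (hfT _ hb)]
    refine ⟨hlt, fun t h2 h3 => ?_⟩
    obtain ⟨k, hk⟩ := haff l[i] l[i + 1] hlt.le (by
      rintro s hs ⟨h4, h5⟩
      obtain ⟨j, rfl⟩ := List.get_of_mem ((hl s).2 (by simp [T, hs]))
      have h6 := Fin.lt_def.1 (hmono.lt_iff_lt.1
        (show l.get ⟨i, by omega⟩ < l.get j from h4))
      have h7 := Fin.lt_def.1 (hmono.lt_iff_lt.1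
        (show l.get j < l.get ⟨i + 1, hi⟩ from h5))
      simp only at h6 h7
      omega)
    have hpos : (0 : ℝ) < (l[i + 1] : ℝ) - (l[i] : ℝ) := sub_pos.2 hlt
    rw [hk t h2 h3, hk l[i + 1] hlt.le le_rfl]
    field_simp
    ring

/-- A breakpoint table determines the element of `PL₂(I)` it describes. -/
theorem IsBreakpointTable.unique {c : BreakpointTable} {f g : PLTwo}
    (hf : IsBreakpointTable c f) (hg : IsBreakpointTable c g) : f = g := by
  have key : ∀ (c : BreakpointTable) (p₀ p₁ : (ℕ × ℕ) × (ℕ × ℕ)) (t : unitInterval),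
      p₀ ∈ c.head? → p₁ ∈ c.getLast? → dyadicValue p₀.1 ≤ t → (t : ℝ) ≤ dyadicValue p₁.1 →
      dyadicValue p₀.1 < dyadicValue p₁.1 →
      ∀ R R' : (ℕ × ℕ) × (ℕ × ℕ) → (ℕ × ℕ) × (ℕ × ℕ) → Prop, c.IsChain R → c.IsChain R' →
      ∃ p q, (R p q ∧ R' p q) ∧ dyadicValue p.1 ≤ t ∧ (t : ℝ) ≤ dyadicValue q.1 := by
    intro c
    induction c with
    | nil => intro p₀ p₁ t h; simp at h
    | cons p c ih =>
      intro p₀ p₁ t h0 h1 h2 h3 h4 R R' hR hR'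
      cases c with
      | nil => simp at h0 h1; subst h0 h1; exact absurd h4 (lt_irrefl _)
      | cons q c =>
        simp at h0
        subst h0
        rw [List.isChain_cons_cons] at hR hR'
        rcases le_or_gt (t : ℝ) (dyadicValue q.1) with h | h
        · exact ⟨p, q, ⟨hR.1, hR'.1⟩, h2, h⟩
        · exact ih q p₁ t (by simp) (by simpa using h1) h.le h3 (h.trans_le h3) R R' hR.2 hR'.2
  obtain ⟨⟨p₀, h0, hx0, -⟩, ⟨p₁, h1, hx1, -⟩, hcf⟩ := hf
  apply Subtype.ext
  ext t
  obtain ⟨p, q, ⟨hpf, hpg⟩, h2, h3⟩ := key c p₀ p₁ t h0 h1 (by rw [hx0]; exact t.2.1)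
    (by rw [hx1]; exact t.2.2) (by rw [hx0, hx1]; exact zero_lt_one) _ _ hcf hg.2.2
  rw [hpf.2 t h2 h3, hpg.2 t h2 h3]

/-- The conjugacy problem of the group `G`, whose elements are given to algorithms through the
names in `α` (`Names a x` means that `a` is a name of `x`), is solvable with an effective solution:
one computable function decides, from names of `x` and `y`, whether some `g ∈ G` satisfies
`g⁻¹ x g = y`. It answers `none` if there is no such `g`, and otherwise returns a name of one. -/
def EffectivelySolvableConjugacyProblem (G : Type*) [Group G] {α : Type*} [Primcodable α]
    (Names : α → G → Prop) : Prop :=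
  ∃ A : α × α → Option α, Computable A ∧
    ∀ (a b : α) (x y : G), Names a x → Names b y →
      (A (a, b) = none → ¬ ∃ g : G, g⁻¹ * x * g = y) ∧
      (∀ c, A (a, b) = some c → ∃ g : G, Names c g ∧ g⁻¹ * x * g = y)

end

/-!
The theorem holds because conjugate elements `x`, `y` have a conjugator whose breakpoint table is
bounded in size by a computable function of the tables of `x` and `y`; a finite search among the
tables of this size then decides conjugacy and finds a conjugator.

To bound a conjugator `g`, that is a solution of `x ∘ g = g ∘ y`, one measures maps by the
exponents of `2` in denominators and slopes: `Lev N` bounds them for `x`, `y`, and `GoodAt C` for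
`g`. Call a point critical for `y` if it is `0`, `1`, or a dyadic fixed point near which `y` is
not the identity. These points have bounded denominators, so there are finitely many, and `g` maps
them to critical points of `x`. Between two consecutive critical points `g` may be changed
independently of the rest (`exists_modify`), and there are two cases
(`eq_self_or_not_eventually`).

* If `y` is the identity there, so is `x` on the image, and `g` may be replaced by any piecewise
  linear map with the same values at the two endpoints (`exists_mild_interval`).
* Otherwise `x` has slope `2 ^ s`, with `s ≠ 0`, at the image of the left endpoint. Composition of
  `g` with a power of `x` reduces the exponent of the initial slope of `g` modulo `s`, after which
  it is bounded. On a bump of `y`, an interval between consecutive fixed points, `g` is linear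
  near the ends on intervals of a definite size, because the functional equation spreads linearity
  from the germ of `g` at the fixed point (`Bump.conj_affine_of_le`). Orbits travel from one end
  to the other in a bounded number of steps, so the final slope is bounded in terms of the initial
  one (`Bump.abs_leftSlope_le`), and the functional equation bounds the denominators of `g` over
  the whole bump (`Bump.goodAt`). The fixed points between the bumps are not dyadic, hence `g`
  does not break at them and its slope passes unchanged to the next bump. The number of bumps is
  bounded, which gives a bound on the whole interval (`ConjData.goodAt_of_mem_piece`).

The result is `exists_goodAt`: some conjugator has a table over the subdivision of level
`conjBound N` with bounded values. The search `conjSearch` runs through all such tables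
(`candidates`) and tests the equation `x ∘ g = g ∘ y` at the points of a subdivision that contains
all breaks of both sides (`CommutesOnGrid.mul_eq`). It is primitive recursive.
-/

open Filter Topology Set

/-! ### Denominators up to odd factors -/

/-- The real number `t` is a rational number whose reduced denominator is not divisible by
`2 ^ (N + 1)`. -/
def TwoBdd (N : ℕ) (t : ℝ) : Prop := ∃ (m : ℤ) (q : ℕ), Odd q ∧ t * (q * 2 ^ N) = m

namespace TwoBdd

theorem mono {N M : ℕ} (h : N ≤ M) {t : ℝ} (ht : TwoBdd N t) : TwoBdd M t := by
  obtain ⟨m, q, hq, e⟩ := ht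
  obtain ⟨d, rfl⟩ := Nat.exists_eq_add_of_le h
  refine ⟨m * 2 ^ d, q, hq, ?_⟩
  push_cast
  rw [← e]; ring

theorem int_div (m : ℤ) (N : ℕ) : TwoBdd N ((m : ℝ) / 2 ^ N) :=
  ⟨m, 1, odd_one, by field_simp; simp⟩

theorem add {N : ℕ} {s t : ℝ} (hs : TwoBdd N s) (ht : TwoBdd N t) : TwoBdd N (s + t) := by
  obtain ⟨m, q, hq, e⟩ := hs
  obtain ⟨m', q', hq', e'⟩ := ht
  refine ⟨m * q' + m' * q, q * q', hq.mul hq', ?_⟩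
  push_cast
  rw [← e, ← e']; ring

theorem neg {N : ℕ} {t : ℝ} (ht : TwoBdd N t) : TwoBdd N (-t) := by
  obtain ⟨m, q, hq, e⟩ := ht
  refine ⟨-m, q, hq, ?_⟩
  push_cast
  rw [← e]; ring

theorem sub {N : ℕ} {s t : ℝ} (hs : TwoBdd N s) (ht : TwoBdd N t) : TwoBdd N (s - t) := by
  rw [sub_eq_add_neg]; exact hs.add ht.neg

theorem zpow_mul {N K : ℕ} {t : ℝ} (ht : TwoBdd N t) {k : ℤ} (hk : |k| ≤ K) :
    TwoBdd (N + K) (2 ^ k * t) := by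
  obtain ⟨m, q, hq, e⟩ := ht
  have h0 : 0 ≤ k + K := by have := (abs_le.1 hk).1; omega
  obtain ⟨d, hd⟩ := Int.eq_ofNat_of_zero_le h0
  refine ⟨m * 2 ^ d, q, hq, ?_⟩
  push_cast
  rw [← e, ← zpow_natCast (2 : ℝ) d, ← hd, zpow_add₀ two_ne_zero, pow_add, zpow_natCast]
  ring

theorem of_mul_odd {N : ℕ} {t : ℝ} {r : ℕ} (hr : Odd r) (ht : TwoBdd N (t * r)) :
    TwoBdd N t := by
  obtain ⟨m, q, hq, e⟩ := ht
  refine ⟨m, r * q, hr.mul hq, ?_⟩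
  rw [← e]; push_cast; ring

theorem of_isDyadic {N : ℕ} {t : ℝ} (ht : TwoBdd N t) (hd : IsDyadic t) :
    ∃ m : ℤ, t = m / 2 ^ N := by
  obtain ⟨m, q, hq, e⟩ := ht
  obtain ⟨a, n, rfl⟩ := hd
  have h1 : a * 2 ^ N * q = m * 2 ^ n := by
    have : ((a * 2 ^ N * q : ℤ) : ℝ) = ((m * 2 ^ n : ℤ) : ℝ) := by
      push_cast
      rw [← e]; field_simp
    exact_mod_cast this
  have hcop : IsCoprime ((2 : ℤ) ^ n) (q : ℤ) := by
    have : Nat.Coprime (2 ^ n) q := (Nat.coprime_two_left.2 hq).pow_left n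
    exact_mod_cast Nat.isCoprime_iff_coprime.2 this
  obtain ⟨b, hb⟩ := hcop.dvd_of_dvd_mul_right (Dvd.intro_left m h1.symm)
  refine ⟨b, ?_⟩
  have hb' : (a : ℝ) * 2 ^ N = 2 ^ n * b := by exact_mod_cast hb
  field_simp
  linarith

end TwoBdd

/-! ### Piecewise affine maps of bounded level -/

/-- `f` is affine on each interval of length `2 ^ (-N)` of the standard dyadic subdivision, its
slopes lie between `2 ^ (-N)` and `2 ^ N`, and its values at the points of the subdivision are
multiples of `2 ^ (-2 N)`. -/
def Lev (N : ℕ) (f : ℝ → ℝ) : Prop :=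
  ∀ j : ℤ, ∃ k m : ℤ, |k| ≤ N ∧ ∀ t ∈ Icc ((j : ℝ) / 2 ^ N) ((j + 1 : ℝ) / 2 ^ N),
    f t = m / 2 ^ (2 * N) + 2 ^ k * (t - j / 2 ^ N)

theorem exists_mem_Ico_grid (N : ℕ) (t : ℝ) :
    ∃ j : ℤ, t ∈ Ico ((j : ℝ) / 2 ^ N) ((j + 1 : ℝ) / 2 ^ N) := by
  refine ⟨⌊t * 2 ^ N⌋, ?_, ?_⟩
  · rw [div_le_iff₀ (by positivity)]; exact Int.floor_le _
  · rw [lt_div_iff₀ (by positivity)]; exact Int.lt_floor_add_one _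

theorem Lev.twoBdd {N : ℕ} {f : ℝ → ℝ} (hf : Lev N f) {M : ℕ} {t : ℝ} (ht : TwoBdd M t) :
    TwoBdd (M + 2 * N) (f t) := by
  obtain ⟨j, hj⟩ := exists_mem_Ico_grid N t
  obtain ⟨k, m, hk, h⟩ := hf j
  rw [h t ⟨hj.1, hj.2.le⟩]
  refine ((TwoBdd.int_div _ _).mono (by omega)).add (TwoBdd.mono (N := max M N + N) ?_ ?_)
  · omega
  · exact ((ht.mono (le_max_left _ _)).sub ((TwoBdd.int_div _ _).mono (le_max_right _ _))).zpow_mul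
      hk

theorem Lev.grid {N : ℕ} {f : ℝ → ℝ} (hf : Lev N f) (j : ℤ) :
    ∃ m : ℤ, f (j / 2 ^ N) = m / 2 ^ (2 * N) := by
  obtain ⟨k, m, hk, h⟩ := hf j
  refine ⟨m, ?_⟩
  rw [h _ ⟨le_rfl, by gcongr; linarith⟩]; simp

/-- A positive multiple of `2 ^ (-M)` is at least `2 ^ (-M)`. -/
theorem inv_two_pow_le_of_int_div {M : ℕ} {m : ℤ} (h : (0 : ℝ) < m / 2 ^ M) :
    1 / 2 ^ M ≤ (m : ℝ) / 2 ^ M := by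
  have h1 : (0 : ℝ) < m := by
    by_contra h2
    exact absurd h (not_lt.2 (div_nonpos_of_nonpos_of_nonneg (not_lt.1 h2) (by positivity)))
  have : (1 : ℝ) ≤ m := by exact_mod_cast (show (0 : ℤ) < m by exact_mod_cast h1)
  gcongr

/-- A point of the subdivision which is moved to the right is moved by at least `2 ^ (-2 N)`. -/
theorem Lev.grid_disp {N : ℕ} {f : ℝ → ℝ} (hf : Lev N f) (j : ℤ)
    (h : (j : ℝ) / 2 ^ N < f (j / 2 ^ N)) :
    1 / 2 ^ (2 * N) ≤ f (j / 2 ^ N) - (j : ℝ) / 2 ^ N := by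
  obtain ⟨m, hm⟩ := hf.grid j
  have e : f (j / 2 ^ N) - (j : ℝ) / 2 ^ N = ((m - j * 2 ^ N : ℤ) : ℝ) / 2 ^ (2 * N) := by
    rw [hm]; push_cast; rw [two_mul, pow_add]; field_simp
  rw [e]
  apply inv_two_pow_le_of_int_div
  rw [← e]; linarith

/-- The conjugate of `f` by the reflection `t ↦ -t`. -/
def reflIso (f : ℝ ≃o ℝ) : ℝ ≃o ℝ where
  toFun t := -f (-t)
  invFun t := -f.symm (-t)
  left_inv t := by simp
  right_inv t := by simp
  map_rel_iff' := by simp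

@[simp] theorem reflIso_apply (f : ℝ ≃o ℝ) (t : ℝ) : reflIso f t = -f (-t) := rfl

theorem reflIso_symm (f : ℝ ≃o ℝ) : (reflIso f).symm = reflIso f.symm := rfl

theorem Lev.reflIso {N : ℕ} {f : ℝ ≃o ℝ} (hf : Lev N f) : Lev N (reflIso f) := by
  intro j
  obtain ⟨k, m, hk, h⟩ := hf (-j - 1)
  have h0 : 0 ≤ k + N := by have := (abs_le.1 hk).1; omega
  obtain ⟨d, hd⟩ := Int.eq_ofNat_of_zero_le h0
  refine ⟨k, -m - 2 ^ d, hk, fun t ht => ?_⟩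
  rw [reflIso_apply, h (-t) ?_]
  · have e : (2 : ℝ) ^ d = 2 ^ k * 2 ^ N := by
      rw [← zpow_natCast (2 : ℝ) d, ← hd, zpow_add₀ two_ne_zero, zpow_natCast]
    push_cast
    rw [e, two_mul, pow_add]
    field_simp
    ring
  · push_cast
    constructor
    · have := ht.2
      have e : ((-(j : ℝ) - 1) / 2 ^ N) = -((j + 1) / 2 ^ N) := by ring
      rw [e]; linarith
    · have := ht.1
      have e : ((-(j : ℝ) - 1 + 1) / 2 ^ N) = -(j / 2 ^ N) := by ring
      rw [e]; linarith

/-! ### One-sided slopes and breaks -/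

/-- `f` is affine with slope `2 ^ k` in a right neighbourhood of `t`. -/
def RightSlope (f : ℝ → ℝ) (t : ℝ) (k : ℤ) : Prop :=
  ∀ᶠ s in 𝓝[>] t, f s = f t + 2 ^ k * (s - t)

/-- `f` is affine with slope `2 ^ k` in a left neighbourhood of `t`. -/
def LeftSlope (f : ℝ → ℝ) (t : ℝ) (k : ℤ) : Prop :=
  ∀ᶠ s in 𝓝[<] t, f s = f t + 2 ^ k * (s - t)

/-- `f` is affine in a neighbourhood of `t`, with slope a power of `2`. -/
def AffAt (f : ℝ → ℝ) (t : ℝ) : Prop :=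
  ∃ k : ℤ, ∀ᶠ s in 𝓝 t, f s = f t + 2 ^ k * (s - t)

theorem leftSlope_iff (f : ℝ ≃o ℝ) (t : ℝ) (k : ℤ) :
    LeftSlope f t k ↔ RightSlope (reflIso f) (-t) k := by
  unfold LeftSlope RightSlope
  have e : 𝓝[>] (-t) = map Neg.neg (𝓝[<] t) := by
    simp
  rw [e, eventually_map]
  refine eventually_congr (Eventually.of_forall fun s => ?_)
  simp only [reflIso_apply, neg_neg]
  constructor <;> intro h <;> linarith

theorem AffAt.exists_slopes {f : ℝ → ℝ} {t : ℝ} (h : AffAt f t) :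
    ∃ k, RightSlope f t k ∧ LeftSlope f t k := by
  obtain ⟨k, hk⟩ := h
  exact ⟨k, hk.filter_mono nhdsWithin_le_nhds, hk.filter_mono nhdsWithin_le_nhds⟩

theorem RightSlope.exists_pos {f : ℝ → ℝ} {t : ℝ} {k : ℤ} (h : RightSlope f t k) :
    ∃ ε > 0, ∀ s ∈ Icc t (t + ε), f s = f t + 2 ^ k * (s - t) := by
  obtain ⟨u, hu, h⟩ := mem_nhdsGT_iff_exists_Ioc_subset.1 h
  refine ⟨u - t, sub_pos.2 hu, fun s hs => ?_⟩
  rcases eq_or_lt_of_le hs.1 with rfl | h1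
  · simp
  · exact h ⟨h1, by linarith [hs.2]⟩

theorem RightSlope.of_Icc {f : ℝ → ℝ} {t ε : ℝ} {k : ℤ} (hε : 0 < ε)
    (h : ∀ s ∈ Icc t (t + ε), f s = f t + 2 ^ k * (s - t)) : RightSlope f t k := by
  filter_upwards [Ioc_mem_nhdsGT (show t < t + ε by linarith)] with s hs
  exact h s ⟨hs.1.le, hs.2⟩

theorem two_zpow_inj {k l : ℤ} (h : (2 : ℝ) ^ k = 2 ^ l) : k = l :=
  zpow_right_injective₀ (by norm_num) (by norm_num) h

theorem RightSlope.unique {f : ℝ → ℝ} {t : ℝ} {k l : ℤ} (h : RightSlope f t k)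
    (h' : RightSlope f t l) : k = l := by
  obtain ⟨s, ⟨h1, h2⟩, h3⟩ := ((h.and h').and self_mem_nhdsWithin).exists
  have h4 : (0 : ℝ) < s - t := sub_pos.2 h3
  refine two_zpow_inj (mul_right_cancel₀ h4.ne' ?_)
  linarith

theorem tendsto_nhdsGT (f : ℝ ≃o ℝ) (t : ℝ) : Tendsto f (𝓝[>] t) (𝓝[>] (f t)) :=
  tendsto_nhdsWithin_iff.2 ⟨f.continuous.continuousAt.continuousWithinAt,
    eventually_mem_nhdsWithin.mono fun _ hs => f.strictMono hs⟩

theorem RightSlope.comp {f : ℝ → ℝ} {g : ℝ ≃o ℝ} {t : ℝ} {k l : ℤ}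
    (hf : RightSlope f (g t) k) (hg : RightSlope g t l) :
    RightSlope (fun s => f (g s)) t (k + l) := by
  filter_upwards [hg, (tendsto_nhdsGT g t).eventually hf] with s h1 h2
  rw [h2, h1, zpow_add₀ two_ne_zero]; ring

theorem RightSlope.symm {f : ℝ ≃o ℝ} {t : ℝ} {k : ℤ} (hf : RightSlope f t k) :
    RightSlope f.symm (f t) (-k) := by
  have h := (tendsto_nhdsGT f.symm (f t)).eventually
    (p := fun s => f s = f t + 2 ^ k * (s - t)) (by rw [f.symm_apply_apply]; exact hf)
  filter_upwards [h] with s h1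
  rw [f.apply_symm_apply] at h1
  rw [f.symm_apply_apply, zpow_neg]
  field_simp
  linarith

theorem AffAt.comp {f : ℝ → ℝ} {g : ℝ ≃o ℝ} {t : ℝ}
    (hf : AffAt f (g t)) (hg : AffAt g t) : AffAt (fun s => f (g s)) t := by
  obtain ⟨k, hk⟩ := hf
  obtain ⟨l, hl⟩ := hg
  refine ⟨k + l, ?_⟩
  filter_upwards [hl, g.continuous.continuousAt.eventually hk] with s h1 h2
  rw [h2, h1, zpow_add₀ two_ne_zero]; ring

theorem AffAt.symm {f : ℝ ≃o ℝ} {t : ℝ} (hf : AffAt f t) : AffAt f.symm (f t) := by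
  obtain ⟨k, hk⟩ := hf
  refine ⟨-k, ?_⟩
  have h := (f.symm.continuous.continuousAt (x := f t)).eventually
    (p := fun s => f s = f t + 2 ^ k * (s - t)) (by rw [f.symm_apply_apply]; exact hk)
  filter_upwards [h] with s h1
  rw [f.apply_symm_apply] at h1
  rw [f.symm_apply_apply, zpow_neg]
  field_simp
  linarith

theorem AffAt.congr {f g : ℝ → ℝ} {t : ℝ} (hf : AffAt f t) (h : f =ᶠ[𝓝 t] g) : AffAt g t := by
  obtain ⟨k, hk⟩ := hf
  refine ⟨k, ?_⟩
  filter_upwards [hk, h] with s h1 h2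
  rw [← h2, ← h.self_of_nhds, h1]

theorem affAt_of_Ioo {f : ℝ → ℝ} {a b c : ℝ} {k : ℤ} {t : ℝ} (ht : t ∈ Ioo a b)
    (h : ∀ s ∈ Ioo a b, f s = c + 2 ^ k * s) : AffAt f t := by
  refine ⟨k, ?_⟩
  filter_upwards [Ioo_mem_nhds ht.1 ht.2] with s hs
  rw [h s hs, h t ht]; ring

/-- A piecewise affine function of level `N` can only break at multiples of `2 ^ (-N)`. -/
theorem Lev.affAt {N : ℕ} {f : ℝ → ℝ} (hf : Lev N f) {t : ℝ} (ht : ¬ TwoBdd N t) :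
    AffAt f t := by
  obtain ⟨j, hj⟩ := exists_mem_Ico_grid N t
  obtain ⟨k, m, hk, h⟩ := hf j
  have hne : (j : ℝ) / 2 ^ N ≠ t := fun h => ht (h ▸ TwoBdd.int_div _ _)
  refine affAt_of_Ioo (c := m / 2 ^ (2 * N) - 2 ^ k * (j / 2 ^ N)) (k := k)
    ⟨lt_of_le_of_ne hj.1 hne, hj.2⟩ fun s hs => ?_
  rw [h s (Ioo_subset_Icc_self hs)]; ring

/-! ### Bumps -/

/-- `g` conjugates `y` to `x`, and `x`, `y` and their inverses are of level `N`. -/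
structure ConjData (N : ℕ) (x y g : ℝ ≃o ℝ) : Prop where
  comm : ∀ t, x (g t) = g (y t)
  levX : Lev N x
  levX' : Lev N x.symm
  levY : Lev N y
  levY' : Lev N y.symm

namespace ConjData

variable {N : ℕ} {x y g : ℝ ≃o ℝ}

theorem inv (S : ConjData N x y g) : ConjData N x.symm y.symm g where
  comm t := by rw [x.symm_apply_eq, S.comm]; simp
  levX := S.levX'
  levX' := S.levX
  levY := S.levY'
  levY' := S.levY

theorem swap (S : ConjData N x y g) : ConjData N y x g.symm where
  comm t := by rw [← g.apply_eq_iff_eq, ← S.comm]; simp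
  levX := S.levY
  levX' := S.levY'
  levY := S.levX
  levY' := S.levX'

theorem refl (S : ConjData N x y g) : ConjData N (reflIso x) (reflIso y) (reflIso g) where
  comm t := by simp [S.comm]
  levX := S.levX.reflIso
  levX' := S.levX'.reflIso
  levY := S.levY.reflIso
  levY' := S.levY'.reflIso

theorem comm_iterate (S : ConjData N x y g) (n : ℕ) (t : ℝ) : x^[n] (g t) = g (y^[n] t) :=
  ((Function.Semiconj.iterate_right (f := g) (ga := y) (gb := x)
    (fun t => (S.comm t).symm) n) t).symm

end ConjData

/-- `p < p'` are fixed points of `f`, and `f` moves all points between them to the right. -/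
structure Bump (f : ℝ ≃o ℝ) (p p' : ℝ) : Prop where
  lt : p < p'
  left : f p = p
  right : f p' = p'
  gt : ∀ t ∈ Ioo p p', t < f t

namespace Bump

variable {N : ℕ} {x y g f : ℝ ≃o ℝ} {p p' : ℝ}

theorem reflIso_symm (hb : Bump f p p') : Bump (reflIso f.symm) (-p') (-p) where
  lt := neg_lt_neg hb.lt
  left := by simp [f.symm_apply_eq, hb.right]
  right := by simp [f.symm_apply_eq, hb.left]
  gt t ht := by
    have h1 : f.symm (-t) < f.symm (f (-t)) :=
      f.symm.strictMono (hb.gt (-t) ⟨by linarith [ht.2], by linarith [ht.1]⟩)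
    rw [f.symm_apply_apply] at h1
    rw [reflIso_apply]; linarith

theorem image (hb : Bump y p p') (S : ConjData N x y g) : Bump x (g p) (g p') where
  lt := g.strictMono hb.lt
  left := by rw [S.comm, hb.left]
  right := by rw [S.comm, hb.right]
  gt t ht := by
    obtain ⟨u, rfl⟩ := g.surjective t
    rw [S.comm]
    exact g.strictMono (hb.gt u ⟨g.lt_iff_lt.1 ht.1, g.lt_iff_lt.1 ht.2⟩)

theorem iterate_mem (hb : Bump f p p') {t : ℝ} (ht : t ∈ Ioo p p') (n : ℕ) :
    f^[n] t ∈ Ioo p p' := by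
  induction n with
  | zero => exact ht
  | succ n ih =>
    rw [Function.iterate_succ_apply']
    exact ⟨ih.1.trans (hb.gt _ ih), by rw [← hb.right]; exact f.strictMono ih.2⟩

theorem symm_mem (hb : Bump f p p') {t : ℝ} (ht : t ∈ Ioo p p') : f.symm t ∈ Ioo p p' :=
  ⟨by rw [f.lt_symm_apply, hb.left]; exact ht.1, by rw [f.symm_apply_lt, hb.right]; exact ht.2⟩

theorem symm_iterate_mem (hb : Bump f p p') {t : ℝ} (ht : t ∈ Ioo p p') (n : ℕ) :
    f.symm^[n] t ∈ Ioo p p' := by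
  induction n with
  | zero => exact ht
  | succ n ih => rw [Function.iterate_succ_apply']; exact hb.symm_mem ih

/-- Inside a bump the displacement is bounded below by the distance to the two fixed points: on
each linear piece it is an affine function whose values at interior points of the subdivision are
positive multiples of `2 ^ (-2 N)`. -/
theorem disp (hb : Bump f p p') (hf : Lev N f) (hlen : p' - p ≤ 1) {t : ℝ} (ht : t ∈ Icc p p') :
    1 / 2 ^ (2 * N) * min (t - p) (p' - t) ≤ f t - t := by
  rcases eq_or_lt_of_le ht.1 with rfl | h1
  · rw [hb.left, sub_self, min_eq_left (by linarith [ht.2])]; simp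
  rcases eq_or_lt_of_le ht.2 with rfl | h2
  · rw [hb.right, sub_self, min_eq_right (by linarith)]; simp
  have hpos := hb.gt t ⟨h1, h2⟩
  obtain ⟨j, hj⟩ := exists_mem_Ico_grid N t
  obtain ⟨k, m, hk, h⟩ := hf j
  have ga : (j : ℝ) / 2 ^ N ∈ Ioo p p' → 1 / 2 ^ (2 * N) ≤ f (j / 2 ^ N) - (j : ℝ) / 2 ^ N :=
    fun h => hf.grid_disp j (hb.gt _ h)
  have gb : (j + 1 : ℝ) / 2 ^ N ∈ Ioo p p' →
      1 / 2 ^ (2 * N) ≤ f ((j + 1) / 2 ^ N) - (j + 1 : ℝ) / 2 ^ N := fun h => by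
    have := hf.grid_disp (j + 1) (by push_cast; exact hb.gt _ h)
    push_cast at this
    exact this
  have hab : (j + 1 : ℝ) / 2 ^ N - j / 2 ^ N ≤ 1 := by
    rw [add_div, add_sub_cancel_left]
    exact div_le_one_of_le₀ (one_le_pow₀ (by norm_num)) (by positivity)
  have hμ0 : (0 : ℝ) < 1 / 2 ^ (2 * N) := by positivity
  have hmin1 := min_le_left (t - p) (p' - t)
  have hmin2 := min_le_right (t - p) (p' - t)
  generalize hμ : (1 : ℝ) / 2 ^ (2 * N) = μ at *
  generalize hc : (m : ℝ) / 2 ^ (2 * N) = c at *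
  generalize (2 : ℝ) ^ k = κ at *
  generalize ha : (j : ℝ) / 2 ^ N = a at *
  generalize hb' : (j + 1 : ℝ) / 2 ^ N = b at *
  generalize min (t - p) (p' - t) = r at *
  have et := h t ⟨hj.1, hj.2.le⟩
  have hlt : a < b := lt_of_le_of_lt hj.1 hj.2
  rcases le_or_gt a p with hap | hap <;> rcases le_or_gt p' b with hbp | hbp
  · exfalso
    have e1 := h p ⟨hap, by linarith⟩
    have e2 := h p' ⟨by linarith, hbp⟩
    rw [hb.left] at e1
    rw [hb.right] at e2
    have e3 : (κ - 1) * (p' - p) = 0 := by linarith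
    rcases mul_eq_zero.1 e3 with e4 | e4
    · have : κ = 1 := by linarith
      subst this; linarith
    · linarith
  · have e1 := h p ⟨hap, by linarith [hj.2]⟩
    rw [hb.left] at e1
    have e2 := h b ⟨hlt.le, le_rfl⟩
    have g1 := gb ⟨by linarith [hj.2], hbp⟩
    have e3 : (f t - t) * (b - p) = (f b - b) * (t - p) := by
      have : c = p - κ * (p - a) := by linarith
      rw [et, e2, this]; ring
    calc μ * r ≤ μ * (t - p) := by gcongr
      _ ≤ (f b - b) * (t - p) := by gcongr
      _ = (f t - t) * (b - p) := e3.symm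
      _ ≤ (f t - t) * 1 := by gcongr; linarith
      _ = _ := mul_one _
  · have e1 := h p' ⟨by linarith [hj.1], hbp⟩
    rw [hb.right] at e1
    have e2 := h a ⟨le_rfl, hlt.le⟩
    have g1 := ga ⟨hap, by linarith [hj.1]⟩
    have e3 : (f t - t) * (p' - a) = (f a - a) * (p' - t) := by
      have : c = p' - κ * (p' - a) := by linarith
      rw [et, e2, this]; ring
    calc μ * r ≤ μ * (p' - t) := by gcongr
      _ ≤ (f a - a) * (p' - t) := by gcongr
      _ = (f t - t) * (p' - a) := e3.symm
      _ ≤ (f t - t) * 1 := by gcongr; linarith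
      _ = _ := mul_one _
  · have e1 := h a ⟨le_rfl, hlt.le⟩
    have e2 := h b ⟨hlt.le, le_rfl⟩
    have g1 := ga ⟨hap, by linarith [hj.1]⟩
    have g2 := gb ⟨by linarith [hj.2], hbp⟩
    have e3 : (f t - t) * (b - a) = (f a - a) * (b - t) + (f b - b) * (t - a) := by
      rw [et, e1, e2]; ring
    have e4 : μ * (b - a) ≤ (f t - t) * (b - a) := by
      rw [e3]
      calc μ * (b - a) = μ * (b - t) + μ * (t - a) := by ring
        _ ≤ _ := by gcongr <;> linarith [hj.1, hj.2]
    have e5 := le_of_mul_le_mul_right e4 (by linarith)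
    calc μ * r ≤ μ * 1 := by gcongr; linarith
      _ ≤ _ := by linarith

/-- Near its left end a bump is linear with slope at least `2`, on a zone of length bounded below in
terms of the level only. -/
theorem germ (hb : Bump f p p') (hf : Lev N f) :
    ∃ s : ℤ, 1 ≤ s ∧ s ≤ N ∧ 1 / 2 ^ (2 * N) ≤ p' - (p + 1 / 2 ^ (3 * N)) ∧
      ∀ t ∈ Icc p (p + 1 / 2 ^ (3 * N)), f t = p + 2 ^ s * (t - p) := by
  obtain ⟨j, hj⟩ := exists_mem_Ico_grid N p
  obtain ⟨k, m, hk, h⟩ := hf j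
  have gb : (j + 1 : ℝ) / 2 ^ N ∈ Ioo p p' →
      1 / 2 ^ (2 * N) ≤ f ((j + 1) / 2 ^ N) - (j + 1 : ℝ) / 2 ^ N := fun h => by
    have := hf.grid_disp (j + 1) (by push_cast; exact hb.gt _ h)
    push_cast at this
    exact this
  have hk2 : (2 : ℝ) ^ k ≤ 2 ^ N := by
    rw [← zpow_natCast]
    exact zpow_le_zpow_right₀ (by norm_num) (abs_le.1 hk).2
  have hδ : (1 : ℝ) / 2 ^ (2 * N) = 1 / 2 ^ (3 * N) * 2 ^ N := by
    rw [show 3 * N = 2 * N + N by ring, pow_add]; field_simp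
  have hN1 : (1 : ℝ) ≤ 2 ^ N := one_le_pow₀ (by norm_num)
  have hδ0 : (0 : ℝ) < 1 / 2 ^ (3 * N) := by positivity
  generalize hc : (m : ℝ) / 2 ^ (2 * N) = c at *
  generalize ha : (j : ℝ) / 2 ^ N = a at *
  generalize hb' : (j + 1 : ℝ) / 2 ^ N = b at *
  generalize (1 : ℝ) / 2 ^ (2 * N) = μ at *
  generalize (1 : ℝ) / 2 ^ (3 * N) = δ at *
  have ep := h p ⟨hj.1, hj.2.le⟩
  rw [hb.left] at ep
  have h' : ∀ t ∈ Icc a b, f t = p + 2 ^ k * (t - p) := fun t ht => by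
    rw [h t ht]; linarith
  have hlt := hb.lt
  have hbp : b < p' := by
    by_contra hbp
    have e1 := h' p' ⟨by linarith [hj.1], by linarith⟩
    rw [hb.right] at e1
    have e2 : (2 : ℝ) ^ k = 1 := by
      have : ((2 : ℝ) ^ k - 1) * (p' - p) = 0 := by linarith
      rcases mul_eq_zero.1 this with e | e <;> linarith
    have e3 := h' ((p + p') / 2) ⟨by linarith [hj.1], by linarith⟩
    have e4 := hb.gt ((p + p') / 2) ⟨by linarith, by linarith⟩
    rw [e3, e2] at e4; linarith
  have g1 := gb ⟨hj.2, hbp⟩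
  have e1 := h' b ⟨by linarith [hj.1, hj.2], le_rfl⟩
  have hfb : f b < p' := by rw [← hb.right]; exact f.strictMono hbp
  have hbpos := hj.2
  have hk1 : (1 : ℝ) < 2 ^ k := by
    by_contra hk1
    have : (2 : ℝ) ^ k * (b - p) ≤ 1 * (b - p) := by gcongr; linarith
    nlinarith
  have hδb : δ ≤ b - p := by
    have : δ * 2 ^ N ≤ (b - p) * 2 ^ N := by
      calc δ * 2 ^ N = μ := hδ.symm
        _ ≤ 2 ^ k * (b - p) := by linarith
        _ ≤ 2 ^ N * (b - p) := by gcongr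
        _ = _ := mul_comm _ _
    exact le_of_mul_le_mul_right this (by positivity)
  refine ⟨k, ?_, (abs_le.1 hk).2, by linarith, fun t ht => h' t ⟨by linarith [hj.1, ht.1], by
    linarith [ht.2]⟩⟩
  by_contra hk0
  have : (2 : ℝ) ^ k ≤ 2 ^ (0 : ℤ) := zpow_le_zpow_right₀ (by norm_num) (by omega)
  rw [zpow_zero] at this
  linarith

/-- The statement of `germ` at the right end, where the slope is at most `1 / 2`. -/
theorem germ_left (hb : Bump f p p') (hf' : Lev N f.symm) :
    ∃ s : ℤ, 1 ≤ s ∧ s ≤ N ∧ 1 / 2 ^ (2 * N) ≤ p' - 1 / 2 ^ (3 * N) - p ∧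
      ∀ t ∈ Icc (p' - 1 / 2 ^ (3 * N)) p', f t = p' + 2 ^ (-s) * (t - p') := by
  obtain ⟨s, h1, h2, h3, h4⟩ := hb.reflIso_symm.germ hf'.reflIso
  refine ⟨s, h1, h2, by linarith, fun t ht => ?_⟩
  have hs : (2 : ℝ) ^ (-s) ≤ 2 ^ (0 : ℤ) := zpow_le_zpow_right₀ (by norm_num) (by omega)
  rw [zpow_zero] at hs
  have hs0 : (0 : ℝ) < 2 ^ (-s) := by positivity
  have ht1 : 2 ^ (-s) * (p' - t) ≤ 1 * (p' - t) := by gcongr; linarith [ht.2]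
  have ht0 : 0 ≤ 2 ^ (-s) * (p' - t) := mul_nonneg hs0.le (by linarith [ht.2])
  have e := h4 (-p' + 2 ^ (-s) * (p' - t)) ⟨by linarith, by linarith [ht.1]⟩
  rw [reflIso_apply, add_sub_cancel_left, ← mul_assoc, ← zpow_add₀ two_ne_zero, add_neg_cancel,
    zpow_zero] at e
  have e2 : f.symm (-(-p' + 2 ^ (-s) * (p' - t))) = t := by linarith
  rw [f.symm_apply_eq] at e2
  rw [← e2]; ring

/-- Points of a bump at distance at least `η` from the left end come within `η'` of the right end
after `n` steps. -/
theorem lt_iterate (hb : Bump f p p') (hf : Lev N f) (hlen : p' - p ≤ 1) {η η' t : ℝ}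
    (hη : 0 < η) (hη' : 0 < η')
    (ht : p + η ≤ t) (ht' : t < p') {n : ℕ} (hn : 1 ≤ n * (1 / 2 ^ (2 * N) * min η η')) :
    p' - η' < f^[n] t := by
  have hmem := hb.iterate_mem (t := t) ⟨by linarith, ht'⟩
  have hμ : (0 : ℝ) < 1 / 2 ^ (2 * N) * min η η' := mul_pos (by positivity) (lt_min hη hη')
  have key : ∀ n : ℕ, p' - η' < f^[n] t ∨ t + n * (1 / 2 ^ (2 * N) * min η η') ≤ f^[n] t := by
    intro n
    induction n with
    | zero => right; simp
    | succ n ih =>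
      have h0 := hmem n
      rw [Function.iterate_succ_apply']
      rcases ih with ih | ih
      · exact Or.inl (ih.trans (hb.gt _ h0))
      · rcases lt_or_ge (p' - η') (f^[n] t) with h | h
        · exact Or.inl (h.trans (hb.gt _ h0))
        · right
          have h1 := hb.disp hf hlen (Ioo_subset_Icc_self h0)
          have h2 : (0 : ℝ) ≤ n * (1 / 2 ^ (2 * N) * min η η') := by positivity
          have h3 : min η η' ≤ min (f^[n] t - p) (p' - f^[n] t) :=
            min_le_min (by linarith) (by linarith)
          have h4 : 1 / 2 ^ (2 * N) * min η η' ≤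
            1 / 2 ^ (2 * N) * min (f^[n] t - p) (p' - f^[n] t) := by gcongr
          push_cast
          linarith
  rcases key n with h | h
  · exact h
  · have := (hmem n).2
    linarith

/-- An orbit cannot approach the right end of a bump faster than geometrically. -/
theorem le_sub_iterate (hb : Bump f p p') (hf' : Lev N f.symm) {t : ℝ} (ht : t ∈ Ioo p p')
    (h : 1 / 2 ^ (3 * N) ≤ p' - t) (n : ℕ) :
    1 / 2 ^ (N * n + 3 * N) ≤ p' - f^[n] t := by
  obtain ⟨s, h1, h2, -, h4⟩ := hb.germ_left hf'
  have hmem := hb.iterate_mem ht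
  have hs : 1 / 2 ^ N ≤ (2 : ℝ) ^ (-s) := by
    rw [one_div, ← zpow_natCast, ← zpow_neg]
    exact zpow_le_zpow_right₀ (by norm_num) (by omega)
  induction n with
  | zero => simpa using h
  | succ n ih =>
    have h0 := hmem n
    rw [Function.iterate_succ_apply']
    have hδ : (1 : ℝ) / 2 ^ (N * n + 3 * N) ≤ 1 / 2 ^ (3 * N) := by
      gcongr
      · norm_num
      · omega
    have e : (1 : ℝ) / 2 ^ (N * (n + 1) + 3 * N) = 1 / 2 ^ N * (1 / 2 ^ (N * n + 3 * N)) := by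
      rw [show N * (n + 1) + 3 * N = N + (N * n + 3 * N) by ring, pow_add]; field_simp
    rw [e]
    rcases le_or_gt (p' - 1 / 2 ^ (3 * N)) (f^[n] t) with h5 | h5
    · rw [h4 _ ⟨h5, h0.2.le⟩]
      calc 1 / 2 ^ N * (1 / 2 ^ (N * n + 3 * N)) ≤ 2 ^ (-s) * (p' - f^[n] t) := by gcongr
        _ = _ := by ring
    · have h6 := f.strictMono h5
      rw [h4 _ ⟨le_rfl, by linarith [show (0 : ℝ) < 1 / 2 ^ (3 * N) by positivity]⟩] at h6
      calc (1 : ℝ) / 2 ^ N * (1 / 2 ^ (N * n + 3 * N)) ≤ 2 ^ (-s) * (1 / 2 ^ (3 * N)) := by gcongr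
        _ ≤ _ := by linarith

end Bump

/-! ### Spreading of linearity from the ends of a bump -/

namespace Bump

variable {N : ℕ} {x y g f : ℝ ≃o ℝ} {p p' : ℝ}

/-- The affine germ of a conjugator at the repelling end of a bump extends over each `η` for which
its graph stays in the square where both maps are linear, because `g = x ∘ g ∘ y⁻¹` spreads it. -/
theorem conj_affine_of_le (hb : Bump y p p') (S : ConjData N x y g) {k : ℤ}
    (hk : RightSlope g p k) {η : ℝ} (h1 : η ≤ 1 / 2 ^ (3 * N))
    (h2 : 2 ^ k * η ≤ 1 / 2 ^ (3 * N)) :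
    ∀ t ∈ Icc p (p + η), g t = g p + 2 ^ k * (t - p) := by
  obtain ⟨s, hs1, -, -, hy⟩ := hb.germ S.levY
  obtain ⟨s', -, -, -, hx⟩ := (hb.image S).germ S.levX
  have hyS : RightSlope y p s := RightSlope.of_Icc (ε := 1 / 2 ^ (3 * N)) (by positivity)
    fun t ht => by rw [hy t ht, hb.left]
  have hxS : RightSlope x (g p) s' := RightSlope.of_Icc (ε := 1 / 2 ^ (3 * N)) (by positivity)
    fun t ht => by rw [hx t ht, (hb.image S).left]
  have hss : s' = s := by
    have e1 := hxS.comp hk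
    have e2 := RightSlope.comp (f := g) (g := y) (t := p) (by rw [hb.left]; exact hk) hyS
    have e3 : (fun t => x (g t)) = fun t => g (y t) := funext S.comm
    rw [e3] at e1
    have := e1.unique e2
    omega
  subst hss
  obtain ⟨ε, hε, hg⟩ := hk.exists_pos
  have hs2 : (2 : ℝ) ≤ 2 ^ s' := by
    calc (2 : ℝ) = 2 ^ (1 : ℤ) := by simp
      _ ≤ _ := zpow_le_zpow_right₀ (by norm_num) hs1
  have hs0 : (0 : ℝ) < 2 ^ s' := by positivity
  have hk0 : (0 : ℝ) < 2 ^ k := by positivity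
  have key : ∀ n : ℕ, ∀ t ∈ Icc p (p + η), t - p ≤ 2 ^ n * ε → g t = g p + 2 ^ k * (t - p) := by
    intro n
    induction n with
    | zero =>
      intro t ht h
      exact hg t ⟨ht.1, by linarith⟩
    | succ n ih =>
      intro t ht h
      have ht0 : 0 ≤ t - p := sub_nonneg.2 ht.1
      have hle : (t - p) / 2 ^ s' ≤ (t - p) / 2 := by gcongr
      have hnn : 0 ≤ (t - p) / 2 ^ s' := by positivity
      have hu : p + (t - p) / 2 ^ s' ∈ Icc p (p + η) :=
        ⟨by linarith, by linarith [ht.2]⟩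
      have e1 := ih _ hu (by rw [pow_succ] at h; linarith)
      have e2 := hy _ ⟨hu.1, by linarith [hu.2]⟩
      rw [add_sub_cancel_left] at e1 e2
      have e3 : p + 2 ^ s' * ((t - p) / 2 ^ s') = t := by field_simp; ring
      rw [e3] at e2
      have h4 : 2 ^ k * ((t - p) / 2 ^ s') ≤ 2 ^ k * η := by
        gcongr; linarith [ht.2]
      have e5 := hx (g p + 2 ^ k * ((t - p) / 2 ^ s'))
        ⟨by linarith [mul_nonneg hk0.le hnn], by linarith⟩
      rw [← e1, S.comm, e2, e1] at e5
      rw [e5]; field_simp; ring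
  intro t ht
  obtain ⟨n, hn⟩ := pow_unbounded_of_one_lt (η / ε) (one_lt_two)
  refine key n t ht ?_
  rw [div_lt_iff₀ hε] at hn
  linarith [ht.2]

/-- A conjugator is linear as far as its graph stays in the square in which both maps are linear. -/
theorem conj_affine_of_mem (hb : Bump y p p') (S : ConjData N x y g) {k : ℤ}
    (hk : RightSlope g p k) {t : ℝ} (ht : t ∈ Icc p (p + 1 / 2 ^ (3 * N)))
    (hgt : g t ≤ g p + 1 / 2 ^ (3 * N)) :
    ∀ u ∈ Icc p t, g u = g p + 2 ^ k * (u - p) := by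
  have hk0 : (0 : ℝ) < 2 ^ k := by positivity
  rcases le_or_gt (2 ^ k * (t - p)) (1 / 2 ^ (3 * N)) with h | h
  · have := hb.conj_affine_of_le S hk (η := t - p) (by linarith [ht.2]) h
    rwa [add_sub_cancel] at this
  · exfalso
    have hη : 1 / 2 ^ (3 * N) / 2 ^ k < t - p := by
      rw [div_lt_iff₀ hk0]; linarith
    have hη0 : (0 : ℝ) < 1 / 2 ^ (3 * N) / 2 ^ k := by positivity
    have e := hb.conj_affine_of_le S hk (η := 1 / 2 ^ (3 * N) / 2 ^ k) (by linarith [ht.2])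
      (by rw [mul_div_cancel₀ _ hk0.ne']) (p + 1 / 2 ^ (3 * N) / 2 ^ k) ⟨by linarith, le_rfl⟩
    rw [add_sub_cancel_left, mul_div_cancel₀ _ hk0.ne'] at e
    have h3 : g (p + 1 / 2 ^ (3 * N) / 2 ^ k) < g t := g.strictMono (by linarith)
    linarith

theorem conj_affine_left_of_le (hb : Bump y p p') (S : ConjData N x y g) {k : ℤ}
    (hk : LeftSlope g p' k) {η : ℝ} (h1 : η ≤ 1 / 2 ^ (3 * N))
    (h2 : 2 ^ k * η ≤ 1 / 2 ^ (3 * N)) :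
    ∀ t ∈ Icc (p' - η) p', g t = g p' + 2 ^ k * (t - p') := by
  intro t ht
  have := hb.reflIso_symm.conj_affine_of_le S.inv.refl ((leftSlope_iff _ _ _).1 hk) h1 h2 (-t)
    ⟨by linarith [ht.2], by linarith [ht.1]⟩
  simp only [reflIso_apply, neg_neg] at this
  linarith

theorem conj_affine_left_of_mem (hb : Bump y p p') (S : ConjData N x y g) {k : ℤ}
    (hk : LeftSlope g p' k) {t : ℝ} (ht : t ∈ Icc (p' - 1 / 2 ^ (3 * N)) p')
    (hgt : g p' - 1 / 2 ^ (3 * N) ≤ g t) :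
    ∀ u ∈ Icc t p', g u = g p' + 2 ^ k * (u - p') := by
  intro u hu
  have := hb.reflIso_symm.conj_affine_of_mem S.inv.refl ((leftSlope_iff _ _ _).1 hk) (t := -t)
    ⟨by linarith [ht.2], by linarith [ht.1]⟩ (by
      rw [reflIso_apply, reflIso_apply, neg_neg, neg_neg]; linarith) (-u)
    ⟨by linarith [hu.2], by linarith [hu.1]⟩
  simp only [reflIso_apply, neg_neg] at this
  linarith

end Bump

theorem two_zpow_le_pow {k : ℤ} {K : ℕ} (hk : |k| ≤ K) : (2 : ℝ) ^ k ≤ 2 ^ K := by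
  rw [← zpow_natCast]
  exact zpow_le_zpow_right₀ (by norm_num) (abs_le.1 hk).2

theorem one_div_pow_le_two_zpow {k : ℤ} {K : ℕ} (hk : |k| ≤ K) : 1 / 2 ^ K ≤ (2 : ℝ) ^ k := by
  rw [one_div, ← zpow_natCast, ← zpow_neg]
  exact zpow_le_zpow_right₀ (by norm_num) (abs_le.1 hk).1

theorem one_div_two_pow_anti {m n : ℕ} (h : m ≤ n) : (1 : ℝ) / 2 ^ n ≤ 1 / 2 ^ m :=
  one_div_pow_le_one_div_pow_of_le (by norm_num) h

/-! ### Slopes at the two ends of a bump -/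

/-- If the initial slope of a conjugator on a bump is at most `2 ^ K` and at least `2 ^ (-K)`,
then its final slope is bounded in the same way by `slopeBound N K`. -/
def slopeBound (N K : ℕ) : ℕ := N * 2 ^ (5 * N + 2 * K) + 3 * N + K

namespace Bump

variable {N : ℕ} {x y g f : ℝ ≃o ℝ} {p p' : ℝ}

/-- The orbit of a point near the left end reaches the linear zone at the right end after a bounded
number of steps, and so does the image of this orbit under `g`. Both stay at a bounded distance from
the right end, and the quotient of the two distances is the final slope of `g`. -/
theorem abs_leftSlope_le (hb : Bump y p p') (S : ConjData N x y g) (hlen : p' - p ≤ 1)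
    (hlen' : g p' - g p ≤ 1) {k k' : ℤ} {K : ℕ} (hK : |k| ≤ K) (hk : RightSlope g p k)
    (hk' : LeftSlope g p' k') : |k'| ≤ slopeBound N K := by
  have hb' := hb.image S
  obtain ⟨-, -, -, hy, -⟩ := hb.germ S.levY
  obtain ⟨-, -, -, hx, -⟩ := hb'.germ S.levX
  have hμδ : (1 : ℝ) / 2 ^ (3 * N) ≤ 1 / 2 ^ (2 * N) := one_div_two_pow_anti (by omega)
  have hη : (1 : ℝ) / 2 ^ (3 * N + K) ≤ 1 / 2 ^ (3 * N) := one_div_two_pow_anti (by omega)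
  have hη2 : (1 : ℝ) / 2 ^ (3 * N + 2 * K) ≤ 1 / 2 ^ (3 * N + K) :=
    one_div_two_pow_anti (by omega)
  have hη0 : (0 : ℝ) < 1 / 2 ^ (3 * N + K) := by positivity
  have hη20 : (0 : ℝ) < 1 / 2 ^ (3 * N + 2 * K) := by positivity
  have hkη : (2 : ℝ) ^ k * (1 / 2 ^ (3 * N + K)) ≤ 1 / 2 ^ (3 * N) := by
    calc (2 : ℝ) ^ k * (1 / 2 ^ (3 * N + K)) ≤ 2 ^ K * (1 / 2 ^ (3 * N + K)) := by
          gcongr; exact two_zpow_le_pow hK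
      _ = _ := by rw [pow_add]; field_simp
  have hkη2 : 1 / 2 ^ (3 * N + 2 * K) ≤ (2 : ℝ) ^ k * (1 / 2 ^ (3 * N + K)) := by
    calc (1 : ℝ) / 2 ^ (3 * N + 2 * K) = 1 / 2 ^ K * (1 / 2 ^ (3 * N + K)) := by
          rw [show 3 * N + 2 * K = K + (3 * N + K) by ring, pow_add]; field_simp
      _ ≤ _ := by gcongr; exact one_div_pow_le_two_zpow hK
  have ha := hb.conj_affine_of_le S hk hη hkη (p + 1 / 2 ^ (3 * N + K)) ⟨by linarith, le_rfl⟩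
  rw [add_sub_cancel_left] at ha
  set a := p + 1 / 2 ^ (3 * N + K) with had
  have hδ0 : (0 : ℝ) < 1 / 2 ^ (3 * N) := by positivity
  -- the number of steps after which both orbits have reached the linear zone at the right end
  set n := 2 ^ (5 * N + 2 * K) with hn
  have hn1 : (1 : ℝ) ≤ n * (1 / 2 ^ (2 * N) * min (1 / 2 ^ (3 * N + 2 * K)) (1 / 2 ^ (3 * N))) := by
    rw [min_eq_left (hη2.trans hη), hn]
    push_cast
    apply le_of_eq
    rw [show 5 * N + 2 * K = 2 * N + (3 * N + 2 * K) by ring, pow_add]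
    field_simp
  have hu := hb.lt_iterate S.levY hlen hη20 hδ0 (t := a) (by linarith) (by linarith) hn1
  have hv := hb'.lt_iterate S.levX hlen' hη20 hδ0 (t := g a) (by linarith) (by linarith) hn1
  have hua := hb.le_sub_iterate S.levY' (t := a) ⟨by linarith, by linarith⟩ (by linarith) n
  have hva := hb'.le_sub_iterate S.levX' (t := g a) ⟨by linarith, by linarith⟩ (by linarith) n
  have hum := hb.iterate_mem (t := a) ⟨by linarith, by linarith⟩ n
  rw [S.comm_iterate] at hv hva
  set u := y^[n] a with hud
  have e := hb.conj_affine_left_of_mem S hk' (t := u) ⟨hu.le, hum.2.le⟩ hv.le u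
    ⟨le_rfl, hum.2.le⟩
  have hgu : g p < g u := g.strictMono hum.1
  have hb1 : N * n + 3 * N ≤ slopeBound N K := by unfold slopeBound; rw [← hn]; omega
  have e2 : (2 : ℝ) ^ k' * (p' - u) = g p' - g u := by linarith
  have hk0 : (0 : ℝ) < 2 ^ k' := by positivity
  have hup := hum.1
  rw [abs_le]
  constructor
  · have h1 : (1 : ℝ) / 2 ^ (N * n + 3 * N) ≤ 2 ^ k' := by
      calc (1 : ℝ) / 2 ^ (N * n + 3 * N) ≤ 2 ^ k' * (p' - u) := by rw [e2]; exact hva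
        _ ≤ 2 ^ k' * 1 := by gcongr; linarith
        _ = _ := mul_one _
    rw [one_div, ← zpow_natCast, ← zpow_neg, zpow_le_zpow_iff_right₀ (by norm_num)] at h1
    omega
  · have h1 : (2 : ℝ) ^ k' ≤ 2 ^ (N * n + 3 * N) := by
      have h2 : (2 : ℝ) ^ k' * (1 / 2 ^ (N * n + 3 * N)) ≤ 1 := by
        calc (2 : ℝ) ^ k' * (1 / 2 ^ (N * n + 3 * N)) ≤ 2 ^ k' * (p' - u) := by gcongr
          _ ≤ _ := by linarith
      rwa [mul_one_div, div_le_one (by positivity)] at h2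
    rw [← zpow_natCast, zpow_le_zpow_iff_right₀ (by norm_num)] at h1
    omega

end Bump

/-! ### Denominators of a conjugator on a bump -/

theorem Lev.twoBdd_iterate {N : ℕ} {f : ℝ → ℝ} (hf : Lev N f) {M : ℕ} {t : ℝ} (ht : TwoBdd M t)
    (n : ℕ) : TwoBdd (M + 2 * N * n) (f^[n] t) := by
  induction n with
  | zero => exact ht.mono (by omega)
  | succ n ih =>
    rw [Function.iterate_succ_apply']
    exact (hf.twoBdd ih).mono (le_of_eq (by ring))

theorem TwoBdd.of_two_zpow_sub_one {M : ℕ} {t : ℝ} {k : ℤ} (hk : k ≠ 0)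
    (h : TwoBdd M ((2 ^ |k| - 1) * t)) : TwoBdd M t := by
  obtain ⟨d, hd⟩ := Int.eq_ofNat_of_zero_le (abs_nonneg k)
  have hd0 : d ≠ 0 := by rintro rfl; exact hk (abs_eq_zero.1 hd)
  rw [hd] at h
  refine TwoBdd.of_mul_odd (r := 2 ^ d - 1) ?_ ?_
  · exact Nat.Even.sub_odd Nat.one_le_two_pow ((Nat.even_pow' hd0).2 even_two) odd_one
  · rw [Nat.cast_sub Nat.one_le_two_pow]
    push_cast
    rwa [mul_comm, ← zpow_natCast]

/-- A fixed point near which `f` is not the identity solves `t = 2 ^ k * t + c` with `k ≠ 0`, so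
it has a bounded power of `2` in the denominator. -/
theorem Lev.twoBdd_fixed {N : ℕ} {f : ℝ → ℝ} (hf : Lev N f) {p : ℝ} (hp : f p = p)
    (hid : ¬ ∀ᶠ s in 𝓝 p, f s = s) : TwoBdd (2 * N) p := by
  obtain ⟨j, hj⟩ := exists_mem_Ico_grid N p
  obtain ⟨k, m, hk, h⟩ := hf j
  rcases eq_or_lt_of_le hj.1 with he | hlt
  · rw [← he]; exact (TwoBdd.int_div _ _).mono (by omega)
  have ep := h p ⟨hj.1, hj.2.le⟩
  have hk0 : k ≠ 0 := by
    rintro rfl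
    apply hid
    filter_upwards [Ioo_mem_nhds hlt hj.2] with s hs
    rw [hp] at ep
    rw [h s (Ioo_subset_Icc_self hs)]
    simp only [zpow_zero] at *
    linarith
  rw [hp] at ep
  have hm := TwoBdd.int_div m (2 * N)
  have hjN := TwoBdd.int_div j N
  have hka : |(|k|)| ≤ N := by rwa [abs_abs]
  generalize (m : ℝ) / 2 ^ (2 * N) = c at *
  generalize (j : ℝ) / 2 ^ N = a at *
  refine TwoBdd.of_two_zpow_sub_one hk0 ?_
  rcases lt_or_gt_of_ne hk0 with hneg | hpos
  · have e : (2 ^ |k| - 1) * p = 2 ^ |k| * c - a := by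
      have e1 : (2 : ℝ) ^ |k| * p = 2 ^ |k| * c + (p - a) := by
        have e2 : (2 : ℝ) ^ |k| * 2 ^ k = 1 := by
          rw [abs_of_neg hneg, ← zpow_add₀ two_ne_zero]; simp
        calc (2 : ℝ) ^ |k| * p = 2 ^ |k| * (c + 2 ^ k * (p - a)) := by rw [← ep]
          _ = 2 ^ |k| * c + (2 ^ |k| * 2 ^ k) * (p - a) := by ring
          _ = _ := by rw [e2, one_mul]
      linarith
    rw [e]
    obtain ⟨d, hd⟩ := Int.eq_ofNat_of_zero_le (abs_nonneg k)
    refine TwoBdd.sub ?_ (hjN.mono (by omega))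
    obtain ⟨m', q, hq, e3⟩ := hm
    refine ⟨2 ^ d * m', q, hq, ?_⟩
    rw [hd]; push_cast; rw [← e3, ← zpow_natCast (2 : ℝ) d]; ring_nf
  · have e : (2 ^ |k| - 1) * p = 2 ^ |k| * a - c := by
      rw [abs_of_pos hpos]; linarith
    rw [e]
    exact ((hjN.zpow_mul hka).mono (by omega)).sub hm

/-- The denominators occurring in a conjugator on a bump, when its slopes at both ends lie between
`2 ^ (-K)` and `2 ^ K`. -/
def denomBound (N K : ℕ) : ℕ := 5 * N + K + 6 * N * 2 ^ (5 * N + K)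

/-- `f` does not break at `t` unless `t` has denominator at most `2 ^ C` up to odd factors, and `f`
increases the power of `2` in the denominator of `t` by at most `C`. -/
def GoodAt (C : ℕ) (f : ℝ → ℝ) (t : ℝ) : Prop :=
  (¬ AffAt f t → TwoBdd C t) ∧ ∀ M, TwoBdd M t → TwoBdd (M + C) (f t)

theorem GoodAt.mono {C C' : ℕ} (h : C ≤ C') {f : ℝ → ℝ} {t : ℝ} (hf : GoodAt C f t) :
    GoodAt C' f t :=
  ⟨fun h' => (hf.1 h').mono h, fun M hM => (hf.2 M hM).mono (by omega)⟩

theorem affAt_of_Icc_affine {f : ℝ → ℝ} {a b c p : ℝ} {k : ℤ} {t : ℝ} (ht : t ∈ Ioo a b)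
    (h : ∀ s ∈ Icc a b, f s = c + 2 ^ k * (s - p)) : AffAt f t :=
  affAt_of_Ioo (c := c - 2 ^ k * p) ht fun s hs => by
    rw [h s (Ioo_subset_Icc_self hs)]; ring

namespace Bump

variable {N : ℕ} {x y g f : ℝ ≃o ℝ} {p p' : ℝ}

theorem not_eventually_id_left (hb : Bump f p p') : ¬ ∀ᶠ s in 𝓝 p, f s = s := by
  intro h
  have h1 : ∀ᶠ s in 𝓝[>] p, f s = s := h.filter_mono nhdsWithin_le_nhds
  obtain ⟨s, h2, h3⟩ := (h1.and (Ioo_mem_nhdsGT hb.lt)).exists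
  exact (hb.gt s h3).ne' h2

theorem not_eventually_id_right (hb : Bump f p p') : ¬ ∀ᶠ s in 𝓝 p', f s = s := by
  intro h
  have h1 : ∀ᶠ s in 𝓝[<] p', f s = s := h.filter_mono nhdsWithin_le_nhds
  obtain ⟨s, h2, h3⟩ := (h1.and (Ioo_mem_nhdsLT hb.lt)).exists
  exact (hb.gt s h3).ne' h2

theorem reflIso_iterate_neg (f : ℝ ≃o ℝ) (n : ℕ) (t : ℝ) :
    (reflIso f)^[n] (-t) = -(f^[n] t) := by
  induction n with
  | zero => rfl
  | succ n ih => rw [Function.iterate_succ_apply', Function.iterate_succ_apply', ih]; simp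

theorem symm_iterate_lt (hb : Bump f p p') (hf' : Lev N f.symm) (hlen : p' - p ≤ 1) {η t : ℝ}
    (hη : 0 < η) (ht : p < t) (ht' : t ≤ p' - η) {n : ℕ}
    (hn : 1 ≤ n * (1 / 2 ^ (2 * N) * η)) : f.symm^[n] t < p + η := by
  have := hb.reflIso_symm.lt_iterate hf'.reflIso (by linarith) hη hη (t := -t) (by linarith)
    (by linarith) (n := n) (by rwa [min_self])
  rw [reflIso_iterate_neg] at this
  linarith

theorem one_le_steps (N K : ℕ) :
    (1 : ℝ) ≤ ((2 ^ (5 * N + K) : ℕ) : ℝ) * (1 / 2 ^ (2 * N) * (1 / 2 ^ (3 * N + K))) := by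
  apply le_of_eq
  push_cast
  rw [show 5 * N + K = 2 * N + (3 * N + K) by ring, pow_add]
  field_simp

theorem small_scale {K : ℕ} {k : ℤ} (hK : |k| ≤ K) (N : ℕ) :
    (2 : ℝ) ^ k * (1 / 2 ^ (3 * N + K)) ≤ 1 / 2 ^ (3 * N) := by
  calc (2 : ℝ) ^ k * (1 / 2 ^ (3 * N + K)) ≤ 2 ^ K * (1 / 2 ^ (3 * N + K)) := by
        gcongr; exact two_zpow_le_pow hK
    _ = _ := by rw [pow_add]; field_simp

/-- A conjugator on a bump is `x ^ n ∘ g ∘ y ^ (-n)`, where `y ^ (-n)` takes the point to the linear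
zone of `g`, so it changes denominators by a bounded amount. -/
theorem twoBdd_conj (hb : Bump y p p') (S : ConjData N x y g) (hlen : p' - p ≤ 1)
    {k k' : ℤ} {K : ℕ} (hK : |k| ≤ K) (hK' : |k'| ≤ K) (hk : RightSlope g p k)
    (hk' : LeftSlope g p' k') {t : ℝ} (ht : t ∈ Ioo p p') {M : ℕ} (hM : TwoBdd M t) :
    TwoBdd (M + (4 * N * 2 ^ (5 * N + K) + K + 2 * N)) (g t) := by
  have hη : (1 : ℝ) / 2 ^ (3 * N + K) ≤ 1 / 2 ^ (3 * N) := one_div_two_pow_anti (by omega)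
  have hp := S.levY.twoBdd_fixed hb.left hb.not_eventually_id_left
  have hp' := S.levY.twoBdd_fixed hb.right hb.not_eventually_id_right
  have hq := S.levX.twoBdd_fixed (hb.image S).left (hb.image S).not_eventually_id_left
  have hq' := S.levX.twoBdd_fixed (hb.image S).right (hb.image S).not_eventually_id_right
  rcases le_or_gt t (p' - 1 / 2 ^ (3 * N + K)) with h | h
  · set n := 2 ^ (5 * N + K) with hn
    have hu := hb.symm_iterate_lt S.levY' hlen (by positivity) ht.1 h (one_le_steps N K)
    have hu' := (hb.symm_iterate_mem ht n).1
    have e1 := hb.conj_affine_of_le S hk hη (small_scale hK N) _ ⟨hu'.le, hu.le⟩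
    have h1 := S.levY'.twoBdd_iterate hM n
    have h2 : TwoBdd (M + 2 * N * n + 2 * N + K) (g (y.symm^[n] t)) := by
      rw [e1]
      exact (hq.mono (by omega)).add
        (((h1.mono (by omega)).sub (hp.mono (by omega))).zpow_mul hK)
    have h3 := S.levX.twoBdd_iterate h2 n
    rw [S.comm_iterate, (Function.RightInverse.iterate y.apply_symm_apply n) t] at h3
    exact h3.mono (by ring_nf; omega)
  · have e1 := hb.conj_affine_left_of_le S hk' hη (small_scale hK' N) t ⟨h.le, ht.2.le⟩
    rw [e1]
    refine TwoBdd.mono (N := M + 2 * N + K) (by omega) ?_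
    exact (hq'.mono (by omega)).add (((hM.mono (by omega)).sub (hp'.mono (by omega))).zpow_mul hK')

/-- The part of `GoodAt` about breakpoints: following the backward orbit of a breakpoint of `g` into
the linear zone, one meets a breakpoint of `y⁻¹` or, through `g`, one of `x`. -/
theorem twoBdd_break (hb : Bump y p p') (S : ConjData N x y g) (hlen : p' - p ≤ 1)
    (hlen' : g p' - g p ≤ 1)
    {k k' : ℤ} {K : ℕ} (hK : |k| ≤ K) (hK' : |k'| ≤ K) (hk : RightSlope g p k)
    (hk' : LeftSlope g p' k') {t : ℝ} (ht : t ∈ Ioo p p') (hnt : ¬ AffAt g t) :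
    TwoBdd (denomBound N K) t := by
  have hη : (1 : ℝ) / 2 ^ (3 * N + K) ≤ 1 / 2 ^ (3 * N) := one_div_two_pow_anti (by omega)
  have hη0 : (0 : ℝ) < 1 / 2 ^ (3 * N + K) := by positivity
  have haff := hb.conj_affine_of_le S hk hη (small_scale hK N)
  have haff' := hb.conj_affine_left_of_le S hk' hη (small_scale hK' N)
  have hle : t ≤ p' - 1 / 2 ^ (3 * N + K) := by
    by_contra h
    exact hnt (affAt_of_Icc_affine ⟨not_le.1 h, ht.2⟩ haff')
  set n := 2 ^ (5 * N + K) with hn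
  have hu := hb.symm_iterate_lt S.levY' hlen (by positivity) ht.1 hle (one_le_steps N K)
  have hu' := (hb.symm_iterate_mem ht n).1
  have hinv : ∀ u ∈ Ioo p p', TwoBdd N (g u) →
      TwoBdd (N + (4 * N * n + K + 2 * N)) u := by
    intro u hu hgu
    have := (hb.image S).twoBdd_conj S.swap (by linarith) (k := -k) (k' := -k') (K := K)
      (by rwa [abs_neg]) (by rwa [abs_neg]) hk.symm
      (by
        rw [leftSlope_iff, ← _root_.reflIso_symm]
        have h := ((leftSlope_iff _ _ _).1 hk').symm
        simpa using h)
      (t := g u) ⟨g.strictMono hu.1, g.strictMono hu.2⟩ hgu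
    rwa [g.symm_apply_apply] at this
  have key : ∀ m : ℕ, ∀ t ∈ Ioo p p', AffAt g (y.symm^[m] t) → ¬ AffAt g t →
      TwoBdd (N + (4 * N * n + K + 2 * N) + 2 * N + 2 * N * m) t := by
    intro m
    induction m with
    | zero => intro t _ h h'; exact absurd h h'
    | succ m ih =>
      intro t ht h h'
      have ht' := hb.symm_mem ht
      have hback : ∀ {M}, TwoBdd M (y.symm t) → TwoBdd (M + 2 * N) t := fun h => by
        simpa using S.levY.twoBdd h
      by_cases h1 : AffAt g (y.symm t)
      · by_cases h2 : TwoBdd N t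
        · exact h2.mono (by omega)
        by_cases h3 : TwoBdd N (g (y.symm t))
        · exact (hback (hinv _ ht' h3)).mono (by omega)
        exfalso
        apply h'
        have h4 : AffAt (fun s => g (y.symm s)) t := AffAt.comp h1 (S.levY'.affAt h2)
        have e : ∀ s, x (g (y.symm s)) = g s := fun s => by rw [S.comm]; simp
        obtain ⟨a, ha⟩ := S.levX.affAt h3
        obtain ⟨b, hb⟩ := h4
        refine ⟨a + b, ?_⟩
        have hcont : ContinuousAt (fun s => g (y.symm s)) t :=
          (g.continuous.comp y.symm.continuous).continuousAt
        filter_upwards [hb, hcont.eventually ha] with s h5 h6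
        rw [e, e] at h6
        rw [h6, h5, zpow_add₀ two_ne_zero]; ring
      · have := hback (ih (y.symm t) ht' (by rwa [Function.iterate_succ_apply] at h) h1)
        exact this.mono (by rw [mul_add]; omega)
  refine (key n t ht (affAt_of_Icc_affine ⟨hu', hu⟩ haff) hnt).mono ?_
  unfold denomBound
  rw [← hn]
  ring_nf
  omega

theorem goodAt (hb : Bump y p p') (S : ConjData N x y g) (hlen : p' - p ≤ 1)
    (hlen' : g p' - g p ≤ 1)
    {k k' : ℤ} {K : ℕ} (hK : |k| ≤ K) (hK' : |k'| ≤ K) (hk : RightSlope g p k)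
    (hk' : LeftSlope g p' k') {t : ℝ} (ht : t ∈ Ioo p p') : GoodAt (denomBound N K) g t := by
  refine ⟨hb.twoBdd_break S hlen hlen' hK hK' hk hk' ht, fun M hM => ?_⟩
  refine (hb.twoBdd_conj S hlen hK hK' hk hk' ht hM).mono ?_
  unfold denomBound
  have : 4 * N * 2 ^ (5 * N + K) ≤ 6 * N * 2 ^ (5 * N + K) := by gcongr; norm_num
  omega

end Bump

/-! ### Chains of bumps -/

/-- Two consecutive fixed points of `f` bound a bump of `f` or of its inverse. -/
theorem bump_or_bump_symm {f : ℝ ≃o ℝ} {p p' : ℝ} (hlt : p < p') (hp : f p = p) (hp' : f p' = p')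
    (hne : ∀ t ∈ Ioo p p', f t ≠ t) : Bump f p p' ∨ Bump f.symm p p' := by
  by_cases h : ∀ t ∈ Ioo p p', t < f t
  · exact Or.inl ⟨hlt, hp, hp', h⟩
  · right
    push Not at h
    obtain ⟨t₁, ht₁, h₁⟩ := h
    have hlt2 : ∀ t ∈ Ioo p p', f t < t := by
      intro t ht
      by_contra h2
      obtain ⟨u, hu, e⟩ := isPreconnected_Ioo.intermediate_value₂ ht₁ ht f.continuous.continuousOn
        continuous_id.continuousOn h₁ (not_lt.1 h2)
      exact hne u hu e
    refine ⟨hlt, by rw [f.symm_apply_eq, hp], by rw [f.symm_apply_eq, hp'], fun t ht => ?_⟩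
    rw [f.lt_symm_apply]
    exact hlt2 t ht

/-- If the slope exponent of a conjugator is bounded by `N` at the beginning of a chain of `i`
adjacent bumps, and the conjugator does not break where two bumps meet, then its slope exponents
along the chain are bounded by `chainBound N i`. -/
def chainBound (N i : ℕ) : ℕ := (slopeBound N)^[i] N

theorem chainBound_succ (N i : ℕ) : chainBound N (i + 1) = slopeBound N (chainBound N i) :=
  Function.iterate_succ_apply' _ _ _

theorem le_slopeBound (N K : ℕ) : K ≤ slopeBound N K := Nat.le_add_left _ _

theorem chainBound_mono (N : ℕ) : Monotone (chainBound N) :=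
  monotone_nat_of_le_succ fun i => by rw [chainBound_succ]; exact le_slopeBound _ _

/-- The bound for the denominators of a conjugator between maps of level `N`, valid on each interval
between consecutive dyadic fixed points on which the initial slope exponent is at most `N`. -/
def pieceBound (N : ℕ) : ℕ := denomBound N (chainBound N (2 ^ N + 1))

section Piece

variable {N : ℕ} {x y g : ℝ ≃o ℝ}

theorem ConjData.abs_leftSlope_le (S : ConjData N x y g) {p p' : ℝ} (hlt : p < p') (hp : y p = p)
    (hp' : y p' = p') (hne : ∀ t ∈ Ioo p p', y t ≠ t) (hlen : p' - p ≤ 1)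
    (hlen' : g p' - g p ≤ 1) {k k' : ℤ} {K : ℕ} (hK : |k| ≤ K) (hk : RightSlope g p k)
    (hk' : LeftSlope g p' k') : |k'| ≤ slopeBound N K := by
  rcases bump_or_bump_symm hlt hp hp' hne with hb | hb
  · exact hb.abs_leftSlope_le S hlen hlen' hK hk hk'
  · exact hb.abs_leftSlope_le S.inv hlen hlen' hK hk hk'

theorem ConjData.goodAt_of_mem_gap (S : ConjData N x y g) {p p' : ℝ} (hlt : p < p') (hp : y p = p)
    (hp' : y p' = p') (hne : ∀ t ∈ Ioo p p', y t ≠ t) (hlen : p' - p ≤ 1)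
    (hlen' : g p' - g p ≤ 1)
    {k k' : ℤ} {K : ℕ} (hK : |k| ≤ K) (hK' : |k'| ≤ K) (hk : RightSlope g p k)
    (hk' : LeftSlope g p' k') {t : ℝ} (ht : t ∈ Ioo p p') : GoodAt (denomBound N K) g t := by
  rcases bump_or_bump_symm hlt hp hp' hne with hb | hb
  · exact hb.goodAt S hlen hlen' hK hK' hk hk' ht
  · exact hb.goodAt S.inv hlen hlen' hK hK' hk hk' ht

/-- Where `f` is nowhere locally the identity, an interval of the subdivision contains at most one
fixed point. This bounds the number of bumps. -/
theorem Lev.not_two_fixed {f : ℝ → ℝ} (hf : Lev N f) {d e : ℝ}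
    (hV : ∀ t ∈ Ioo d e, ¬ ∀ᶠ s in 𝓝 t, f s = s) {u u' : ℝ} (hu : f u = u) (hu' : f u' = u')
    (hlt : u < u') (hd : d ≤ u) (he : u' ≤ e) {j : ℤ} (hj : (j : ℝ) / 2 ^ N ≤ u)
    (hj' : u' ≤ (j + 1 : ℝ) / 2 ^ N) : False := by
  obtain ⟨k, m, hk, h⟩ := hf j
  have e1 := h u ⟨hj, by linarith⟩
  have e2 := h u' ⟨by linarith, hj'⟩
  rw [hu] at e1
  rw [hu'] at e2
  have e3 : ((2 : ℝ) ^ k - 1) * (u' - u) = 0 := by linarith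
  have e4 : (2 : ℝ) ^ k = 1 := by
    rcases mul_eq_zero.1 e3 with e | e <;> linarith
  refine hV ((u + u') / 2) ⟨by linarith, by linarith⟩ ?_
  filter_upwards [Ioo_mem_nhds (show u < (u + u') / 2 by linarith)
    (show (u + u') / 2 < u' by linarith)] with s hs
  rw [h s ⟨by linarith [hs.1], by linarith [hs.2]⟩]
  rw [e4] at e1 ⊢
  linarith

theorem isCompact_fixed (y : ℝ ≃o ℝ) (a b : ℝ) : IsCompact ({s | y s = s} ∩ Icc a b) :=
  isCompact_Icc.inter_left (isClosed_eq y.continuous continuous_id)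

/-- The slope of a conjugator at a fixed point `p` of `y` is bounded by induction on the number of
intervals of the subdivision to the left of `p`: each contains at most one fixed point, and between
consecutive fixed points the slope grows by at most `slopeBound`. -/
theorem ConjData.abs_rightSlope_le_chainBound (S : ConjData N x y g) {d e : ℝ} (hd0 : 0 ≤ d)
    (he1 : e ≤ 1) (hgd : 0 ≤ g d) (hge : g e ≤ 1) (hd : y d = d)
    (hV : ∀ t ∈ Ioo d e, ¬ ∀ᶠ s in 𝓝 t, y s = s)
    (haff : ∀ t ∈ Ioo d e, y t = t → AffAt g t) (hR : ∀ t, ∃ k, RightSlope g t k)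
    {k₀ : ℤ} (hk₀ : RightSlope g d k₀) (hk₀N : |k₀| ≤ N) :
    ∀ i : ℕ, ∀ p ∈ Ico d e, y p = p → ⌈p * 2 ^ N⌉ ≤ i → ∀ k, RightSlope g p k →
      |k| ≤ chainBound N i := by
  intro i
  induction i with
  | zero =>
    intro p hp hyp hi k hk
    have h1 : p * 2 ^ N ≤ 0 := by
      have := Int.ceil_le.1 hi
      simpa using this
    have h2 : p ≤ 0 := nonpos_of_mul_nonpos_left h1 (by positivity)
    have h3 : p = d := le_antisymm (h2.trans hd0) hp.1
    subst h3
    rw [hk.unique hk₀]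
    exact hk₀N
  | succ i ih =>
    intro p hp hyp hi k hk
    rcases eq_or_lt_of_le hp.1 with rfl | hdp
    · rw [hk.unique hk₀]
      exact hk₀N.trans (by exact_mod_cast chainBound_mono N (Nat.zero_le (i + 1)))
    set j : ℤ := ⌈p * 2 ^ N⌉ - 1 with hj
    have hjp : (j : ℝ) / 2 ^ N < p := by
      rw [div_lt_iff₀ (by positivity), hj]
      push_cast
      linarith [Int.ceil_lt_add_one (p * 2 ^ N)]
    have hpj : p ≤ (j + 1 : ℝ) / 2 ^ N := by
      rw [le_div_iff₀ (by positivity), hj]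
      push_cast
      linarith [Int.le_ceil (p * 2 ^ N)]
    have hfix : ∀ u, d ≤ u → u < p → y u = u → u < (j : ℝ) / 2 ^ N := by
      intro u h1 h2 h3
      by_contra h4
      exact S.levY.not_two_fixed hV h3 hyp h2 h1 hp.2.le (not_lt.1 h4) hpj
    obtain ⟨q, ⟨hq1, hq2⟩, hq3⟩ := (isCompact_fixed y d ((j : ℝ) / 2 ^ N)).exists_isGreatest
      ⟨d, hd, le_rfl, (hfix d le_rfl hdp hd).le⟩
    have hqj := hfix q hq2.1 (by linarith [hq2.2]) hq1
    obtain ⟨k₁, hk₁⟩ := hR q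
    have hceil : ⌈q * 2 ^ N⌉ ≤ i := by
      have : ⌈q * 2 ^ N⌉ ≤ j := by
        rw [Int.ceil_le, ← le_div_iff₀ (by positivity)]; exact hqj.le
      push_cast at hi
      omega
    have hK := ih q ⟨hq2.1, by linarith [hp.2]⟩ hq1 hceil k₁ hk₁
    obtain ⟨k', hk', hk''⟩ := (haff p ⟨hdp, hp.2⟩ hyp).exists_slopes
    rw [hk.unique hk', chainBound_succ]
    refine S.abs_leftSlope_le (p := q) (by linarith) hq1 hyp ?_ (by linarith [hq2.1, hp.2]) ?_ hK
      hk₁ hk''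
    · intro t ht hyt
      have h1 := hfix t (by linarith [hq2.1, ht.1]) ht.2 hyt
      exact absurd (hq3 ⟨hyt, by linarith [hq2.1, ht.1], h1.le⟩) (not_le.2 ht.1)
    · have h1 : g d ≤ g q := g.monotone hq2.1
      have h2 : g p ≤ g e := g.monotone hp.2.le
      linarith

/-- On an interval where `y` is nowhere locally the identity and has no dyadic fixed points inside,
a conjugator whose initial slope is bounded has bounded denominators: its slope at each fixed point
is bounded by induction along the chain of bumps, since it does not change at a fixed point which
is not dyadic. -/
theorem ConjData.goodAt_of_mem_piece (S : ConjData N x y g) {d e : ℝ} (hd0 : 0 ≤ d)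
    (he1 : e ≤ 1) (hgd : 0 ≤ g d) (hge : g e ≤ 1) (hd : y d = d) (he : y e = e)
    (hV : ∀ t ∈ Ioo d e, ¬ ∀ᶠ s in 𝓝 t, y s = s)
    (haff : ∀ t ∈ Ioo d e, y t = t → AffAt g t) (hR : ∀ t, ∃ k, RightSlope g t k)
    (hL : ∀ t, ∃ k, LeftSlope g t k)
    {k₀ : ℤ} (hk₀ : RightSlope g d k₀) (hk₀N : |k₀| ≤ N) {t : ℝ} (ht : t ∈ Ioo d e) :
    GoodAt (pieceBound N) g t := by
  by_cases hyt : y t = t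
  · refine ⟨fun h => absurd (haff t ht hyt) h, fun M _ => ?_⟩
    have hid : ¬ ∀ᶠ s in 𝓝 (g t), x s = s := by
      intro h
      refine hV t ht ?_
      filter_upwards [g.continuous.continuousAt.eventually h] with s hs
      rw [S.comm] at hs
      exact g.injective hs
    refine (S.levX.twoBdd_fixed (by rw [S.comm, hyt]) hid).mono ?_
    unfold pieceBound denomBound
    omega
  · obtain ⟨p, ⟨hp1, hp2⟩, hp3⟩ := (isCompact_fixed y d t).exists_isGreatest
      ⟨d, hd, le_rfl, ht.1.le⟩
    obtain ⟨p', ⟨hp1', hp2'⟩, hp3'⟩ := (isCompact_fixed y t e).exists_isLeast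
      ⟨e, he, ht.2.le, le_rfl⟩
    have hpt : p < t := lt_of_le_of_ne hp2.2 (by rintro rfl; exact hyt hp1)
    have hpt' : t < p' := lt_of_le_of_ne hp2'.1 (by rintro rfl; exact hyt hp1')
    obtain ⟨k, hk⟩ := hR p
    obtain ⟨k', hk'⟩ := hL p'
    have h1 : g d ≤ g p := g.monotone hp2.1
    have h2 : g p' ≤ g e := g.monotone hp2'.2
    have hne : ∀ s ∈ Ioo p p', y s ≠ s := by
      intro s hs hys
      rcases le_or_gt s t with h | h
      · exact absurd (hp3 ⟨hys, by linarith [hp2.1, hs.1], h⟩) (not_le.2 hs.1)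
      · exact absurd (hp3' ⟨hys, h.le, by linarith [hp2'.2, hs.2]⟩) (not_le.2 hs.2)
    have hK := S.abs_rightSlope_le_chainBound hd0 he1 hgd hge hd hV haff hR hk₀ hk₀N (2 ^ N) p
      ⟨hp2.1, by linarith [ht.2]⟩ hp1 (by
        rw [Int.ceil_le]
        push_cast
        have : p * 2 ^ N ≤ 1 * 2 ^ N := by gcongr; linarith [ht.2]
        linarith) k hk
    have hK' := S.abs_leftSlope_le (by linarith) hp1 hp1' hne (by linarith [hp2.1, hp2'.2])
      (by linarith) hK hk hk'
    rw [← chainBound_succ] at hK'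
    refine S.goodAt_of_mem_gap (by linarith) hp1 hp1' hne (by linarith [hp2.1, hp2'.2])
      (by linarith) (hK.trans ?_) hK' hk hk' ⟨hpt, hpt'⟩
    exact_mod_cast chainBound_mono N (Nat.le_succ _)

end Piece

/-! ### Dyadic piecewise linear maps of the real line -/

theorem IsDyadic.zero : IsDyadic 0 := ⟨0, 0, by simp⟩

theorem IsDyadic.one : IsDyadic 1 := ⟨1, 0, by simp⟩

theorem IsDyadic.int_div (m : ℤ) (M : ℕ) : IsDyadic ((m : ℝ) / 2 ^ M) := ⟨m, M, rfl⟩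

/-- `f` is affine, with slopes powers of `2`, on the intervals of a standard dyadic subdivision of
the real line. -/
def IsPL (f : ℝ → ℝ) : Prop :=
  ∃ M : ℕ, ∀ j : ℤ, ∃ (k : ℤ) (c : ℝ), ∀ t ∈ Icc ((j : ℝ) / 2 ^ M) ((j + 1 : ℝ) / 2 ^ M),
    f t = c + 2 ^ k * t

/-- Every interval of a finer dyadic subdivision lies in one of a coarser subdivision. -/
theorem exists_coarser_interval {M M' : ℕ} (h : M ≤ M') (j : ℤ) : ∃ i : ℤ,
    (i : ℝ) / 2 ^ M ≤ (j : ℝ) / 2 ^ M' ∧ (j + 1 : ℝ) / 2 ^ M' ≤ (i + 1 : ℝ) / 2 ^ M := by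
  obtain ⟨d, rfl⟩ := Nat.exists_eq_add_of_le h
  have hd : (0 : ℤ) < 2 ^ d := by positivity
  refine ⟨j / 2 ^ d, ?_, ?_⟩
  · rw [pow_add, div_le_div_iff₀ (by positivity) (by positivity)]
    have h1 : j / 2 ^ d * 2 ^ d ≤ j := Int.ediv_mul_le _ hd.ne'
    have h2 : ((j / 2 ^ d : ℤ) : ℝ) * 2 ^ d ≤ j := by exact_mod_cast h1
    calc ((j / 2 ^ d : ℤ) : ℝ) * (2 ^ M * 2 ^ d) = ((j / 2 ^ d : ℤ) : ℝ) * 2 ^ d * 2 ^ M := by ring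
      _ ≤ _ := by gcongr
  · rw [pow_add, div_le_div_iff₀ (by positivity) (by positivity)]
    have h1 : j + 1 ≤ (j / 2 ^ d + 1) * 2 ^ d := Int.lt_ediv_add_one_mul_self j hd
    have h2 : (j + 1 : ℝ) ≤ (((j / 2 ^ d : ℤ) : ℝ) + 1) * 2 ^ d := by exact_mod_cast h1
    calc (j + 1 : ℝ) * 2 ^ M ≤ (((j / 2 ^ d : ℤ) : ℝ) + 1) * 2 ^ d * 2 ^ M := by gcongr
      _ = _ := by ring

theorem IsPL.of_le {f : ℝ → ℝ} {M M' : ℕ} (h : M ≤ M')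
    (hf : ∀ j : ℤ, ∃ (k : ℤ) (c : ℝ), ∀ t ∈ Icc ((j : ℝ) / 2 ^ M) ((j + 1 : ℝ) / 2 ^ M),
      f t = c + 2 ^ k * t) :
    ∀ j : ℤ, ∃ (k : ℤ) (c : ℝ), ∀ t ∈ Icc ((j : ℝ) / 2 ^ M') ((j + 1 : ℝ) / 2 ^ M'),
      f t = c + 2 ^ k * t := by
  intro j
  obtain ⟨i, h1, h2⟩ := exists_coarser_interval h j
  obtain ⟨k, c, hc⟩ := hf i
  exact ⟨k, c, fun t ht => hc t ⟨h1.trans ht.1, ht.2.trans h2⟩⟩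

theorem IsPL.exists_rightSlope {f : ℝ → ℝ} (hf : IsPL f) (t : ℝ) : ∃ k, RightSlope f t k := by
  obtain ⟨M, hf⟩ := hf
  obtain ⟨j, hj⟩ := exists_mem_Ico_grid M t
  obtain ⟨k, c, h⟩ := hf j
  refine ⟨k, ?_⟩
  filter_upwards [Ioo_mem_nhdsGT hj.2] with s hs
  rw [h s ⟨by linarith [hj.1, hs.1], hs.2.le⟩, h t ⟨hj.1, hj.2.le⟩]; ring

theorem IsPL.affAt {f : ℝ → ℝ} (hf : IsPL f) {t : ℝ} (ht : ¬ IsDyadic t) : AffAt f t := by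
  obtain ⟨M, hf⟩ := hf
  obtain ⟨j, hj⟩ := exists_mem_Ico_grid M t
  obtain ⟨k, c, h⟩ := hf j
  have hne : (j : ℝ) / 2 ^ M ≠ t := fun h => ht (h ▸ IsDyadic.int_div _ _)
  exact affAt_of_Ioo (c := c) (k := k) ⟨lt_of_le_of_ne hj.1 hne, hj.2⟩ fun s hs =>
    h s (Ioo_subset_Icc_self hs)

theorem IsPL.exists_leftSlope {f : ℝ → ℝ} (hf : IsPL f) (t : ℝ) : ∃ k, LeftSlope f t k := by
  obtain ⟨M, hf⟩ := hf
  set j : ℤ := ⌈t * 2 ^ M⌉ - 1 with hj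
  have hjp : (j : ℝ) / 2 ^ M < t := by
    rw [div_lt_iff₀ (by positivity), hj]
    push_cast
    linarith [Int.ceil_lt_add_one (t * 2 ^ M)]
  have hpj : t ≤ (j + 1 : ℝ) / 2 ^ M := by
    rw [le_div_iff₀ (by positivity), hj]
    push_cast
    linarith [Int.le_ceil (t * 2 ^ M)]
  obtain ⟨k, c, h⟩ := hf j
  refine ⟨k, ?_⟩
  filter_upwards [Ioo_mem_nhdsLT hjp] with s hs
  rw [h s ⟨hs.1.le, by linarith [hs.2]⟩, h t ⟨hjp.le, hpj⟩]; ring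

/-- A continuous function which is affine near each interior point of an interval is affine on
it. -/
theorem affine_of_affAt {f : ℝ → ℝ} (hf : Continuous f) {a b : ℝ} (hab : a < b)
    (h : ∀ t ∈ Ioo a b, AffAt f t) : ∃ (k : ℤ) (c : ℝ), ∀ t ∈ Icc a b, f t = c + 2 ^ k * t := by
  have h' : ∀ t ∈ Ioo a b, ∃ (k : ℤ) (c : ℝ), ∀ᶠ s in 𝓝 t, f s = c + 2 ^ k * s := by
    intro t ht
    obtain ⟨k, hk⟩ := h t ht
    exact ⟨k, f t - 2 ^ k * t, hk.mono fun s hs => by rw [hs]; ring⟩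
  obtain ⟨k, c, hkc⟩ := h' ((a + b) / 2) ⟨by linarith, by linarith⟩
  refine ⟨k, c, ?_⟩
  let U : Set ℝ := {t | ∀ᶠ s in 𝓝 t, f s = c + 2 ^ k * s}
  let V : Set ℝ := {t | ∃ (l : ℤ) (e : ℝ), (l, e) ≠ (k, c) ∧ ∀ᶠ s in 𝓝 t, f s = e + 2 ^ l * s}
  have hU : IsOpen U := isOpen_iff_mem_nhds.2 fun t ht => ht.eventually_nhds
  have hV : IsOpen V := isOpen_iff_mem_nhds.2 fun t ⟨l, e, hne, ht⟩ =>
    ht.eventually_nhds.mono fun s hs => ⟨l, e, hne, hs⟩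
  have hdisj : Disjoint U V := by
    rw [Set.disjoint_left]
    rintro t ht ⟨l, e, hne, ht'⟩
    have hand : ∀ᶠ s in 𝓝 t, c + 2 ^ k * s = e + 2 ^ l * s := by
      filter_upwards [ht, ht'] with s h1 h2
      rw [← h1, h2]
    have hs : ∃ s, t < s ∧ c + 2 ^ k * s = e + 2 ^ l * s := by
      have h3 : ∀ᶠ s in 𝓝[>] t, c + 2 ^ k * s = e + 2 ^ l * s :=
        hand.filter_mono nhdsWithin_le_nhds
      obtain ⟨s, h4, h5⟩ := (h3.and self_mem_nhdsWithin).exists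
      exact ⟨s, h5, h4⟩
    obtain ⟨s, hts, h4⟩ := hs
    have h5 := hand.self_of_nhds
    have h6 : (2 : ℝ) ^ k = 2 ^ l :=
      mul_right_cancel₀ (sub_pos.2 hts).ne' (by linarith)
    rw [h6] at h5
    exact hne (Prod.ext (two_zpow_inj h6).symm (by simp only; linarith))
  have hsub : Ioo a b ⊆ U := by
    refine isPreconnected_Ioo.subset_left_of_subset_union hU hV hdisj ?_
      ⟨(a + b) / 2, ⟨by linarith, by linarith⟩, hkc⟩
    intro t ht
    obtain ⟨l, e, hle⟩ := h' t ht
    by_cases heq : (l, e) = (k, c)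
    · left
      rw [Prod.mk.injEq] at heq
      rw [heq.1, heq.2] at hle
      exact hle
    · exact Or.inr ⟨l, e, heq, hle⟩
  have hcl : Icc a b ⊆ {t | f t = c + 2 ^ k * t} := by
    rw [← closure_Ioo hab.ne]
    refine closure_minimal (fun t ht => (hsub ht).self_of_nhds) ?_
    exact isClosed_eq hf (by fun_prop)
  exact fun t ht => hcl ht

theorem not_int_div_of_mem_Ioo {M : ℕ} {j : ℤ} {t : ℝ}
    (ht : t ∈ Ioo ((j : ℝ) / 2 ^ M) ((j + 1 : ℝ) / 2 ^ M)) (m : ℤ) : t ≠ m / 2 ^ M := by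
  rintro rfl
  have h1 : (j : ℝ) < m := (div_lt_div_iff_of_pos_right (by positivity)).1 ht.1
  have h2 : (m : ℝ) < j + 1 := (div_lt_div_iff_of_pos_right (by positivity)).1 ht.2
  have h3 : j < m := by exact_mod_cast h1
  have h4 : m < j + 1 := by exact_mod_cast h2
  omega

theorem grid_lt (M : ℕ) (j : ℤ) : (j : ℝ) / 2 ^ M < (j + 1 : ℝ) / 2 ^ M := by
  gcongr; linarith

theorem isPL_of_break {f : ℝ → ℝ} (hf : Continuous f) {C : ℕ}
    (h : ∀ t, ¬ AffAt f t → TwoBdd C t ∧ IsDyadic t) : IsPL f := by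
  refine ⟨C, fun j => affine_of_affAt hf (grid_lt C j) fun t ht => ?_⟩
  by_contra hn
  obtain ⟨h1, h2⟩ := h t hn
  obtain ⟨m, hm⟩ := h1.of_isDyadic h2
  exact not_int_div_of_mem_Ioo ht m hm

/-! ### Gluing, and extension of elements of `PLTwo` to the real line -/

/-- The increasing bijection equal to `f` on the left of `d` and to `h` on the right of `d`. -/
noncomputable def glueIso (f h : ℝ ≃o ℝ) (d : ℝ) (hd : f d = h d) : ℝ ≃o ℝ :=
  StrictMono.orderIsoOfRightInverse (fun t => if t ≤ d then f t else h t)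
    (by
      intro s t hst
      dsimp only
      split_ifs with h1 h2 h2
      · exact f.strictMono hst
      · calc f s ≤ f d := f.monotone h1
          _ = h d := hd
          _ < h t := h.strictMono (not_le.1 h2)
      · exact absurd (hst.le.trans h2) h1
      · exact h.strictMono hst)
    (fun s => if s ≤ f d then f.symm s else h.symm s)
    (by
      intro s
      dsimp only
      by_cases h1 : s ≤ f d
      · rw [if_pos h1, if_pos (by rwa [f.symm_apply_le]), f.apply_symm_apply]
      · rw [if_neg h1, if_neg, h.apply_symm_apply]
        rw [h.symm_apply_le, ← hd]; exact h1)

theorem glueIso_of_le {f h : ℝ ≃o ℝ} {d : ℝ} (hd : f d = h d) {t : ℝ} (ht : t ≤ d) :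
    glueIso f h d hd t = f t := if_pos ht

theorem glueIso_of_ge {f h : ℝ ≃o ℝ} {d : ℝ} (hd : f d = h d) {t : ℝ} (ht : d ≤ t) :
    glueIso f h d hd t = h t := by
  rcases eq_or_lt_of_le ht with rfl | ht
  · rw [glueIso_of_le hd le_rfl, hd]
  · exact if_neg (not_le.2 ht)

theorem isPL_glueIso {f h : ℝ ≃o ℝ} {d : ℝ} (hd : f d = h d) (hf : IsPL f) (hh : IsPL h)
    (hdy : IsDyadic d) : IsPL (glueIso f h d hd) := by
  obtain ⟨m, n, rfl⟩ := hdy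
  obtain ⟨M, hM⟩ := hf
  obtain ⟨M', hM'⟩ := hh
  refine ⟨max n (max M M'), fun j => ?_⟩
  obtain ⟨i, h1, h2⟩ := exists_coarser_interval (M := n) (M' := max n (max M M')) (by omega) j
  rcases lt_or_ge i m with him | him
  · obtain ⟨k, c, hc⟩ := IsPL.of_le (M' := max n (max M M')) (by omega) hM j
    refine ⟨k, c, fun t ht => ?_⟩
    have h3 : (i + 1 : ℝ) ≤ m := by exact_mod_cast him
    rw [glueIso_of_le hd, hc t ht]
    calc t ≤ _ := ht.2
      _ ≤ _ := h2
      _ ≤ _ := by gcongr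
  · obtain ⟨k, c, hc⟩ := IsPL.of_le (M' := max n (max M M')) (by omega) hM' j
    refine ⟨k, c, fun t ht => ?_⟩
    have h3 : (m : ℝ) ≤ i := by exact_mod_cast him
    rw [glueIso_of_ge hd, hc t ht]
    calc (m : ℝ) / 2 ^ n ≤ i / 2 ^ n := by gcongr
      _ ≤ _ := h1
      _ ≤ _ := ht.1

/-- The extension of a self-map of the unit interval by the identity. -/
noncomputable def extendId (f : unitInterval → unitInterval) (t : ℝ) : ℝ :=
  if h : t ∈ Icc (0 : ℝ) 1 then (f ⟨t, h⟩ : ℝ) else t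

theorem extendId_coe (f : unitInterval → unitInterval) (t : unitInterval) :
    extendId f t = f t := dif_pos t.2

theorem extendId_comp (f g : unitInterval → unitInterval) (t : ℝ) :
    extendId f (extendId g t) = extendId (f ∘ g) t := by
  by_cases h : t ∈ Icc (0 : ℝ) 1
  · lift t to unitInterval using h
    rw [extendId_coe, extendId_coe, extendId_coe]; rfl
  · unfold extendId; simp only [h, dite_false]

theorem extendId_id (t : ℝ) : extendId id t = t := by
  unfold extendId; split_ifs <;> rfl

theorem strictMono_extendId {f : unitInterval → unitInterval} (hf : StrictMono f) :
    StrictMono (extendId f) := by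
  intro s t hst
  unfold extendId
  split_ifs with h1 h2 h2
  · exact hf (show (⟨s, h1⟩ : unitInterval) < ⟨t, h2⟩ from hst)
  · have h3 : 1 < t := by
      by_contra h; exact h2 ⟨h1.1.trans hst.le, not_lt.1 h⟩
    exact lt_of_le_of_lt (f _).2.2 h3
  · have h3 : s < 0 := by
      by_contra h; exact h1 ⟨not_lt.1 h, hst.le.trans h2.2⟩
    exact lt_of_lt_of_le h3 (f _).2.1
  · exact hst

/-- The increasing bijection of the real line obtained by extending an element of `PLTwo` by the
identity outside the unit interval. -/
noncomputable def PLTwo.toIso (f : PLTwo) : ℝ ≃o ℝ :=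
  StrictMono.orderIsoOfRightInverse (extendId f.1) (strictMono_extendId f.2.1) (extendId f.1.symm)
    (fun t => by
      rw [extendId_comp]
      have : (f.1 : unitInterval → unitInterval) ∘ f.1.symm = id := by ext; simp
      rw [this, extendId_id])

open PLTwo

theorem toIso_coe (f : PLTwo) (t : unitInterval) : toIso f t = f.1 t := extendId_coe _ t

theorem toIso_mul (f g : PLTwo) (t : ℝ) : toIso (f * g) t = toIso f (toIso g t) :=
  (extendId_comp f.1 g.1 t).symm

theorem toIso_one (t : ℝ) : toIso 1 t = t := extendId_id t

theorem toIso_inv (f : PLTwo) : toIso f⁻¹ = (toIso f).symm := by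
  ext t
  rw [OrderIso.eq_symm_apply, ← toIso_mul, mul_inv_cancel, toIso_one]

theorem toIso_zero (f : PLTwo) : toIso f 0 = 0 := by
  have := toIso_coe f 0
  rw [unitInterval.homeomorph_zero f.2.1] at this
  exact_mod_cast this

theorem toIso_one_apply (f : PLTwo) : toIso f 1 = 1 := by
  have := toIso_coe f 1
  rw [unitInterval.homeomorph_one f.2.1] at this
  exact_mod_cast this

theorem toIso_of_le_zero (f : PLTwo) {t : ℝ} (ht : t ≤ 0) : toIso f t = t := by
  rcases eq_or_lt_of_le ht with rfl | ht
  · exact toIso_zero f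
  · exact dif_neg fun h => absurd h.1 (not_le.2 ht)

theorem toIso_of_one_le (f : PLTwo) {t : ℝ} (ht : 1 ≤ t) : toIso f t = t := by
  rcases eq_or_lt_of_le ht with rfl | ht
  · exact toIso_one_apply f
  · exact dif_neg fun h => absurd h.2 (not_le.2 ht)

theorem toIso_injective : Function.Injective toIso := by
  intro f g h
  apply Subtype.ext
  ext t
  rw [← toIso_coe, ← toIso_coe, h]

theorem isDyadic_toIso_iff (f : PLTwo) (t : ℝ) : IsDyadic (toIso f t) ↔ IsDyadic t := by
  rcases le_or_gt t 0 with h | h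
  · rw [toIso_of_le_zero f h]
  rcases le_or_gt 1 t with h' | h'
  · rw [toIso_of_one_le f h']
  have := IsDyadicPL.isDyadic_iff f.2.2 (unitInterval.homeomorph_zero f.2.1)
    (⟨t, h.le, h'.le⟩ : unitInterval)
  rwa [← toIso_coe] at this

theorem toIso_mem_Icc (f : PLTwo) {t : ℝ} (ht : t ∈ Icc (0 : ℝ) 1) :
    toIso f t ∈ Icc (0 : ℝ) 1 := by
  constructor
  · rw [← toIso_zero f]; exact (toIso f).monotone ht.1
  · rw [← toIso_one_apply f]; exact (toIso f).monotone ht.2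

theorem isPL_toIso (f : PLTwo) : IsPL (toIso f) := by
  obtain ⟨S, hS, haff⟩ := f.2.2
  have hM : ∃ M : ℕ, ∀ s ∈ S, ∃ m : ℤ, (s : ℝ) = m / 2 ^ M := by
    have : ∀ s : unitInterval, ∃ n : ℕ, s ∈ S → ∃ m : ℤ, (s : ℝ) = m / 2 ^ n := by
      intro s
      by_cases hs : s ∈ S
      · obtain ⟨m, n, h⟩ := hS s hs
        exact ⟨n, fun _ => ⟨m, h⟩⟩
      · exact ⟨0, fun h => absurd h hs⟩
    choose n hn using this
    refine ⟨S.sup n, fun s hs => ?_⟩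
    obtain ⟨m, hm⟩ := hn s hs
    obtain ⟨d, hd⟩ := Nat.exists_eq_add_of_le (Finset.le_sup (f := n) hs)
    refine ⟨m * 2 ^ d, ?_⟩
    rw [hm, hd, pow_add]; push_cast; field_simp
  obtain ⟨M, hM⟩ := hM
  refine ⟨M, fun j => ?_⟩
  have hpos : (0 : ℝ) < 2 ^ M := by positivity
  have id0 : ∀ t : ℝ, t = 0 + 2 ^ (0 : ℤ) * t := fun t => by simp
  rcases lt_or_ge j 0 with hj | hj
  · refine ⟨0, 0, fun t ht => ?_⟩
    rw [toIso_of_le_zero, ← id0]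
    refine ht.2.trans (div_nonpos_of_nonpos_of_nonneg ?_ hpos.le)
    exact_mod_cast hj
  rcases le_or_gt (2 ^ M) j with hj' | hj'
  · refine ⟨0, 0, fun t ht => ?_⟩
    rw [toIso_of_one_le, ← id0]
    refine le_trans ?_ ht.1
    rw [one_le_div hpos]
    exact_mod_cast hj'
  have ha : (j : ℝ) / 2 ^ M ∈ unitInterval := by
    refine ⟨div_nonneg (by exact_mod_cast hj) hpos.le, ?_⟩
    rw [div_le_one hpos]; exact_mod_cast hj'.le
  have hb : (j + 1 : ℝ) / 2 ^ M ∈ unitInterval := by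
    refine ⟨ha.1.trans (grid_lt M j).le, ?_⟩
    rw [div_le_one hpos]; exact_mod_cast hj'
  obtain ⟨k, hk⟩ := haff ⟨_, ha⟩ ⟨_, hb⟩ (grid_lt M j).le (by
    rintro s hs ⟨h1, h2⟩
    obtain ⟨m, hm⟩ := hM s hs
    exact not_int_div_of_mem_Ioo ⟨h1, h2⟩ m hm)
  refine ⟨k, (f.1 ⟨_, ha⟩ : ℝ) - 2 ^ k * (j / 2 ^ M), fun t ht => ?_⟩
  have hk' := hk ⟨t, ha.1.trans ht.1, ht.2.trans hb.2⟩ ht.1 ht.2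
  rw [← toIso_coe] at hk'
  simp only at hk'
  rw [hk']; ring

/-- The maps obtained by extension from `PLTwo` are all piecewise linear maps which are the identity
outside the unit interval. -/
theorem exists_toIso_eq {f : ℝ ≃o ℝ} (hf : IsPL f) (h0 : ∀ t ≤ 0, f t = t)
    (h1 : ∀ t, 1 ≤ t → f t = t) : ∃ F : PLTwo, toIso F = f := by
  have hmem : ∀ t : ℝ, t ∈ unitInterval ↔ f t ∈ unitInterval := by
    intro t
    have e0 := h0 0 le_rfl
    have e1 := h1 1 le_rfl
    constructor
    · rintro ⟨h2, h3⟩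
      exact ⟨by rw [← e0]; exact f.monotone h2, by rw [← e1]; exact f.monotone h3⟩
    · rintro ⟨h2, h3⟩
      exact ⟨by rw [← e0] at h2; exact f.le_iff_le.1 h2, by rw [← e1] at h3; exact f.le_iff_le.1 h3⟩
  let G : unitInterval ≃o unitInterval :=
    { toEquiv := f.toEquiv.subtypeEquiv hmem
      map_rel_iff' := fun {a b} => f.le_iff_le (x := (a : ℝ)) (y := b) }
  have hG : ∀ t : unitInterval, (G t : ℝ) = f t := fun t => rfl
  obtain ⟨M, hM⟩ := hf
  have hPL : IsDyadicPL G := by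
    have hgrid : ∀ i : ℕ, (i : ℝ) / 2 ^ M ∈ unitInterval ∨ ¬ i ≤ 2 ^ M := by
      intro i
      by_cases h : i ≤ 2 ^ M
      · left
        refine ⟨by positivity, ?_⟩
        rw [div_le_one (by positivity)]
        exact_mod_cast h
      · exact Or.inr h
    refine ⟨(Finset.range (2 ^ M + 1)).image fun i : ℕ => projIcc (0 : ℝ) 1 zero_le_one (i / 2 ^ M),
      ?_, ?_⟩
    · intro s hs
      obtain ⟨i, hi, rfl⟩ := Finset.mem_image.1 hs
      rcases hgrid i with h | h
      · rw [projIcc_of_mem _ h]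
        exact ⟨i, M, by push_cast; rfl⟩
      · exact absurd (Nat.lt_succ_iff.1 (Finset.mem_range.1 hi)) h
    · intro a b hab hfree
      rcases eq_or_lt_of_le hab with rfl | hlt
      · refine ⟨0, fun t h2 h3 => ?_⟩
        rw [le_antisymm h2 h3]; simp
      obtain ⟨j, hj⟩ := exists_mem_Ico_grid M (a : ℝ)
      have hbj : (b : ℝ) ≤ (j + 1 : ℝ) / 2 ^ M := by
        by_contra hcon
        have hcon := not_le.1 hcon
        have h2 : (0 : ℝ) ≤ (j + 1 : ℝ) / 2 ^ M := a.2.1.trans hj.2.le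
        have h3 : (0 : ℤ) ≤ j + 1 := by
          by_contra h4
          have h5 : (j + 1 : ℝ) < 0 := by exact_mod_cast not_le.1 h4
          exact absurd h2 (not_le.2 (div_neg_of_neg_of_pos h5 (by positivity)))
        obtain ⟨i, hi⟩ := Int.eq_ofNat_of_zero_le h3
        have hi' : (j + 1 : ℝ) = i := by exact_mod_cast hi
        rw [hi'] at hcon hj
        have hm : (i : ℝ) / 2 ^ M ∈ unitInterval := ⟨by positivity, hcon.le.trans b.2.2⟩
        refine hfree (projIcc (0 : ℝ) 1 zero_le_one (i / 2 ^ M))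
          (Finset.mem_image.2 ⟨i, ?_, rfl⟩) ?_
        · rw [Finset.mem_range, Nat.lt_succ_iff]
          have h6 := hm.2
          rw [div_le_one (by positivity)] at h6
          exact_mod_cast h6
        · rw [projIcc_of_mem _ hm]
          exact ⟨hj.2, hcon⟩
      obtain ⟨k, c, hc⟩ := hM j
      refine ⟨k, fun t h2 h3 => ?_⟩
      have h2' : (a : ℝ) ≤ t := h2
      have h3' : (t : ℝ) ≤ b := h3
      rw [hG, hG, hc t ⟨hj.1.trans h2', h3'.trans hbj⟩, hc a ⟨hj.1, hj.2.le⟩]; ring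
  refine ⟨⟨G.toHomeomorph, G.strictMono, hPL⟩, ?_⟩
  ext t
  rcases le_or_gt t 0 with h | h
  · rw [toIso_of_le_zero _ h, h0 t h]
  rcases le_or_gt 1 t with h' | h'
  · rw [toIso_of_one_le _ h', h1 t h']
  exact toIso_coe _ (⟨t, h.le, h'.le⟩ : unitInterval)

/-! ### Maps between dyadic intervals with controlled denominators -/

/-- `f` breaks only at multiples of `2 ^ (-(R + n))`, and neither `f` nor its inverse raises the
power of `2` in a denominator by more than `n`, once this power is at least `R`. -/
structure Mild (R n : ℕ) (f : ℝ ≃o ℝ) : Prop where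
  brk : ∀ t, ¬ AffAt f t → TwoBdd (R + n) t ∧ IsDyadic t
  two : ∀ M t, R ≤ M → TwoBdd M t → TwoBdd (M + n) (f t)
  two_symm : ∀ M t, R ≤ M → TwoBdd M t → TwoBdd (M + n) (f.symm t)
  dyad : ∀ t, IsDyadic (f t) ↔ IsDyadic t

theorem AffAt.of_comp {f g : ℝ ≃o ℝ} {t : ℝ} (hf : AffAt f t) (hg : AffAt g (f t)) :
    AffAt (f.trans g) t := AffAt.comp (f := g) hg hf

theorem Mild.trans {R m n : ℕ} {f g : ℝ ≃o ℝ} (hf : Mild R m f) (hg : Mild R n g) :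
    Mild R (n + m) (f.trans g) where
  brk t h := by
    by_cases h1 : AffAt f t
    · have h2 : ¬ AffAt g (f t) := fun h2 => h (h1.of_comp h2)
      obtain ⟨h3, h4⟩ := hg.brk _ h2
      refine ⟨?_, (hf.dyad t).1 h4⟩
      have := hf.two_symm _ _ (by omega) h3
      rw [f.symm_apply_apply] at this
      exact this.mono (by omega)
    · exact ⟨(hf.brk t h1).1.mono (by omega), (hf.brk t h1).2⟩
  two M t hM ht := (hg.two _ _ (by omega) (hf.two M t hM ht)).mono (by omega)
  two_symm M t hM ht := (hf.two_symm _ _ (by omega) (hg.two_symm M t hM ht)).mono (by omega)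
  dyad t := (hg.dyad _).trans (hf.dyad t)

theorem Mild.symm {R n : ℕ} {f : ℝ ≃o ℝ} (hf : Mild R n f) : Mild R (2 * n) f.symm where
  brk t h := by
    obtain ⟨u, rfl⟩ := f.surjective t
    obtain ⟨h1, h2⟩ := hf.brk u (fun h' => h h'.symm)
    exact ⟨(hf.two _ _ (by omega) h1).mono (by omega), (hf.dyad u).2 h2⟩
  two M t hM ht := (hf.two_symm M t hM ht).mono (by omega)
  two_symm M t hM ht := (hf.two M t hM ht).mono (by omega)
  dyad t := by
    have := hf.dyad (f.symm t)
    rw [f.apply_symm_apply] at this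
    exact this.symm

theorem Mild.of_affine {R n : ℕ} {f : ℝ ≃o ℝ}
    (hbrk : ∀ t, ¬ AffAt f t → TwoBdd (R + n) t ∧ IsDyadic t)
    (h : ∀ t, ∃ (k : ℤ) (c : ℝ), |k| ≤ n ∧ TwoBdd R c ∧ IsDyadic c ∧ f t = c + 2 ^ k * t) :
    Mild R n f where
  brk := hbrk
  two M t hM ht := by
    obtain ⟨k, c, hk, hc, -, e⟩ := h t
    rw [e]
    exact (hc.mono (by omega)).add (ht.zpow_mul hk)
  two_symm M t hM ht := by
    obtain ⟨k, c, hk, hc, -, e⟩ := h (f.symm t)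
    have e2 : f.symm t = 2 ^ (-k) * (t - c) := by
      rw [f.apply_symm_apply] at e
      rw [zpow_neg]; field_simp; linarith
    rw [e2]
    exact (ht.sub (hc.mono hM)).zpow_mul (by rwa [abs_neg])
  dyad t := by
    obtain ⟨k, c, hk, -, hc, e⟩ := h t
    rw [e]
    constructor
    · intro h1
      have := IsDyadic.zero.add_zpow_mul_sub h1 hc (-k)
      rwa [add_sub_cancel_left, ← mul_assoc, ← zpow_add₀ two_ne_zero, neg_add_cancel, zpow_zero,
        one_mul, zero_add] at this
    · intro h1
      have := hc.add_zpow_mul_sub h1 IsDyadic.zero k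
      rwa [sub_zero] at this

/-- Multiplication by `2`. -/
noncomputable def doubleIso : ℝ ≃o ℝ := OrderIso.mulLeft₀ 2 two_pos

theorem doubleIso_apply (t : ℝ) : doubleIso t = 2 * t := rfl

theorem refl_zero_eq_doubleIso_zero : OrderIso.refl ℝ 0 = doubleIso 0 := by
  rw [doubleIso_apply, mul_zero, OrderIso.refl_apply]

/-- The identity on the left of `0`, the map `t ↦ 2 t` on `[0, r]` and the translation by `r` on
the right of `r`, for `r = 2 ^ (-R)`. It maps the interval of length `i * r` starting at `0` onto
the one of length `(i + 1) * r`, for each natural number `i ≥ 1`. -/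
noncomputable def stretchIso (R : ℕ) : ℝ ≃o ℝ :=
  glueIso (glueIso (OrderIso.refl ℝ) doubleIso 0 refl_zero_eq_doubleIso_zero)
    (OrderIso.addRight (((1 : ℤ) : ℝ) / 2 ^ R)) (((1 : ℤ) : ℝ) / 2 ^ R) (by
      rw [glueIso_of_ge _ (by positivity)]
      rw [doubleIso_apply, OrderIso.addRight_apply, two_mul])

theorem stretchIso_of_le_zero (R : ℕ) {t : ℝ} (ht : t ≤ 0) : stretchIso R t = t := by
  rw [stretchIso, glueIso_of_le _ (ht.trans (by positivity)), glueIso_of_le _ ht]; rfl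

theorem stretchIso_of_mem (R : ℕ) {t : ℝ} (ht : t ∈ Icc 0 (((1 : ℤ) : ℝ) / 2 ^ R)) :
    stretchIso R t = 2 * t := by
  rw [stretchIso, glueIso_of_le _ ht.2, glueIso_of_ge _ ht.1]; rfl

theorem stretchIso_of_ge (R : ℕ) {t : ℝ} (ht : ((1 : ℤ) : ℝ) / 2 ^ R ≤ t) :
    stretchIso R t = t + ((1 : ℤ) : ℝ) / 2 ^ R := by
  rw [stretchIso, glueIso_of_ge _ ht]; rfl

theorem affAt_of_eventually {f : ℝ → ℝ} {t c : ℝ} {k : ℤ} (h : ∀ᶠ s in 𝓝 t, f s = c + 2 ^ k * s) :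
    AffAt f t :=
  ⟨k, h.mono fun s hs => by rw [hs, h.self_of_nhds]; ring⟩

theorem mild_stretchIso (R : ℕ) : Mild R 1 (stretchIso R) := by
  have hr : (0 : ℝ) < ((1 : ℤ) : ℝ) / 2 ^ R := by push_cast; positivity
  refine Mild.of_affine (fun t ht => ?_) fun t => ?_
  · rcases lt_trichotomy t 0 with h | rfl | h
    · refine absurd (affAt_of_eventually (k := 0) (c := 0) ?_) ht
      filter_upwards [Iio_mem_nhds h] with s hs
      rw [stretchIso_of_le_zero R (le_of_lt hs)]; simp
    · exact ⟨by simpa using TwoBdd.int_div 0 (R + 1), IsDyadic.zero⟩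
    · rcases lt_trichotomy t (((1 : ℤ) : ℝ) / 2 ^ R) with h' | rfl | h'
      · refine absurd (affAt_of_eventually (k := 1) (c := 0) ?_) ht
        filter_upwards [Ioo_mem_nhds h h'] with s hs
        rw [stretchIso_of_mem R (Ioo_subset_Icc_self hs)]; simp
      · exact ⟨(TwoBdd.int_div 1 R).mono (by omega), IsDyadic.int_div 1 R⟩
      · refine absurd (affAt_of_eventually (k := 0) (c := ((1 : ℤ) : ℝ) / 2 ^ R) ?_) ht
        filter_upwards [Ioi_mem_nhds h'] with s hs
        rw [stretchIso_of_ge R (le_of_lt hs), zpow_zero, one_mul, add_comm]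
  · have z : TwoBdd R 0 := by simpa using TwoBdd.int_div 0 R
    rcases le_total t 0 with h | h
    · exact ⟨0, 0, by simp, z, IsDyadic.zero, by rw [stretchIso_of_le_zero R h]; simp⟩
    rcases le_total t (((1 : ℤ) : ℝ) / 2 ^ R) with h' | h'
    · exact ⟨1, 0, by simp, z, IsDyadic.zero, by rw [stretchIso_of_mem R ⟨h, h'⟩]; simp⟩
    · exact ⟨0, _, by simp, TwoBdd.int_div 1 R, IsDyadic.int_div 1 R, by
        rw [stretchIso_of_ge R h', zpow_zero, one_mul, add_comm]⟩

/-- Composing `n` stretches lengthens an interval of length `a / 2 ^ R` by `n / 2 ^ R`. -/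
theorem exists_mild_stretch (R n : ℕ) : ∀ a : ℕ, 1 ≤ a →
    ∃ F : ℝ ≃o ℝ, Mild R n F ∧ F 0 = 0 ∧ F (a / 2 ^ R) = (a + n : ℕ) / 2 ^ R := by
  induction n with
  | zero =>
    intro a ha
    refine ⟨OrderIso.refl ℝ, ?_, rfl, by simp⟩
    have haff : ∀ t, AffAt (OrderIso.refl ℝ) t := fun t =>
      affAt_of_eventually (k := 0) (c := 0) (Eventually.of_forall fun s => by simp)
    exact ⟨fun t h => absurd (haff t) h, fun M t _ h => h, fun M t _ h => h, fun t => Iff.rfl⟩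
  | succ n ih =>
    intro a ha
    obtain ⟨F, h1, h2, h3⟩ := ih (a + 1) (by omega)
    refine ⟨(stretchIso R).trans F, (mild_stretchIso R).trans h1, ?_, ?_⟩
    · rw [OrderIso.trans_apply, stretchIso_of_le_zero R le_rfl, h2]
    · rw [OrderIso.trans_apply, stretchIso_of_ge R, ← add_div]
      · have e : ((a : ℝ) + ((1 : ℤ) : ℝ)) = ((a + 1 : ℕ) : ℝ) := by push_cast; rfl
        rw [e, h3, show a + 1 + n = a + (n + 1) by ring]
      · gcongr
        exact_mod_cast ha

theorem Mild.mono {R n n' : ℕ} (h : n ≤ n') {f : ℝ ≃o ℝ} (hf : Mild R n f) : Mild R n' f where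
  brk t ht := ⟨(hf.brk t ht).1.mono (by omega), (hf.brk t ht).2⟩
  two M t hM ht := (hf.two M t hM ht).mono (by omega)
  two_symm M t hM ht := (hf.two_symm M t hM ht).mono (by omega)
  dyad := hf.dyad

theorem mild_addRight {R : ℕ} {c : ℝ} (hc : TwoBdd R c) (hc' : IsDyadic c) :
    Mild R 0 (OrderIso.addRight c) := by
  have e : ∀ t, OrderIso.addRight c t = c + 2 ^ (0 : ℤ) * t := fun t => by simp [add_comm]
  refine Mild.of_affine (fun t ht => absurd ?_ ht) fun t => ⟨0, c, by simp, hc, hc', e t⟩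
  exact affAt_of_eventually (Eventually.of_forall e)

theorem TwoBdd.exists_nat_of_mem {R : ℕ} {d : ℝ} (h : TwoBdd R d) (h' : IsDyadic d)
    (hd : d ∈ Icc (0 : ℝ) 1) : ∃ a : ℕ, a ≤ 2 ^ R ∧ d = a / 2 ^ R := by
  obtain ⟨m, rfl⟩ := h.of_isDyadic h'
  have h1 : (0 : ℝ) ≤ m := by
    have := hd.1
    rwa [le_div_iff₀ (by positivity), zero_mul] at this
  have h2 := hd.2
  rw [div_le_one (by positivity)] at h2
  lift m to ℕ using (by exact_mod_cast h1)
  exact ⟨m, by exact_mod_cast h2, by push_cast; rfl⟩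

/-- Any two intervals with endpoints among the multiples of `2 ^ (-R)` in `[0, 1]` are related by a
dyadic piecewise linear map with denominators bounded in terms of `R`. -/
theorem exists_mild_interval {R : ℕ} {d e d' e' : ℝ} (hd : TwoBdd R d) (he : TwoBdd R e)
    (hd' : TwoBdd R d') (he' : TwoBdd R e') (hd2 : IsDyadic d) (he2 : IsDyadic e)
    (hd2' : IsDyadic d') (he2' : IsDyadic e') (hdm : d ∈ Icc (0 : ℝ) 1) (hem : e ∈ Icc (0 : ℝ) 1)
    (hdm' : d' ∈ Icc (0 : ℝ) 1) (hem' : e' ∈ Icc (0 : ℝ) 1) (hlt : d < e) (hlt' : d' < e') :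
    ∃ F : ℝ ≃o ℝ, Mild R (2 * 2 ^ R) F ∧ F d = d' ∧ F e = e' := by
  have key : ∀ {d e : ℝ}, TwoBdd R d → TwoBdd R e → IsDyadic d → IsDyadic e → d ∈ Icc (0 : ℝ) 1 →
      e ∈ Icc (0 : ℝ) 1 → d < e → ∃ a : ℕ, 1 ≤ a ∧ a ≤ 2 ^ R ∧ e - d = a / 2 ^ R := by
    intro d e hd he hd2 he2 hdm hem hlt
    obtain ⟨a, ha, rfl⟩ := hd.exists_nat_of_mem hd2 hdm
    obtain ⟨b, hb, rfl⟩ := he.exists_nat_of_mem he2 hem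
    have hab : a < b := by
      rw [div_lt_div_iff_of_pos_right (by positivity)] at hlt
      exact_mod_cast hlt
    refine ⟨b - a, by omega, by omega, ?_⟩
    rw [Nat.cast_sub hab.le]; ring
  obtain ⟨a, ha1, ha2, ha⟩ := key hd he hd2 he2 hdm hem hlt
  obtain ⟨b, hb1, hb2, hb⟩ := key hd' he' hd2' he2' hdm' hem' hlt'
  have hF : ∃ F : ℝ ≃o ℝ, Mild R (2 * 2 ^ R) F ∧ F 0 = 0 ∧ F (a / 2 ^ R) = b / 2 ^ R := by
    rcases le_total a b with h | h
    · obtain ⟨F, h1, h2, h3⟩ := exists_mild_stretch R (b - a) a ha1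
      exact ⟨F, h1.mono (by omega), h2, by rw [h3]; congr 3; omega⟩
    · obtain ⟨F, h1, h2, h3⟩ := exists_mild_stretch R (a - b) b hb1
      refine ⟨F.symm, h1.symm.mono (by omega), by rw [F.symm_apply_eq, h2], ?_⟩
      rw [F.symm_apply_eq, h3]; congr 3; omega
  obtain ⟨F, h1, h2, h3⟩ := hF
  have hneg : IsDyadic (-d) := by
    obtain ⟨m, n, rfl⟩ := hd2
    exact ⟨-m, n, by push_cast; ring⟩
  refine ⟨(OrderIso.addRight (-d)).trans (F.trans (OrderIso.addRight d')),
    ((mild_addRight hd.neg hneg).trans (h1.trans (mild_addRight hd' hd2'))).mono (by omega), ?_, ?_⟩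
  · simp [h2]
  · simp only [OrderIso.trans_apply, OrderIso.addRight_apply]
    rw [← sub_eq_add_neg, ha, h3, ← hb]; ring

theorem Mild.isPL {R n : ℕ} {f : ℝ ≃o ℝ} (hf : Mild R n f) : IsPL f :=
  isPL_of_break f.continuous hf.brk

theorem Mild.goodAt {R n : ℕ} {f : ℝ ≃o ℝ} (hf : Mild R n f) (t : ℝ) : GoodAt (R + n) f t :=
  ⟨fun h => (hf.brk t h).1, fun M hM =>
    (hf.two (M + R) t (by omega) (hM.mono (by omega))).mono (by omega)⟩

/-! ### Normalization of a conjugator between critical points -/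

/-- The dyadic fixed points of `f` in the unit interval which are not interior to the set of fixed
points, together with the endpoints of the interval. -/
structure CritPt (f : ℝ ≃o ℝ) (d : ℝ) : Prop where
  fixed : f d = d
  dyad : IsDyadic d
  mem : d ∈ Icc (0 : ℝ) 1
  bdry : d = 0 ∨ d = 1 ∨ ¬ ∀ᶠ s in 𝓝 d, f s = s

theorem CritPt.twoBdd {N : ℕ} {f : ℝ ≃o ℝ} (hf : Lev N f) {d : ℝ} (hd : CritPt f d) :
    TwoBdd (2 * N) d := by
  rcases hd.bdry with rfl | rfl | h
  · simpa using TwoBdd.int_div 0 (2 * N)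
  · simpa using (TwoBdd.int_div 1 0).mono (show 0 ≤ 2 * N by omega)
  · exact hf.twoBdd_fixed hd.fixed h

theorem CritPt.image {N : ℕ} {x y g : PLTwo} (S : ConjData N (toIso x) (toIso y) (toIso g)) {d : ℝ}
    (hd : CritPt (toIso y) d) : CritPt (toIso x) (toIso g d) where
  fixed := by rw [S.comm, hd.fixed]
  dyad := (isDyadic_toIso_iff g d).2 hd.dyad
  mem := toIso_mem_Icc g hd.mem
  bdry := by
    rcases hd.bdry with rfl | rfl | h
    · exact Or.inl (toIso_zero g)
    · exact Or.inr (Or.inl (toIso_one_apply g))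
    · refine Or.inr (Or.inr fun h' => h ?_)
      filter_upwards [(toIso g).continuous.continuousAt.eventually h'] with s hs
      rw [S.comm] at hs
      exact (toIso g).injective hs

theorem CritPt.goodAt {N C : ℕ} (hC : 2 * N ≤ C) {x y g : PLTwo}
    (S : ConjData N (toIso x) (toIso y) (toIso g)) {d : ℝ}
    (hd : CritPt (toIso y) d) : GoodAt C (toIso g) d :=
  ⟨fun _ => (hd.twoBdd S.levY).mono hC, fun _ _ => ((hd.image S).twoBdd S.levX).mono (by omega)⟩

theorem critPt_zero (y : PLTwo) : CritPt (toIso y) 0 :=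
  ⟨toIso_zero y, IsDyadic.zero, by simp, Or.inl rfl⟩

theorem critPt_one (y : PLTwo) : CritPt (toIso y) 1 :=
  ⟨toIso_one_apply y, IsDyadic.one, by simp, Or.inr (Or.inl rfl)⟩

theorem GoodAt.congr {C : ℕ} {f g : ℝ → ℝ} {t : ℝ} (hf : GoodAt C f t) (h : f =ᶠ[𝓝 t] g) :
    GoodAt C g t :=
  ⟨fun h' => hf.1 fun h'' => h' (h''.congr h), by rw [← h.self_of_nhds]; exact hf.2⟩

/-- A conjugator may be replaced, between two fixed points of `y`, by another conjugator with the
same values at these points. -/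
theorem exists_modify {N : ℕ} {x y g : PLTwo} (S : ConjData N (toIso x) (toIso y) (toIso g))
    {d e : ℝ} (hd : CritPt (toIso y) d) (he : CritPt (toIso y) e) (hde : d < e)
    {h : ℝ ≃o ℝ} (hPL : IsPL h) (hhd : h d = toIso g d) (hhe : h e = toIso g e)
    (hcomm : ∀ t ∈ Icc d e, toIso x (h t) = h (toIso y t)) :
    ∃ g' : PLTwo, ConjData N (toIso x) (toIso y) (toIso g') ∧ (∀ t ≤ d, toIso g' t = toIso g t) ∧
      ∀ t ∈ Icc d e, toIso g' t = h t := by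
  have e1 : glueIso (toIso g) h d hhd.symm e = toIso g e := by
    rw [glueIso_of_ge _ hde.le, hhe]
  set G := glueIso (glueIso (toIso g) h d hhd.symm) (toIso g) e e1 with hG
  have hGle : ∀ t ≤ d, G t = toIso g t := fun t ht => by
    rw [hG, glueIso_of_le _ (ht.trans hde.le), glueIso_of_le _ ht]
  have hGmid : ∀ t ∈ Icc d e, G t = h t := fun t ht => by
    rw [hG, glueIso_of_le _ ht.2, glueIso_of_ge _ ht.1]
  have hGge : ∀ t, e ≤ t → G t = toIso g t := fun t ht => by rw [hG, glueIso_of_ge _ ht]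
  have hyd : ∀ t, toIso y t ≤ d ↔ t ≤ d := fun t => by
    conv_lhs => rw [← hd.fixed]
    exact (toIso y).le_iff_le
  have hye : ∀ t, e ≤ toIso y t ↔ e ≤ t := fun t => by
    conv_lhs => rw [← he.fixed]
    exact (toIso y).le_iff_le
  obtain ⟨g', hg'⟩ := exists_toIso_eq (f := G)
    (isPL_glueIso _ (isPL_glueIso _ (isPL_toIso g) hPL hd.dyad) (isPL_toIso g) he.dyad)
    (fun t ht => by rw [hGle t (ht.trans hd.mem.1), toIso_of_le_zero g ht])
    (fun t ht => by rw [hGge t (he.mem.2.trans ht), toIso_of_one_le g ht])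
  refine ⟨g', ⟨fun t => ?_, S.levX, S.levX', S.levY, S.levY'⟩, fun t ht => ?_, fun t ht => ?_⟩
  · rw [hg']
    rcases le_total t d with h1 | h1
    · rw [hGle t h1, hGle _ ((hyd t).2 h1), S.comm]
    rcases le_total e t with h2 | h2
    · rw [hGge t h2, hGge _ ((hye t).2 h2), S.comm]
    · rw [hGmid t ⟨h1, h2⟩, hGmid _ ⟨?_, ?_⟩, hcomm t ⟨h1, h2⟩]
      · rw [← hd.fixed]; exact (toIso y).monotone h1
      · rw [← he.fixed]; exact (toIso y).monotone h2
  · rw [hg', hGle t ht]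
  · rw [hg', hGmid t ht]

/-- The exponent of the slope at a fixed point is additive, so it is multiplied by `m` under an
`m`-th power. -/
theorem RightSlope.toIso_zpow {x : PLTwo} {q : ℝ} (hq : toIso x q = q) {s : ℤ}
    (hs : RightSlope (toIso x) q s) (m : ℤ) :
    toIso (x ^ m) q = q ∧ RightSlope (toIso (x ^ m)) q (m * s) := by
  have hq' : toIso x⁻¹ q = q := by rw [toIso_inv, (toIso x).symm_apply_eq, hq]
  have hs' : RightSlope (toIso x⁻¹) q (-s) := by
    have := hs.symm
    rwa [hq, ← toIso_inv] at this
  have hmul : ∀ (f g : PLTwo), (toIso (f * g) : ℝ → ℝ) = fun t => toIso f (toIso g t) :=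
    fun f g => funext (toIso_mul f g)
  induction m with
  | zero =>
    rw [zpow_zero, zero_mul]
    refine ⟨toIso_one q, Eventually.of_forall fun s => ?_⟩
    rw [toIso_one, toIso_one]; simp
  | succ i ih =>
    obtain ⟨h1, h2⟩ := ih
    rw [zpow_add, zpow_one, toIso_mul, hq, hmul]
    refine ⟨h1, ?_⟩
    have := RightSlope.comp (f := toIso (x ^ (i : ℤ))) (g := toIso x) (t := q)
      (by rw [hq]; exact h2) hs
    convert this using 1
    ring
  | pred i ih =>
    obtain ⟨h1, h2⟩ := ih
    rw [zpow_sub, zpow_one, toIso_mul, hq', hmul]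
    refine ⟨h1, ?_⟩
    have := RightSlope.comp (f := toIso (x ^ (-(i : ℤ)))) (g := toIso x⁻¹) (t := q)
      (by rw [hq']; exact h2) hs'
    convert this using 1
    ring

theorem toIso_zpow_comm {x : PLTwo} (m : ℤ) (t : ℝ) :
    toIso x (toIso (x ^ m) t) = toIso (x ^ m) (toIso x t) := by
  rw [← toIso_mul, ← toIso_mul, (Commute.refl x).zpow_right m]

/-- The next critical point after `d`. -/
theorem CritPt.exists_next {N : ℕ} {y : PLTwo} (hy : Lev N (toIso y)) {d : ℝ} (hd1 : d < 1) :
    ∃ e, CritPt (toIso y) e ∧ d < e ∧ ∀ t ∈ Ioo d e, ¬ CritPt (toIso y) t := by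
  have hfin : {t | CritPt (toIso y) t}.Finite := by
    refine ((Finset.range (2 ^ (2 * N) + 1)).finite_toSet.image
      (fun a : ℕ => (a : ℝ) / 2 ^ (2 * N))).subset ?_
    intro t ht
    obtain ⟨a, ha, e⟩ := (CritPt.twoBdd hy ht).exists_nat_of_mem ht.dyad ht.mem
    exact ⟨a, by simpa [Nat.lt_succ_iff] using ha, e.symm⟩
  obtain ⟨e, ⟨he, hde⟩, hmin⟩ := Set.exists_min_image ({t | CritPt (toIso y) t} ∩ Ioi d) id
    (hfin.inter_of_left _) ⟨1, critPt_one y, hd1⟩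
  exact ⟨e, he, hde, fun t ht hcrit => absurd (hmin t ⟨hcrit, ht.1⟩) (not_le.2 ht.2)⟩

/-- Between consecutive critical points, `y` is the identity on the whole interval or near no
point. -/
theorem eq_self_or_not_eventually {y : PLTwo} {d e : ℝ} (hd : d ∈ Icc (0 : ℝ) 1)
    (he : e ∈ Icc (0 : ℝ) 1) (hde : d < e)
    (hcrit : ∀ t ∈ Ioo d e, ¬ CritPt (toIso y) t) :
    (∀ t ∈ Icc d e, toIso y t = t) ∨ ∀ t ∈ Ioo d e, ¬ ∀ᶠ s in 𝓝 t, toIso y s = s := by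
  by_contra! hcon
  obtain ⟨⟨u, hu, hyu⟩, t, ht, hyt⟩ := hcon
  let V : Set ℝ := {t | ∀ᶠ s in 𝓝 t, toIso y s = s}
  have hV : IsOpen V := isOpen_iff_mem_nhds.2 fun t ht => ht.eventually_nhds
  have hW : IsOpen (closure V)ᶜ := isClosed_closure.isOpen_compl
  have hcl : ∀ s ∈ Ioo d e, s ∈ closure V → s ∈ V := by
    intro s hs hsV
    have hfix : toIso y s = s := by
      have h1 : closure V ⊆ {s | toIso y s = s} :=
        closure_minimal (fun r hr => hr.self_of_nhds)
          (isClosed_eq (toIso y).continuous continuous_id)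
      exact h1 hsV
    by_contra hsV'
    by_cases hdy : IsDyadic s
    · exact hcrit s hs ⟨hfix, hdy, ⟨by linarith [hd.1, hs.1], by linarith [he.2, hs.2]⟩,
        Or.inr (Or.inr hsV')⟩
    · obtain ⟨k, hk⟩ := (isPL_toIso y).affAt hdy
      obtain ⟨r, hrk, hrV⟩ := mem_closure_iff_nhds.1 hsV
        {r | ∀ᶠ z in 𝓝 r, toIso y z = toIso y s + 2 ^ k * (z - s)} hk.eventually_nhds
      have h2 : ∀ᶠ z in 𝓝[>] r, toIso y z = z ∧ toIso y z = toIso y s + 2 ^ k * (z - s) :=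
        (Filter.Eventually.and hrV hrk).filter_mono nhdsWithin_le_nhds
      obtain ⟨z, ⟨hz1, hz2⟩, hz3⟩ := (h2.and self_mem_nhdsWithin).exists
      have hz3 : r < z := hz3
      have hr1 := hrV.self_of_nhds
      have hr2 := hrk.self_of_nhds
      rw [hfix] at hz2 hr2
      have h3 : ((2 : ℝ) ^ k - 1) * (z - r) = 0 := by linarith
      have h4 : (2 : ℝ) ^ k = 1 := by
        rcases mul_eq_zero.1 h3 with h | h <;> linarith
      apply hsV'
      filter_upwards [hk] with z hz
      rw [hz, hfix, h4]; ring
  have hsub : Ioo d e ⊆ V := by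
    refine isPreconnected_Ioo.subset_left_of_subset_union hV hW
      (Set.disjoint_left.2 fun s h1 h2 => h2 (subset_closure h1)) (fun s hs => ?_) ⟨t, ht, hyt⟩
    by_cases h : s ∈ closure V
    · exact Or.inl (hcl s hs h)
    · exact Or.inr h
  have hcl2 : Icc d e ⊆ {s | toIso y s = s} := by
    rw [← closure_Ioo hde.ne]
    exact closure_minimal (fun s hs => (hsub hs).self_of_nhds)
      (isClosed_eq (toIso y).continuous continuous_id)
  exact hyu (hcl2 hu)

/-- The bound for the denominators of a suitable conjugator between conjugate elements of
level `N`. -/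
def conjBound (N : ℕ) : ℕ := pieceBound N + (2 * N + 2 * 2 ^ (2 * N))

/-- A conjugator can be changed to one with bounded denominators between a critical point and the
next: to a map of controlled denominators where `y` is the identity, and by composition with a power
of `x` elsewhere. -/
theorem exists_goodAt_next {N : ℕ} {x y g : PLTwo} (S : ConjData N (toIso x) (toIso y) (toIso g))
    {d : ℝ} (hd : CritPt (toIso y) d) (hd1 : d < 1) :
    ∃ e, CritPt (toIso y) e ∧ d < e ∧ ∃ g' : PLTwo, ConjData N (toIso x) (toIso y) (toIso g') ∧
      (∀ t ≤ d, toIso g' t = toIso g t) ∧ ∀ t ∈ Ioo d e, GoodAt (conjBound N) (toIso g') t := by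
  obtain ⟨e, he, hde, hcrit⟩ := CritPt.exists_next S.levY hd1
  refine ⟨e, he, hde, ?_⟩
  have hgd := hd.image S
  have hge := he.image S
  have hlt := (toIso g).strictMono hde
  rcases eq_self_or_not_eventually hd.mem he.mem hde hcrit with hid | hV
  · obtain ⟨h, h1, h2, h3⟩ := exists_mild_interval (hd.twoBdd S.levY) (he.twoBdd S.levY)
      (hgd.twoBdd S.levX) (hge.twoBdd S.levX) hd.dyad he.dyad hgd.dyad hge.dyad hd.mem he.mem
      hgd.mem hge.mem hde hlt
    obtain ⟨g', h4, h5, h6⟩ := exists_modify S hd he hde h1.isPL h2 h3 (by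
      intro t ht
      rw [hid t ht]
      obtain ⟨u, hu⟩ := (toIso g).surjective (h t)
      have hu2 : u ∈ Icc d e := by
        constructor
        · rw [← (toIso g).le_iff_le, hu, ← h2]; exact h.monotone ht.1
        · rw [← (toIso g).le_iff_le, hu, ← h3]; exact h.monotone ht.2
      rw [← hu, S.comm, hid u hu2])
    refine ⟨g', h4, h5, fun t ht => ?_⟩
    refine ((h1.goodAt t).mono (by unfold conjBound; omega)).congr ?_
    filter_upwards [Ioo_mem_nhds ht.1 ht.2] with s hs
    exact (h6 s (Ioo_subset_Icc_self hs)).symm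
  · obtain ⟨k₀, hk₀⟩ := (isPL_toIso g).exists_rightSlope d
    obtain ⟨s, hs⟩ := (isPL_toIso x).exists_rightSlope (toIso g d)
    have hsN : s ≠ 0 ∧ |s| ≤ N := by
      obtain ⟨s', hs'⟩ := (isPL_toIso y).exists_rightSlope d
      have hss : s = s' := by
        have e1 := hs.comp hk₀
        have e2 := RightSlope.comp (f := toIso g) (g := toIso y) (t := d)
          (by rw [hd.fixed]; exact hk₀) hs'
        have e3 : (fun t => toIso x (toIso g t)) = fun t => toIso g (toIso y t) := funext S.comm
        rw [e3] at e1
        have := e1.unique e2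
        omega
      subst hss
      constructor
      · rintro rfl
        have h1 : ∀ᶠ t in 𝓝[>] d, toIso y t = t := hs'.mono fun t ht => by
          rw [ht, hd.fixed]; simp
        obtain ⟨u, hu, h2⟩ := mem_nhdsGT_iff_exists_Ioo_subset.1 h1
        have hu : d < u := hu
        have hm : d < min u e := lt_min hu hde
        refine hV ((d + min u e) / 2) ⟨by linarith, by linarith [min_le_right u e]⟩ ?_
        filter_upwards [Ioo_mem_nhds (show d < (d + min u e) / 2 by linarith)
          (show (d + min u e) / 2 < u by linarith [min_le_left u e])] with t ht
        exact h2 ht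
      · obtain ⟨j, hj⟩ := exists_mem_Ico_grid N d
        obtain ⟨k, m, hk, h⟩ := S.levY j
        have hks : RightSlope (toIso y) d k := by
          filter_upwards [Ioo_mem_nhdsGT hj.2] with t ht
          rw [h t ⟨by linarith [hj.1, ht.1], ht.2.le⟩, h d ⟨hj.1, hj.2.le⟩]; ring
        rw [hs'.unique hks]
        exact hk
    -- the power of `x` that reduces the initial slope modulo the slope of `x`
    obtain ⟨h1, h2⟩ := RightSlope.toIso_zpow hgd.fixed hs (-(k₀ / s))
    have h1e : toIso (x ^ (-(k₀ / s))) (toIso g e) = toIso g e := by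
      obtain ⟨s', hs'⟩ := (isPL_toIso x).exists_rightSlope (toIso g e)
      exact (RightSlope.toIso_zpow hge.fixed hs' _).1
    obtain ⟨g', h4, h5, h6⟩ := exists_modify S hd he hde
      (isPL_toIso (x ^ (-(k₀ / s)) * g)) (by rw [toIso_mul, h1]) (by rw [toIso_mul, h1e])
      (by intro t _; rw [toIso_mul, toIso_mul, toIso_zpow_comm, S.comm])
    have hslope : RightSlope (toIso g') d (k₀ % s) := by
      have h7 := RightSlope.comp (f := toIso (x ^ (-(k₀ / s)))) h2 hk₀
      have h8 : -(k₀ / s) * s + k₀ = k₀ % s := by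
        rw [Int.emod_def]; ring
      rw [h8] at h7
      filter_upwards [h7, Ioo_mem_nhdsGT hde] with t ht ht'
      rw [h6 t (Ioo_subset_Icc_self ht'), h6 d ⟨le_rfl, hde.le⟩, toIso_mul, toIso_mul]
      exact ht
    have hmod : |k₀ % s| ≤ N := by
      rw [abs_of_nonneg (Int.emod_nonneg _ hsN.1)]
      exact (Int.emod_lt_abs _ hsN.1).le.trans hsN.2
    refine ⟨g', h4, h5, fun t ht => ?_⟩
    refine GoodAt.mono (C := pieceBound N) (by unfold conjBound; omega) ?_
    refine h4.goodAt_of_mem_piece hd.mem.1 he.mem.2 (hd.image h4).mem.1 (he.image h4).mem.2 hd.fixed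
      he.fixed hV (fun u hu hyu => (isPL_toIso g').affAt fun hdy => ?_)
      (isPL_toIso g').exists_rightSlope (isPL_toIso g').exists_leftSlope hslope hmod ht
    exact hcrit u hu ⟨hyu, hdy, ⟨by linarith [hd.mem.1, hu.1], by linarith [he.mem.2, hu.2]⟩,
      Or.inr (Or.inr (hV u hu))⟩

/-- Conjugate elements of level `N` have a conjugator with denominators bounded in terms of `N`. -/
theorem exists_goodAt {N : ℕ} {x y g : PLTwo} (S : ConjData N (toIso x) (toIso y) (toIso g)) :
    ∃ g' : PLTwo, ConjData N (toIso x) (toIso y) (toIso g') ∧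
      ∀ t ∈ Icc (0 : ℝ) 1, GoodAt (conjBound N) (toIso g') t := by
  have hC : 2 * N ≤ conjBound N := by unfold conjBound; omega
  have key : ∀ n : ℕ, ∃ d, CritPt (toIso y) d ∧ ((n : ℝ) / 2 ^ (2 * N) ≤ d ∨ d = 1) ∧
      ∃ g' : PLTwo, ConjData N (toIso x) (toIso y) (toIso g') ∧
        ∀ t ∈ Ico (0 : ℝ) d, GoodAt (conjBound N) (toIso g') t := by
    intro n
    induction n with
    | zero => exact ⟨0, critPt_zero y, Or.inl (by simp), g, S, fun t ht => by simp at ht⟩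
    | succ n ih =>
      obtain ⟨d, hd, hn, g', S', hg'⟩ := ih
      rcases eq_or_lt_of_le hd.mem.2 with h1 | h1
      · exact ⟨d, hd, Or.inr h1, g', S', hg'⟩
      obtain ⟨e, he, hde, g'', S'', h2, h3⟩ := exists_goodAt_next S' hd h1
      refine ⟨e, he, Or.inl ?_, g'', S'', fun t ht => ?_⟩
      · obtain ⟨a, -, ha⟩ := (hd.twoBdd S.levY).exists_nat_of_mem hd.dyad hd.mem
        obtain ⟨b, -, hb⟩ := (he.twoBdd S.levY).exists_nat_of_mem he.dyad he.mem
        have hn := hn.resolve_right h1.ne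
        rw [ha, hb, div_lt_div_iff_of_pos_right (by positivity)] at hde
        rw [ha, div_le_div_iff_of_pos_right (by positivity)] at hn
        rw [hb, div_le_div_iff_of_pos_right (by positivity)]
        have h4 : n ≤ a := by exact_mod_cast hn
        have h5 : a < b := by exact_mod_cast hde
        exact_mod_cast (by omega : n + 1 ≤ b)
      · rcases lt_trichotomy t d with h4 | rfl | h4
        · refine (hg' t ⟨ht.1, h4⟩).congr ?_
          filter_upwards [Iio_mem_nhds h4] with s hs
          exact (h2 s (le_of_lt hs)).symm
        · exact hd.goodAt hC S''
        · exact h3 t ⟨h4, ht.2⟩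
  obtain ⟨d, hd, hn, g', S', hg'⟩ := key (2 ^ (2 * N))
  have hd1 : d = 1 := by
    rcases hn with h | h
    · refine le_antisymm hd.mem.2 (le_trans (le_of_eq ?_) h)
      push_cast
      exact (div_self (by positivity)).symm
    · exact h
  subst hd1
  refine ⟨g', S', fun t ht => ?_⟩
  rcases eq_or_lt_of_le ht.2 with rfl | h
  · exact hd.goodAt hC S'
  · exact hg' t ⟨ht.1, h⟩

/-! ### Breakpoint tables -/

/-- `c` lists the vertices of a polygonal graph of `f` over the unit interval whose edges have
slopes powers of `2`. In contrast to `IsBreakpointTable`, this makes sense for functions on the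
real line and is symmetric under exchanging the coordinates. -/
structure IsVertexList (c : BreakpointTable) (f : ℝ → ℝ) : Prop where
  head : ∃ p ∈ c.head?, dyadicValue p.1 = 0 ∧ dyadicValue p.2 = 0
  last : ∃ p ∈ c.getLast?, dyadicValue p.1 = 1 ∧ dyadicValue p.2 = 1
  chain : c.IsChain fun p q => ∃ k : ℤ, dyadicValue p.1 < dyadicValue q.1 ∧
    dyadicValue q.2 = dyadicValue p.2 + 2 ^ k * (dyadicValue q.1 - dyadicValue p.1) ∧
    ∀ t ∈ Icc (dyadicValue p.1) (dyadicValue q.1),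
      f t = dyadicValue p.2 + 2 ^ k * (t - dyadicValue p.1)

theorem dyadicValue_nonneg (p : ℕ × ℕ) : 0 ≤ dyadicValue p := by
  unfold dyadicValue; positivity

theorem isChain_le_getLast {α : Type*} {R : α → α → Prop} {φ : α → ℝ}
    (hR : ∀ p q, R p q → φ p < φ q) : ∀ {c : List α}, c.IsChain R → ∀ l ∈ c.getLast?,
      ∀ p ∈ c, φ p ≤ φ l
  | [], _, l, hl, p, hp => by simp at hp
  | [a], _, l, hl, p, hp => by
    simp at hl hp; subst hl hp; exact le_rfl
  | a :: b :: c, h, l, hl, p, hp => by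
    rw [List.isChain_cons_cons] at h
    have hl' : l ∈ (b :: c).getLast? := by simpa using hl
    rcases List.mem_cons.1 hp with rfl | hp
    · exact (hR _ _ h.1).le.trans (isChain_le_getLast hR h.2 l hl' b (by simp))
    · exact isChain_le_getLast hR h.2 l hl' p hp

/-- A point between the first and the last element of a chain lies between two consecutive
elements. -/
theorem isChain_exists_between {α : Type*} {R : α → α → Prop} {φ : α → ℝ} :
    ∀ {c : List α}, c.IsChain R → ∀ h ∈ c.head?, ∀ l ∈ c.getLast?,
      ∀ t, φ h ≤ t → t < φ l → ∃ p ∈ c, ∃ q ∈ c, R p q ∧ φ p ≤ t ∧ t < φ q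
  | [], _, h, hh, l, hl, t, h1, h2 => by simp at hh
  | [a], _, h, hh, l, hl, t, h1, h2 => by
    simp at hh hl; subst hh hl; exact absurd h2 (not_lt.2 h1)
  | a :: b :: c, hc, h, hh, l, hl, t, h1, h2 => by
    rw [List.isChain_cons_cons] at hc
    have hl' : l ∈ (b :: c).getLast? := by simpa using hl
    simp only [List.head?_cons, Option.mem_def, Option.some.injEq] at hh
    subst hh
    rcases lt_or_ge t (φ b) with h3 | h3
    · exact ⟨a, by simp, b, by simp, hc.1, h1, h3⟩
    · obtain ⟨p, hp, q, hq, h4⟩ := isChain_exists_between hc.2 b (by simp) l hl' t h3 h2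
      exact ⟨p, List.mem_cons_of_mem _ hp, q, List.mem_cons_of_mem _ hq, h4⟩

theorem IsBreakpointTable.isVertexList {c : BreakpointTable} {f : PLTwo}
    (hc : IsBreakpointTable c f) : IsVertexList c (toIso f) := by
  obtain ⟨h1, h2, h3⟩ := hc
  refine ⟨h1, h2, ?_⟩
  obtain ⟨l, hl, hl1, -⟩ := h2
  have hle : ∀ p ∈ c, dyadicValue p.1 ≤ 1 := by
    intro p hp
    rw [← hl1]
    exact isChain_le_getLast (φ := fun p => dyadicValue p.1) (fun p q h => h.1) h3 l hl p hp
  rw [List.isChain_iff_getElem] at h3 ⊢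
  intro i hi
  obtain ⟨hlt, hf⟩ := h3 i hi
  set p := (c)[i]
  set q := (c)[i + 1] with hq
  have hq1 := hle q (List.getElem_mem hi)
  have hf' : ∀ t ∈ Icc (dyadicValue p.1) (dyadicValue q.1), toIso f t = dyadicValue p.2 +
      (dyadicValue q.2 - dyadicValue p.2) / (dyadicValue q.1 - dyadicValue p.1) *
        (t - dyadicValue p.1) := by
    intro t ht
    have := hf ⟨t, (dyadicValue_nonneg _).trans ht.1, ht.2.trans hq1⟩ ht.1 ht.2
    rwa [← toIso_coe] at this
  obtain ⟨k, hk⟩ := (isPL_toIso f).exists_rightSlope (dyadicValue p.1)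
  have hk2 : (dyadicValue q.2 - dyadicValue p.2) / (dyadicValue q.1 - dyadicValue p.1) =
      2 ^ k := by
    obtain ⟨t, ht1, ht2⟩ := (hk.and (Ioo_mem_nhdsGT hlt)).exists
    rw [hf' t (Ioo_subset_Icc_self ht2), hf' _ ⟨le_rfl, hlt.le⟩, sub_self, mul_zero, add_zero]
      at ht1
    exact mul_right_cancel₀ (sub_pos.2 ht2.1).ne' (by linarith)
  rw [hk2] at hf'
  refine ⟨k, hlt, ?_, hf'⟩
  rw [← hk2, div_mul_cancel₀ _ (sub_pos.2 hlt).ne']; ring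

theorem IsVertexList.isBreakpointTable {c : BreakpointTable} {f : PLTwo}
    (hc : IsVertexList c (toIso f)) : IsBreakpointTable c f := by
  refine ⟨hc.head, hc.last, hc.chain.imp ?_⟩
  rintro p q ⟨k, hlt, h2, h3⟩
  refine ⟨hlt, fun t h4 h5 => ?_⟩
  rw [← toIso_coe, h3 t ⟨h4, h5⟩, h2, add_sub_cancel_left,
    mul_div_cancel_right₀ _ (sub_pos.2 hlt).ne']

theorem IsVertexList.symm {c : BreakpointTable} {f : ℝ ≃o ℝ} (hc : IsVertexList c f) :
    IsVertexList (c.map Prod.swap) f.symm := by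
  obtain ⟨⟨p, hp, hp1, hp2⟩, ⟨q, hq, hq1, hq2⟩, h3⟩ := hc
  refine ⟨⟨p.swap, ?_, hp2, hp1⟩, ⟨q.swap, ?_, hq2, hq1⟩, ?_⟩
  · rw [List.head?_map]; exact Option.mem_map_of_mem _ hp
  · rw [List.getLast?_map]; exact Option.mem_map_of_mem _ hq
  · rw [List.isChain_map]
    refine h3.imp ?_
    rintro p q ⟨k, hlt, h2, h4⟩
    have hk : (0 : ℝ) < 2 ^ k := by positivity
    have hd : (0 : ℝ) < 2 ^ k * (dyadicValue q.1 - dyadicValue p.1) :=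
      mul_pos hk (sub_pos.2 hlt)
    refine ⟨-k, ?_, ?_, ?_⟩
    · simp only [Prod.fst_swap]; linarith
    · simp only [Prod.fst_swap, Prod.snd_swap]
      rw [h2, zpow_neg]; field_simp; ring
    · simp only [Prod.fst_swap, Prod.snd_swap]
      intro t ht
      rw [f.symm_apply_eq, h4]
      · rw [zpow_neg]; field_simp; ring
      · rw [h2] at ht
        have h5 : 2 ^ (-k) * (t - dyadicValue p.2) ≤ dyadicValue q.1 - dyadicValue p.1 := by
          rw [zpow_neg, inv_mul_le_iff₀ hk]; linarith [ht.2]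
        have h6 : 0 ≤ 2 ^ (-k) * (t - dyadicValue p.2) :=
          mul_nonneg (by positivity) (sub_nonneg.2 ht.1)
        exact ⟨by linarith, by linarith⟩

/-- The exponents of the denominators in a table are at most `N`. -/
def ExpLE (N : ℕ) (c : BreakpointTable) : Prop := ∀ p ∈ c, p.1.2 ≤ N ∧ p.2.2 ≤ N

theorem exists_nat_dyadicValue {N : ℕ} {p : ℕ × ℕ} (hp : p.2 ≤ N) :
    ∃ n : ℕ, dyadicValue p = n / 2 ^ N := by
  obtain ⟨d, rfl⟩ := Nat.exists_eq_add_of_le hp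
  refine ⟨p.1 * 2 ^ d, ?_⟩
  unfold dyadicValue
  rw [pow_add]; push_cast; field_simp

/-- Distinct vertices differ by at least `2 ^ (-N)` in each coordinate, which bounds the slopes. -/
theorem IsVertexList.lev {N : ℕ} {c : BreakpointTable} {f : ℝ → ℝ} (hc : IsVertexList c f)
    (hN : ExpLE N c) (h0 : ∀ t ≤ 0, f t = t) (h1 : ∀ t, 1 ≤ t → f t = t) : Lev N f := by
  intro j
  have hpos : (0 : ℝ) < 2 ^ N := by positivity
  have hid : ∀ t : ℝ, t = ((j * 2 ^ N : ℤ) : ℝ) / 2 ^ (2 * N) + 2 ^ (0 : ℤ) * (t - j / 2 ^ N) := by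
    intro t
    rw [two_mul, pow_add]; push_cast; field_simp; simp
  rcases lt_or_ge j 0 with hj | hj
  · refine ⟨0, j * 2 ^ N, by simp, fun t ht => ?_⟩
    rw [h0, ← hid]
    refine ht.2.trans (div_nonpos_of_nonpos_of_nonneg ?_ hpos.le)
    exact_mod_cast hj
  rcases le_or_gt (2 ^ N) j with hj' | hj'
  · refine ⟨0, j * 2 ^ N, by simp, fun t ht => ?_⟩
    rw [h1, ← hid]
    refine le_trans ?_ ht.1
    rw [one_le_div hpos]
    exact_mod_cast hj'
  obtain ⟨h, hh, hh1, -⟩ := hc.head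
  obtain ⟨l, hl, hl1, hl2⟩ := hc.last
  have ha : (0 : ℝ) ≤ j / 2 ^ N := div_nonneg (by exact_mod_cast hj) hpos.le
  have hb : (j : ℝ) / 2 ^ N < 1 := by rw [div_lt_one hpos]; exact_mod_cast hj'
  obtain ⟨p, hp, q, hq, ⟨k, hlt, hv, hf⟩, hpj, hjq⟩ := isChain_exists_between
    (φ := fun p => dyadicValue p.1) hc.chain h hh l hl (j / 2 ^ N) (by simpa only [hh1] using ha)
    (by simpa only [hl1] using hb)
  have hq1 := isChain_le_getLast (φ := fun p => dyadicValue p.1) (fun p q ⟨_, h, _⟩ => h)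
    hc.chain l hl q hq
  have hq2 := isChain_le_getLast (φ := fun p => dyadicValue p.2) (fun p q ⟨k, h, h', _⟩ => by
    have : (0 : ℝ) < 2 ^ k * (dyadicValue q.1 - dyadicValue p.1) :=
      mul_pos (by positivity) (sub_pos.2 h)
    linarith) hc.chain l hl q hq
  simp only [hl1] at hq1
  simp only [hl2] at hq2
  have hp0 := dyadicValue_nonneg p.1
  have hp0' := dyadicValue_nonneg p.2
  obtain ⟨u, hu⟩ := exists_nat_dyadicValue (hN p hp).1
  obtain ⟨v, hv'⟩ := exists_nat_dyadicValue (hN p hp).2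
  obtain ⟨u', hu'⟩ := exists_nat_dyadicValue (hN q hq).1
  obtain ⟨v', hv''⟩ := exists_nat_dyadicValue (hN q hq).2
  have hk0 : (0 : ℝ) < 2 ^ k := by positivity
  have hdu : 1 / 2 ^ N ≤ dyadicValue q.1 - dyadicValue p.1 := by
    have e : dyadicValue q.1 - dyadicValue p.1 = ((u' - u : ℤ) : ℝ) / 2 ^ N := by
      rw [hu, hu']; push_cast; ring
    rw [e]
    apply inv_two_pow_le_of_int_div
    rw [← e]; linarith
  have hdv : 1 / 2 ^ N ≤ dyadicValue q.2 - dyadicValue p.2 := by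
    have e : dyadicValue q.2 - dyadicValue p.2 = ((v' - v : ℤ) : ℝ) / 2 ^ N := by
      rw [hv', hv'']; push_cast; ring
    rw [e]
    apply inv_two_pow_le_of_int_div
    rw [← e, hv, add_sub_cancel_left]
    exact mul_pos hk0 (sub_pos.2 hlt)
  have hkN : |k| ≤ N := by
    rw [abs_le]
    constructor
    · have h2 : (2 : ℝ) ^ (-(N : ℤ)) ≤ 2 ^ k := by
        rw [zpow_neg, zpow_natCast, ← one_div]
        calc 1 / 2 ^ N ≤ dyadicValue q.2 - dyadicValue p.2 := hdv
          _ = 2 ^ k * (dyadicValue q.1 - dyadicValue p.1) := by rw [hv]; ring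
          _ ≤ 2 ^ k * 1 := by gcongr; linarith
          _ = _ := mul_one _
      rwa [zpow_le_zpow_iff_right₀ (by norm_num)] at h2
    · have h2 : (2 : ℝ) ^ k ≤ 2 ^ (N : ℤ) := by
        have h3 : (2 : ℝ) ^ k * (1 / 2 ^ N) ≤ 1 := by
          calc (2 : ℝ) ^ k * (1 / 2 ^ N) ≤ 2 ^ k * (dyadicValue q.1 - dyadicValue p.1) := by gcongr
            _ ≤ 1 := by linarith
        rwa [mul_one_div, div_le_one hpos, ← zpow_natCast] at h3
      rwa [zpow_le_zpow_iff_right₀ (by norm_num)] at h2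
  obtain ⟨d, hd⟩ := Int.eq_ofNat_of_zero_le (show 0 ≤ k + N by have := (abs_le.1 hkN).1; omega)
  have hd' : (2 : ℝ) ^ k * 2 ^ N = 2 ^ d := by
    rw [← zpow_natCast (2 : ℝ) d, ← hd, zpow_add₀ two_ne_zero, zpow_natCast]
  refine ⟨k, v * 2 ^ N + 2 ^ d * (j - u), hkN, fun t ht => ?_⟩
  rw [hf t ⟨hpj.trans ht.1, ht.2.trans ?_⟩, hv', hu]
  · push_cast
    rw [← hd', two_mul, pow_add]; field_simp; ring
  · simp only [hu'] at hjq ⊢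
    rw [div_lt_div_iff_of_pos_right hpos] at hjq
    have : j + 1 ≤ (u' : ℤ) := by exact_mod_cast hjq
    gcongr
    exact_mod_cast this

theorem ExpLE.swap {N : ℕ} {c : BreakpointTable} (hN : ExpLE N c) :
    ExpLE N (c.map Prod.swap) := by
  intro p hp
  obtain ⟨q, hq, rfl⟩ := List.mem_map.1 hp
  exact (hN q hq).symm

theorem IsBreakpointTable.lev {N : ℕ} {c : BreakpointTable} {f : PLTwo}
    (hc : IsBreakpointTable c f) (hN : ExpLE N c) : Lev N (toIso f) :=
  hc.isVertexList.lev hN (fun _ => toIso_of_le_zero f) fun _ => toIso_of_one_le f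

theorem IsBreakpointTable.lev_symm {N : ℕ} {c : BreakpointTable} {f : PLTwo}
    (hc : IsBreakpointTable c f) (hN : ExpLE N c) : Lev N (toIso f).symm := by
  refine hc.isVertexList.symm.lev hN.swap ?_ ?_ <;> rw [← toIso_inv]
  · exact fun _ => toIso_of_le_zero _
  · exact fun _ => toIso_of_one_le _

/-! ### Tables over a standard subdivision -/

/-- The table with vertices `(j / 2 ^ B, G j / 2 ^ (2 B))` for `j ≤ n`. -/
def gridTable (B : ℕ) (G : ℕ → ℕ) (n : ℕ) : BreakpointTable :=
  (List.range (n + 1)).map fun j => ((j, B), (G j, 2 * B))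

theorem expLE_gridTable (B : ℕ) (G : ℕ → ℕ) (n : ℕ) : ExpLE (2 * B) (gridTable B G n) := by
  intro p hp
  obtain ⟨j, -, rfl⟩ := List.mem_map.1 hp
  exact ⟨by simp only; omega, le_rfl⟩

theorem isVertexList_gridTable {B : ℕ} {G : ℕ → ℕ} {f : ℝ → ℝ} (h0 : G 0 = 0)
    (h1 : G (2 ^ B) = 2 ^ (2 * B))
    (h : ∀ j : ℕ, j < 2 ^ B → ∃ k : ℤ,
      (G (j + 1) : ℝ) / 2 ^ (2 * B) = G j / 2 ^ (2 * B) + 2 ^ k * (1 / 2 ^ B) ∧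
      ∀ t ∈ Icc ((j : ℝ) / 2 ^ B) ((j + 1 : ℝ) / 2 ^ B),
        f t = G j / 2 ^ (2 * B) + 2 ^ k * (t - j / 2 ^ B)) :
    IsVertexList (gridTable B G (2 ^ B)) f := by
  refine ⟨⟨((0, B), (G 0, 2 * B)), ?_, ?_, ?_⟩, ⟨((2 ^ B, B), (G (2 ^ B), 2 * B)), ?_, ?_, ?_⟩, ?_⟩
  · simp [gridTable, List.range_succ_eq_map]
  · simp [dyadicValue]
  · simp [dyadicValue, h0]
  · simp [gridTable, List.range_succ]
  · simp [dyadicValue]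
  · simp [dyadicValue, h1]
  · rw [List.isChain_iff_getElem]
    intro i hi
    simp only [gridTable, List.length_map, List.length_range] at hi
    simp only [gridTable, List.getElem_map, List.getElem_range, dyadicValue]
    obtain ⟨k, h2, h3⟩ := h i (by omega)
    push_cast
    refine ⟨k, grid_lt B i, ?_, h3⟩
    rw [h2, add_div, add_sub_cancel_left]

/-- An element with denominators bounded by `B` has a table over the subdivision of level `B`. -/
theorem GoodAt.exists_gridTable {B : ℕ} {g : PLTwo}
    (hg : ∀ t ∈ Icc (0 : ℝ) 1, GoodAt B (toIso g) t) :
    ∃ G : ℕ → ℕ, G 0 = 0 ∧ G (2 ^ B) = 2 ^ (2 * B) ∧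
      (∀ j < 2 ^ B, ∃ e ≤ 2 * B, G (j + 1) = G j + 2 ^ e) ∧
      IsBreakpointTable (gridTable B G (2 ^ B)) g := by
  have hpos : (0 : ℝ) < 2 ^ B := by positivity
  have hval : ∀ j : ℕ, ∃ a : ℕ, j ≤ 2 ^ B →
      a ≤ 2 ^ (2 * B) ∧ toIso g (j / 2 ^ B) = a / 2 ^ (2 * B) := by
    intro j
    by_cases hj : j ≤ 2 ^ B
    · have hm : (j : ℝ) / 2 ^ B ∈ Icc (0 : ℝ) 1 := by
        refine ⟨by positivity, ?_⟩
        rw [div_le_one hpos]; exact_mod_cast hj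
      have h1 : TwoBdd B ((j : ℝ) / 2 ^ B) := by simpa using TwoBdd.int_div j B
      have h2 : IsDyadic ((j : ℝ) / 2 ^ B) := by simpa using IsDyadic.int_div j B
      have h3 := (hg _ hm).2 _ h1
      rw [← two_mul] at h3
      obtain ⟨a, ha, e⟩ := h3.exists_nat_of_mem ((isDyadic_toIso_iff g _).2 h2) (toIso_mem_Icc g hm)
      exact ⟨a, fun _ => ⟨ha, e⟩⟩
    · exact ⟨0, fun h => absurd h hj⟩
  choose G hG using hval
  have haff : ∀ j : ℕ, j < 2 ^ B → ∃ k : ℤ, ∀ t ∈ Icc ((j : ℝ) / 2 ^ B) ((j + 1 : ℝ) / 2 ^ B),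
      toIso g t = G j / 2 ^ (2 * B) + 2 ^ k * (t - j / 2 ^ B) := by
    intro j hj
    obtain ⟨k, c, hkc⟩ := affine_of_affAt (toIso g).continuous (grid_lt B j) (by
      intro t ht
      by_contra hn
      have hj' : (j + 1 : ℝ) ≤ 2 ^ B := by exact_mod_cast hj
      have hm : t ∈ Icc (0 : ℝ) 1 := by
        constructor
        · exact le_trans (by positivity) ht.1.le
        · refine ht.2.le.trans ?_
          rw [div_le_one hpos]
          exact_mod_cast hj'
      have hd : IsDyadic t := by
        by_contra hd
        exact hn ((isPL_toIso g).affAt hd)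
      obtain ⟨m, hm⟩ := ((hg t hm).1 hn).of_isDyadic hd
      exact not_int_div_of_mem_Ioo ht m hm)
    push_cast at hkc
    refine ⟨k, fun t ht => ?_⟩
    have e := (hG j hj.le).2
    rw [hkc _ ⟨le_rfl, by simpa using (grid_lt B j).le⟩] at e
    rw [hkc t ht, ← e]; ring
  have hG0 : G 0 = 0 := by
    have := (hG 0 (by positivity)).2
    simp only [Nat.cast_zero, zero_div, toIso_zero] at this
    rw [eq_div_iff (by positivity), zero_mul] at this
    exact_mod_cast this.symm
  have hG1 : G (2 ^ B) = 2 ^ (2 * B) := by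
    have := (hG (2 ^ B) le_rfl).2
    push_cast at this
    rw [div_self hpos.ne', toIso_one_apply, eq_div_iff (by positivity), one_mul] at this
    exact_mod_cast this.symm
  have hstep : ∀ j : ℕ, j < 2 ^ B → ∀ k : ℤ, (∀ t ∈ Icc ((j : ℝ) / 2 ^ B) ((j + 1 : ℝ) / 2 ^ B),
      toIso g t = G j / 2 ^ (2 * B) + 2 ^ k * (t - j / 2 ^ B)) →
      (G (j + 1) : ℝ) / 2 ^ (2 * B) = G j / 2 ^ (2 * B) + 2 ^ k * (1 / 2 ^ B) := by
    intro j hj k hk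
    have e := (hG (j + 1) hj).2
    push_cast at e
    rw [← e, hk _ ⟨by simpa using (grid_lt B j).le, le_rfl⟩, add_div, add_sub_cancel_left]
  refine ⟨G, hG0, hG1, fun j hj => ?_, IsVertexList.isBreakpointTable ?_⟩
  · obtain ⟨k, hk⟩ := haff j hj
    have e := hstep j hj k hk
    have e1 : (2 : ℝ) ^ (k + B) = ((G (j + 1) - G j : ℤ) : ℝ) := by
      rw [zpow_add₀ two_ne_zero, zpow_natCast]
      rw [two_mul, pow_add] at e
      field_simp at e
      push_cast
      linarith
    have hle := (hG (j + 1) hj).1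
    have hkB : 0 ≤ k + B := by
      by_contra hcon
      have h2 : (2 : ℝ) ^ (k + B) < 1 := zpow_lt_one_of_neg₀ (by norm_num) (by omega)
      have h3 : (0 : ℝ) < 2 ^ (k + B) := by positivity
      rw [e1] at h2 h3
      have h4 : (G (j + 1) - G j : ℤ) < 1 := by exact_mod_cast h2
      have h5 : 0 < (G (j + 1) - G j : ℤ) := by exact_mod_cast h3
      omega
    obtain ⟨e', he'⟩ := Int.eq_ofNat_of_zero_le hkB
    rw [he'] at e1
    have e2 : (2 : ℤ) ^ e' = G (j + 1) - G j := by
      rw [zpow_natCast] at e1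
      exact_mod_cast e1
    have e3 : G (j + 1) = G j + 2 ^ e' := by
      have : ((G (j + 1) : ℕ) : ℤ) = ((G j + 2 ^ e' : ℕ) : ℤ) := by push_cast; omega
      exact_mod_cast this
    refine ⟨e', ?_, e3⟩
    by_contra hcon
    have : 2 ^ (2 * B) < 2 ^ e' := Nat.pow_lt_pow_right (by norm_num) (by omega)
    omega
  · refine isVertexList_gridTable hG0 hG1 fun j hj => ?_
    obtain ⟨k, hk⟩ := haff j hj
    exact ⟨k, hstep j hj k hk, hk⟩

/-- The increasing affine bijection with slope `2 ^ k` through `(a, b)`. -/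
noncomputable def affineIso (k : ℤ) (a b : ℝ) : ℝ ≃o ℝ :=
  ((OrderIso.addRight (-a)).trans (OrderIso.mulLeft₀ (2 ^ k) (by positivity))).trans
    (OrderIso.addRight b)

theorem affineIso_apply (k : ℤ) (a b t : ℝ) : affineIso k a b t = b + 2 ^ k * (t - a) := by
  change 2 ^ k * (t + -a) + b = _
  ring

theorem isPL_affineIso (k : ℤ) (a b : ℝ) : IsPL (affineIso k a b) :=
  ⟨0, fun _ => ⟨k, b - 2 ^ k * a, fun t _ => by rw [affineIso_apply]; ring⟩⟩

/-- Increasing values over a subdivision, with differences powers of `2`, are interpolated by an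
element of `PLTwo`. -/
theorem exists_isBreakpointTable_gridTable {B : ℕ} {G : ℕ → ℕ} (h0 : G 0 = 0)
    (h1 : G (2 ^ B) = 2 ^ (2 * B)) (h : ∀ j : ℕ, j < 2 ^ B → ∃ e : ℕ, G (j + 1) = G j + 2 ^ e) :
    ∃ g : PLTwo, IsBreakpointTable (gridTable B G (2 ^ B)) g := by
  have hpos : (0 : ℝ) < 2 ^ B := by positivity
  have key : ∀ n ≤ 2 ^ B, ∃ F : ℝ ≃o ℝ, IsPL F ∧ (∀ t ≤ 0, F t = t) ∧
      (∀ j < n, ∃ k : ℤ,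
        (G (j + 1) : ℝ) / 2 ^ (2 * B) = G j / 2 ^ (2 * B) + 2 ^ k * (1 / 2 ^ B) ∧
        ∀ t ∈ Icc ((j : ℝ) / 2 ^ B) ((j + 1 : ℝ) / 2 ^ B),
          F t = G j / 2 ^ (2 * B) + 2 ^ k * (t - j / 2 ^ B)) ∧
      ∀ t, (n : ℝ) / 2 ^ B ≤ t → F t = G n / 2 ^ (2 * B) + (t - n / 2 ^ B) := by
    intro n
    induction n with
    | zero =>
      intro _
      refine ⟨affineIso 0 0 0, isPL_affineIso 0 0 0, ?_, fun j hj => absurd hj (by omega), ?_⟩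
      · intro t _; simp [affineIso_apply]
      · intro t _; simp [affineIso_apply, h0]
    | succ n ih =>
      intro hn
      obtain ⟨F, hF, hF0, hFn, hF1⟩ := ih (by omega)
      obtain ⟨e, he⟩ := h n (by omega)
      have hstep : (G (n + 1) : ℝ) / 2 ^ (2 * B) =
          G n / 2 ^ (2 * B) + 2 ^ ((e : ℤ) - B) * (1 / 2 ^ B) := by
        rw [he, zpow_sub₀ two_ne_zero, zpow_natCast, zpow_natCast, two_mul, pow_add]
        push_cast
        field_simp
      have hlt : (n : ℝ) / 2 ^ B < ((n : ℝ) + 1) / 2 ^ B := by simpa using grid_lt B n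
      have e1 : F (n / 2 ^ B) =
          affineIso ((e : ℤ) - B) (n / 2 ^ B) (G n / 2 ^ (2 * B)) (n / 2 ^ B) := by
        rw [hF1 _ le_rfl, affineIso_apply]; simp
      have e2 : glueIso F (affineIso ((e : ℤ) - B) (n / 2 ^ B) (G n / 2 ^ (2 * B))) (n / 2 ^ B) e1
          ((n + 1) / 2 ^ B) =
          affineIso 0 ((n + 1) / 2 ^ B) (G (n + 1) / 2 ^ (2 * B)) ((n + 1) / 2 ^ B) := by
        rw [glueIso_of_ge _ hlt.le, affineIso_apply, affineIso_apply, hstep, add_div]; ring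
      refine ⟨glueIso _ _ _ e2, isPL_glueIso _ (isPL_glueIso _ hF (isPL_affineIso _ _ _) ?_)
        (isPL_affineIso _ _ _) ?_, ?_, ?_, ?_⟩
      · exact ⟨n, B, by push_cast; rfl⟩
      · exact ⟨n + 1, B, by push_cast; rfl⟩
      · intro t ht
        rw [glueIso_of_le _ (ht.trans (by positivity)), glueIso_of_le _ (ht.trans (by positivity)),
          hF0 t ht]
      · intro j hj
        rcases Nat.lt_succ_iff_lt_or_eq.1 hj with hj | rfl
        · obtain ⟨k, h2, h3⟩ := hFn j hj
          refine ⟨k, h2, fun t ht => ?_⟩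
          have h4 : (j + 1 : ℝ) ≤ n := by exact_mod_cast hj
          have h5 : t ≤ n / 2 ^ B := ht.2.trans (by gcongr)
          rw [glueIso_of_le _ (h5.trans hlt.le), glueIso_of_le _ h5, h3 t ht]
        · refine ⟨(e : ℤ) - B, hstep, fun t ht => ?_⟩
          rw [glueIso_of_le _ ht.2, glueIso_of_ge _ ht.1, affineIso_apply]
      · intro t ht
        push_cast at ht ⊢
        rw [glueIso_of_ge _ ht, affineIso_apply]; simp
  obtain ⟨F, hF, hF0, hFn, hF1⟩ := key (2 ^ B) le_rfl
  push_cast at hF1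
  rw [div_self hpos.ne', h1] at hF1
  obtain ⟨g, hg⟩ := exists_toIso_eq hF hF0 fun t ht => by
    rw [hF1 t ht]; push_cast; rw [div_self (by positivity)]; ring
  refine ⟨g, IsVertexList.isBreakpointTable ?_⟩
  rw [hg]
  exact isVertexList_gridTable h0 h1 hFn

/-! ### Primitive recursive bounds -/

section Primrec

variable {α : Type*} [Primcodable α]

theorem Primrec.add {f g : α → ℕ} (hf : Primrec f) (hg : Primrec g) :
    Primrec fun a => f a + g a := Primrec.nat_add.comp hf hg

theorem Primrec.mul {f g : α → ℕ} (hf : Primrec f) (hg : Primrec g) :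
    Primrec fun a => f a * g a := Primrec.nat_mul.comp hf hg

theorem Primrec.two_pow {f : α → ℕ} (hf : Primrec f) : Primrec fun a => 2 ^ f a :=
  (Primrec₂.unpaired'.1 Nat.Primrec.pow).comp (.const 2) hf

theorem PrimrecPred.exists_lt_comp {p : α → ℕ → Prop} (hp : PrimrecPred fun z : α × ℕ => p z.1 z.2)
    {f : α → ℕ} (hf : Primrec f) : PrimrecPred fun a => ∃ i < f a, p a i := by
  have hR : PrimrecRel fun (i : ℕ) (a : α) => p a i :=
    PrimrecPred.comp hp (Primrec.pair Primrec.snd Primrec.fst)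
  exact (hR.exists_mem_list.comp (Primrec.list_range.comp hf) Primrec.id).of_eq
    fun a => by simp

theorem PrimrecPred.forall_lt_comp {p : α → ℕ → Prop} (hp : PrimrecPred fun z : α × ℕ => p z.1 z.2)
    {f : α → ℕ} (hf : Primrec f) : PrimrecPred fun a => ∀ i < f a, p a i := by
  have hR : PrimrecRel fun (i : ℕ) (a : α) => p a i :=
    PrimrecPred.comp hp (Primrec.pair Primrec.snd Primrec.fst)
  exact (hR.forall_mem_list.comp (Primrec.list_range.comp hf) Primrec.id).of_eq
    fun a => by simp

theorem Primrec.slopeBound {f g : α → ℕ} (hf : Primrec f) (hg : Primrec g) :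
    Primrec fun a => slopeBound (f a) (g a) :=
  ((hf.mul (((Primrec.const 5).mul hf).add ((Primrec.const 2).mul hg)).two_pow).add
    ((Primrec.const 3).mul hf)).add hg

theorem Primrec.chainBound {f g : α → ℕ} (hf : Primrec f) (hg : Primrec g) :
    Primrec fun a => chainBound (f a) (g a) :=
  Primrec.nat_iterate hg hf (Primrec.slopeBound (hf.comp Primrec.fst) Primrec.snd)

theorem Primrec.conjBound {f : α → ℕ} (hf : Primrec f) : Primrec fun a => conjBound (f a) := by
  have h1 := Primrec.chainBound hf (hf.two_pow.add (Primrec.const 1))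
  have h2 := ((Primrec.const 5).mul hf).add h1
  have h3 := h2.add (((Primrec.const 6).mul hf).mul h2.two_pow)
  have h4 := (Primrec.const 2).mul hf
  exact h3.add (h4.add ((Primrec.const 2).mul h4.two_pow))

end Primrec

/-! ### The search for a conjugator -/

/-- Addition of dyadic numbers given as pairs. -/
def dyAdd (p q : ℕ × ℕ) : ℕ × ℕ := (p.1 * 2 ^ q.2 + q.1 * 2 ^ p.2, p.2 + q.2)

/-- Multiplication of dyadic numbers given as pairs. -/
def dyMul (p q : ℕ × ℕ) : ℕ × ℕ := (p.1 * q.1, p.2 + q.2)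

/-- The order of dyadic numbers given as pairs. -/
def DyLE (p q : ℕ × ℕ) : Prop := p.1 * 2 ^ q.2 ≤ q.1 * 2 ^ p.2

theorem dyadicValue_dyAdd (p q : ℕ × ℕ) :
    dyadicValue (dyAdd p q) = dyadicValue p + dyadicValue q := by
  simp only [dyadicValue, dyAdd, pow_add]; push_cast; field_simp

theorem dyadicValue_dyMul (p q : ℕ × ℕ) :
    dyadicValue (dyMul p q) = dyadicValue p * dyadicValue q := by
  simp only [dyadicValue, dyMul, pow_add]; push_cast; field_simp

theorem dyLE_iff (p q : ℕ × ℕ) : DyLE p q ↔ dyadicValue p ≤ dyadicValue q := by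
  unfold DyLE dyadicValue
  rw [div_le_div_iff₀ (by positivity) (by positivity)]
  exact_mod_cast Iff.rfl

/-- The point `(u, v)` lies on the line through the points `p` and `q` of the plane, and `u` is
between their first coordinates. The equation of the line is written without subtractions. -/
def OnEdge (p q : (ℕ × ℕ) × (ℕ × ℕ)) (u v : ℕ × ℕ) : Prop :=
  let l := dyAdd (dyAdd (dyMul v q.1) (dyMul q.2 p.1)) (dyMul p.2 u)
  let r := dyAdd (dyAdd (dyMul q.2 u) (dyMul v p.1)) (dyMul p.2 q.1)
  DyLE p.1 u ∧ DyLE u q.1 ∧ DyLE l r ∧ DyLE r l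

theorem onEdge_iff {p q : (ℕ × ℕ) × (ℕ × ℕ)} {u v : ℕ × ℕ} : OnEdge p q u v ↔
    dyadicValue p.1 ≤ dyadicValue u ∧ dyadicValue u ≤ dyadicValue q.1 ∧
      (dyadicValue v - dyadicValue p.2) * (dyadicValue q.1 - dyadicValue p.1) =
        (dyadicValue q.2 - dyadicValue p.2) * (dyadicValue u - dyadicValue p.1) := by
  simp only [OnEdge, dyLE_iff, dyadicValue_dyAdd, dyadicValue_dyMul]
  refine and_congr_right fun _ => and_congr_right fun _ => ?_
  rw [← le_antisymm_iff]
  constructor <;> intro h <;> linarith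

/-- The point `(u, v)` lies on the polygonal graph with vertices `c`. -/
def OnGraph (c : BreakpointTable) (u v : ℕ × ℕ) : Prop :=
  ∃ i < c.length - 1, OnEdge (c.getD i ((0, 0), (0, 0))) (c.getD (i + 1) ((0, 0), (0, 0))) u v

/-- The polygonal graphs `a`, `b`, `c` of functions `x`, `y`, `g` satisfy `x ∘ g = g ∘ y` at the
multiples of `2 ^ (-T)` in the unit interval, all values being multiples of `2 ^ (-T')`. -/
def CommutesOnGrid (a b c : BreakpointTable) (T T' : ℕ) : Prop :=
  ∀ j < 2 ^ T + 1, ∃ v < 2 ^ T' + 1, ∃ w < 2 ^ T' + 1, ∃ z < 2 ^ T' + 1,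
    OnGraph c (j, T) (v, T') ∧ OnGraph a (v, T') (w, T') ∧
    OnGraph b (j, T) (z, T') ∧ OnGraph c (z, T') (w, T')

/-- The tables with `n + 1` vertices above `0, 2 ^ (-B), …, n * 2 ^ (-B)` whose values start from
`0` and increase at each step by a power of `2` between `2 ^ (-2 B)` and `1`, each together with
the numerator of its last value. -/
def candidates (B : ℕ) : ℕ → List (BreakpointTable × ℕ)
  | 0 => [([((0, B), (0, 2 * B))], 0)]
  | n + 1 => (candidates B n).flatMap fun s => (List.range (2 * B + 1)).map fun e =>
      (s.1 ++ [((n + 1, B), (s.2 + 2 ^ e, 2 * B))], s.2 + 2 ^ e)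

open Classical in
/-- The search for a conjugator from `x` to `y`, given by tables `z.1` and `z.2`, among the
candidates of the size dictated by `conjBound`. -/
noncomputable def conjSearch (z : BreakpointTable × BreakpointTable) : Option BreakpointTable :=
  let N := Encodable.encode z.1 + Encodable.encode z.2
  let B := conjBound N
  (((candidates B (2 ^ B)).filter fun s => s.2 = 2 ^ (2 * B) ∧
    CommutesOnGrid z.1 z.2 s.1 (4 * B + 3 * N) (8 * B + 5 * N)).head?).map Prod.fst

section Primrec

variable {α : Type*} [Primcodable α]

theorem Primrec.dyAdd {f g : α → ℕ × ℕ} (hf : Primrec f) (hg : Primrec g) :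
    Primrec fun a => dyAdd (f a) (g a) :=
  .pair (.add ((Primrec.fst.comp hf).mul (Primrec.snd.comp hg).two_pow)
    ((Primrec.fst.comp hg).mul (Primrec.snd.comp hf).two_pow))
    (.add (Primrec.snd.comp hf) (Primrec.snd.comp hg))

theorem Primrec.dyMul {f g : α → ℕ × ℕ} (hf : Primrec f) (hg : Primrec g) :
    Primrec fun a => dyMul (f a) (g a) :=
  .pair ((Primrec.fst.comp hf).mul (Primrec.fst.comp hg))
    (.add (Primrec.snd.comp hf) (Primrec.snd.comp hg))

theorem PrimrecPred.dyLE {f g : α → ℕ × ℕ} (hf : Primrec f) (hg : Primrec g) :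
    PrimrecPred fun a => DyLE (f a) (g a) :=
  Primrec.nat_le.comp ((Primrec.fst.comp hf).mul (Primrec.snd.comp hg).two_pow)
    ((Primrec.fst.comp hg).mul (Primrec.snd.comp hf).two_pow)

theorem PrimrecPred.onEdge {p q : α → (ℕ × ℕ) × (ℕ × ℕ)} {u v : α → ℕ × ℕ} (hp : Primrec p)
    (hq : Primrec q) (hu : Primrec u) (hv : Primrec v) :
    PrimrecPred fun a => OnEdge (p a) (q a) (u a) (v a) := by
  have hp1 := Primrec.fst.comp hp
  have hp2 := Primrec.snd.comp hp
  have hq1 := Primrec.fst.comp hq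
  have hq2 := Primrec.snd.comp hq
  have hl := ((hv.dyMul hq1).dyAdd (hq2.dyMul hp1)).dyAdd (hp2.dyMul hu)
  have hr := ((hq2.dyMul hu).dyAdd (hv.dyMul hp1)).dyAdd (hp2.dyMul hq1)
  exact (PrimrecPred.dyLE hp1 hu).and ((PrimrecPred.dyLE hu hq1).and
    ((PrimrecPred.dyLE hl hr).and (PrimrecPred.dyLE hr hl)))

theorem PrimrecPred.onGraph {c : α → BreakpointTable} {u v : α → ℕ × ℕ} (hc : Primrec c)
    (hu : Primrec u) (hv : Primrec v) : PrimrecPred fun a => OnGraph (c a) (u a) (v a) := by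
  have hc' : Primrec fun z : α × ℕ => c z.1 := hc.comp Primrec.fst
  refine PrimrecPred.exists_lt_comp (PrimrecPred.onEdge ?_ ?_ (hu.comp Primrec.fst)
    (hv.comp Primrec.fst)) (Primrec.nat_sub.comp (Primrec.list_length.comp hc) (.const 1))
  · exact (Primrec.list_getD _).comp hc' Primrec.snd
  · exact (Primrec.list_getD _).comp hc' (Primrec.snd.add (.const 1))

theorem PrimrecPred.commutesOnGrid {a b c : α → BreakpointTable} {T T' : α → ℕ} (ha : Primrec a)
    (hb : Primrec b) (hc : Primrec c) (hT : Primrec T) (hT' : Primrec T') :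
    PrimrecPred fun s => CommutesOnGrid (a s) (b s) (c s) (T s) (T' s) := by
  have h1 : Primrec fun z : α × ℕ => z.1 := Primrec.fst
  have h2 : Primrec fun z : (α × ℕ) × ℕ => z.1.1 := h1.comp Primrec.fst
  have h3 : Primrec fun z : ((α × ℕ) × ℕ) × ℕ => z.1.1.1 := h2.comp Primrec.fst
  have h4 : Primrec fun z : (((α × ℕ) × ℕ) × ℕ) × ℕ => z.1.1.1.1 := h3.comp Primrec.fst
  have hK := hT'.two_pow.add (Primrec.const 1)
  refine PrimrecPred.forall_lt_comp (PrimrecPred.exists_lt_comp (PrimrecPred.exists_lt_comp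
    (PrimrecPred.exists_lt_comp ?_ (hK.comp h3)) (hK.comp h2)) (hK.comp h1))
    (hT.two_pow.add (Primrec.const 1))
  have hj : Primrec fun z : (((α × ℕ) × ℕ) × ℕ) × ℕ => (z.1.1.1.2, T z.1.1.1.1) :=
    .pair (Primrec.snd.comp (Primrec.fst.comp (Primrec.fst.comp Primrec.fst))) (hT.comp h4)
  have hv : Primrec fun z : (((α × ℕ) × ℕ) × ℕ) × ℕ => (z.1.1.2, T' z.1.1.1.1) :=
    .pair (Primrec.snd.comp (Primrec.fst.comp Primrec.fst)) (hT'.comp h4)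
  have hw : Primrec fun z : (((α × ℕ) × ℕ) × ℕ) × ℕ => (z.1.2, T' z.1.1.1.1) :=
    .pair (Primrec.snd.comp Primrec.fst) (hT'.comp h4)
  have hz : Primrec fun z : (((α × ℕ) × ℕ) × ℕ) × ℕ => (z.2, T' z.1.1.1.1) :=
    .pair Primrec.snd (hT'.comp h4)
  exact (PrimrecPred.onGraph (hc.comp h4) hj hv).and ((PrimrecPred.onGraph (ha.comp h4) hv hw).and
    ((PrimrecPred.onGraph (hb.comp h4) hj hz).and (PrimrecPred.onGraph (hc.comp h4) hz hw)))

theorem primrec_candidates : Primrec₂ candidates := by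
  have hbase : Primrec fun B : ℕ => [([((0, B), (0, 2 * B))], 0)] := by
    refine Primrec.list_cons.comp (.pair (Primrec.list_cons.comp (.pair
      (.pair (.const 0) .id) (.pair (.const 0) ((Primrec.const 2).mul .id))) (.const []))
      (.const 0)) (.const [])
  have hstep : Primrec₂ fun (B : ℕ) (z : ℕ × List (BreakpointTable × ℕ)) =>
      z.2.flatMap fun s => (List.range (2 * B + 1)).map fun e =>
        (s.1 ++ [((z.1 + 1, B), (s.2 + 2 ^ e, 2 * B))], s.2 + 2 ^ e) := by
    refine Primrec.list_flatMap (Primrec.snd.comp Primrec.snd) (Primrec.list_map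
      (Primrec.list_range.comp (.add (.mul (.const 2) (Primrec.fst.comp Primrec.fst)) (.const 1)))
      ?_)
    have hB : Primrec fun w : ((ℕ × ℕ × List (BreakpointTable × ℕ)) × (BreakpointTable × ℕ)) × ℕ =>
      w.1.1.1 := Primrec.fst.comp (Primrec.fst.comp Primrec.fst)
    have hn : Primrec fun w : ((ℕ × ℕ × List (BreakpointTable × ℕ)) × (BreakpointTable × ℕ)) × ℕ =>
      w.1.1.2.1 := Primrec.fst.comp (Primrec.snd.comp (Primrec.fst.comp Primrec.fst))
    have hs : Primrec fun w : ((ℕ × ℕ × List (BreakpointTable × ℕ)) × (BreakpointTable × ℕ)) × ℕ =>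
      w.1.2 := Primrec.snd.comp Primrec.fst
    have hv : Primrec fun w : ((ℕ × ℕ × List (BreakpointTable × ℕ)) × (BreakpointTable × ℕ)) × ℕ =>
      w.1.2.2 + 2 ^ w.2 := (Primrec.snd.comp hs).add Primrec.snd.two_pow
    exact Primrec.pair (Primrec.list_append.comp (Primrec.fst.comp hs) (Primrec.list_cons.comp
      (.pair (.pair (hn.add (.const 1)) hB) (.pair hv ((Primrec.const 2).mul hB))) (.const []))) hv
  refine (Primrec.nat_rec hbase hstep).of_eq fun B n => ?_
  induction n with
  | zero => rfl
  | succ n ih =>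
    change List.flatMap _ _ = List.flatMap _ _
    rw [← ih]

theorem primrec_conjSearch : Primrec conjSearch := by
  classical
  have hN : Primrec fun z : BreakpointTable × BreakpointTable =>
      Encodable.encode z.1 + Encodable.encode z.2 :=
    (Primrec.encode.comp Primrec.fst).add (Primrec.encode.comp Primrec.snd)
  have hB := hN.conjBound
  have hR : PrimrecRel fun (s : BreakpointTable × ℕ) (z : BreakpointTable × BreakpointTable) =>
      s.2 = 2 ^ (2 * conjBound (Encodable.encode z.1 + Encodable.encode z.2)) ∧
      CommutesOnGrid z.1 z.2 s.1
        (4 * conjBound (Encodable.encode z.1 + Encodable.encode z.2) +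
          3 * (Encodable.encode z.1 + Encodable.encode z.2))
        (8 * conjBound (Encodable.encode z.1 + Encodable.encode z.2) +
          5 * (Encodable.encode z.1 + Encodable.encode z.2)) := by
    have hB' := hB.comp (Primrec.snd (α := BreakpointTable × ℕ))
    have hN' := hN.comp (Primrec.snd (α := BreakpointTable × ℕ))
    exact (Primrec.eq.comp (Primrec.snd.comp Primrec.fst) ((Primrec.const 2).mul hB').two_pow).and
      (PrimrecPred.commutesOnGrid (Primrec.fst.comp Primrec.snd) (Primrec.snd.comp Primrec.snd)
        (Primrec.fst.comp Primrec.fst) (((Primrec.const 4).mul hB').add ((Primrec.const 3).mul hN'))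
        (((Primrec.const 8).mul hB').add ((Primrec.const 5).mul hN')))
  refine Primrec.option_map (Primrec.list_head?.comp ?_) (Primrec.fst.comp Primrec.snd)
  exact hR.listFilter.comp (primrec_candidates.comp hB hB.two_pow) Primrec.id

end Primrec

/-! ### Testing the functional equation -/

theorem exists_getD_between {α : Type*} {φ : α → ℝ} (d : α) {t : ℝ} : ∀ {c : List α},
    ∀ h ∈ c.head?, ∀ l ∈ c.getLast?, φ h ≤ t → t ≤ φ l → φ h < φ l →
      ∃ i < c.length - 1, φ (c.getD i d) ≤ t ∧ t ≤ φ (c.getD (i + 1) d)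
  | [], h, hh, l, hl, h1, h2, h3 => by simp at hh
  | [a], h, hh, l, hl, h1, h2, h3 => by
    simp at hh hl; subst hh hl; exact absurd h3 (lt_irrefl _)
  | a :: b :: c, h, hh, l, hl, h1, h2, h3 => by
    have hl' : l ∈ (b :: c).getLast? := by simpa using hl
    simp only [List.head?_cons, Option.mem_def, Option.some.injEq] at hh
    subst hh
    rcases le_or_gt t (φ b) with h4 | h4
    · exact ⟨0, by simp, by simpa using h1, by simpa using h4⟩
    · obtain ⟨i, hi, h5, h6⟩ :=
        exists_getD_between d b (by simp) l hl' h4.le h2 (h4.trans_le h2)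
      refine ⟨i + 1, ?_, ?_, ?_⟩
      · simp only [List.length_cons] at hi ⊢; omega
      · rwa [List.getD_cons_succ]
      · rwa [List.getD_cons_succ]

/-- For a table of `f`, the polygonal graph is the graph of `f` over the unit interval. -/
theorem onGraph_iff {c : BreakpointTable} {f : PLTwo} (hc : IsBreakpointTable c f)
    {u v : ℕ × ℕ} :
    OnGraph c u v ↔ dyadicValue u ≤ 1 ∧ dyadicValue v = toIso f (dyadicValue u) := by
  obtain ⟨⟨h, hh, hh1, -⟩, ⟨l, hl, hl1, -⟩, hchain⟩ := hc.isVertexList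
  have hlast := isChain_le_getLast (φ := fun p => dyadicValue p.1) (fun p q ⟨_, h, _⟩ => h)
    hchain l hl
  rw [List.isChain_iff_getElem] at hchain
  unfold OnGraph
  constructor
  · rintro ⟨i, hi, he⟩
    rw [List.getD_eq_getElem _ _ (by omega), List.getD_eq_getElem _ _ (by omega), onEdge_iff] at he
    obtain ⟨k, hlt, h2, h3⟩ := hchain i (by omega)
    obtain ⟨h4, h5, h6⟩ := he
    have h7 := hlast _ (List.getElem_mem (show i + 1 < c.length by omega))
    refine ⟨h5.trans (h7.trans hl1.le), ?_⟩
    rw [h3 _ ⟨h4, h5⟩]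
    rw [h2] at h6
    have h8 := (sub_pos.2 hlt).ne'
    exact sub_eq_iff_eq_add'.1 (mul_right_cancel₀ h8 (by rw [h6]; ring))
  · rintro ⟨h1, hv⟩
    obtain ⟨i, hi, h4, h5⟩ := exists_getD_between (φ := fun p => dyadicValue p.1)
      ((0, 0), (0, 0)) h hh l hl (hh1.le.trans (dyadicValue_nonneg u)) (h1.trans hl1.ge)
      (by rw [hh1, hl1]; exact zero_lt_one)
    refine ⟨i, hi, ?_⟩
    simp only [List.getD_eq_getElem _ _ (show i < c.length by omega),
      List.getD_eq_getElem _ _ (show i + 1 < c.length by omega)] at h4 h5 ⊢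
    obtain ⟨k, hlt, h2, h3⟩ := hchain i (by omega)
    rw [onEdge_iff]
    refine ⟨h4, h5, ?_⟩
    rw [hv, h3 _ ⟨h4, h5⟩, h2]
    ring

/-- Elements whose breaks lie in the subdivision of level `T` are determined by their values
there. -/
theorem PLTwo.eq_of_grid {f h : PLTwo} {T : ℕ} (hf : ∀ t, ¬ AffAt (toIso f) t → TwoBdd T t)
    (hh : ∀ t, ¬ AffAt (toIso h) t → TwoBdd T t)
    (e : ∀ j : ℕ, j ≤ 2 ^ T → toIso f (j / 2 ^ T) = toIso h (j / 2 ^ T)) : f = h := by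
  have hpos : (0 : ℝ) < 2 ^ T := by positivity
  apply toIso_injective
  ext t
  rcases le_or_gt t 0 with h0 | h0
  · rw [toIso_of_le_zero f h0, toIso_of_le_zero h h0]
  rcases le_or_gt 1 t with h1 | h1
  · rw [toIso_of_one_le f h1, toIso_of_one_le h h1]
  obtain ⟨j, hj⟩ := exists_mem_Ico_grid T t
  have hj0 : 0 ≤ j := by
    have := h0.trans hj.2
    rw [lt_div_iff₀ hpos, zero_mul] at this
    have : 0 < j + 1 := by exact_mod_cast this
    omega
  have hj1 : j < 2 ^ T := by
    have := hj.1.trans_lt h1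
    rw [div_lt_one hpos] at this
    exact_mod_cast this
  lift j to ℕ using hj0
  have hj1 : j < 2 ^ T := by exact_mod_cast hj1
  have haff : ∀ {f : PLTwo}, (∀ t, ¬ AffAt (toIso f) t → TwoBdd T t) → ∃ (k : ℤ) (c : ℝ),
      ∀ t ∈ Icc (((j : ℤ) : ℝ) / 2 ^ T) ((((j : ℤ) : ℝ) + 1) / 2 ^ T),
        toIso f t = c + 2 ^ k * t := by
    intro f hf
    refine affine_of_affAt (toIso f).continuous (grid_lt T j) fun t ht => ?_
    by_contra hn
    have hd : IsDyadic t := by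
      by_contra hd
      exact hn ((isPL_toIso f).affAt hd)
    obtain ⟨m, hm⟩ := (hf t hn).of_isDyadic hd
    exact not_int_div_of_mem_Ioo ht m hm
  obtain ⟨k, c, h2⟩ := haff hf
  obtain ⟨k', c', h3⟩ := haff hh
  have hlt := grid_lt T j
  have e1 := e j hj1.le
  have e2 := e (j + 1) hj1
  push_cast at e2 h2 h3 hlt hj
  rw [h2 _ ⟨le_rfl, hlt.le⟩, h3 _ ⟨le_rfl, hlt.le⟩] at e1
  rw [h2 _ ⟨hlt.le, le_rfl⟩, h3 _ ⟨hlt.le, le_rfl⟩] at e2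
  have hk : (2 : ℝ) ^ k = 2 ^ k' :=
    mul_right_cancel₀ (sub_pos.2 hlt).ne' (by linarith)
  rw [hk] at e1
  rw [h2 _ ⟨hj.1, hj.2.le⟩, h3 _ ⟨hj.1, hj.2.le⟩, hk]
  linarith

theorem twoBdd_of_not_affAt_mul {f h : PLTwo} {M N : ℕ} (hf : Lev M (toIso f))
    (hh : Lev N (toIso h)) (hh' : Lev N (toIso h).symm) {t : ℝ}
    (ht : ¬ AffAt (toIso (f * h)) t) : TwoBdd (M + 2 * N) t := by
  by_contra hn
  refine ht (((hf.affAt ?_).comp (hh.affAt ?_)).congr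
    (Eventually.of_forall fun s => (toIso_mul f h s).symm))
  · intro h1
    refine hn ?_
    have := hh'.twoBdd h1
    rwa [OrderIso.symm_apply_apply] at this
  · exact fun h1 => hn (h1.mono (by omega))

/-- Both `x * g` and `g * y` break only at multiples of `2 ^ (-(4 B + 3 N))`, so it is enough to
compare them there. -/
theorem CommutesOnGrid.mul_eq {a b c : BreakpointTable} {x y g : PLTwo}
    (ha : IsBreakpointTable a x) (hb : IsBreakpointTable b y) (hc : IsBreakpointTable c g)
    {B N T' : ℕ} (hNa : ExpLE N a) (hNb : ExpLE N b)
    (hNc : ExpLE (2 * B) c) (h : CommutesOnGrid a b c (4 * B + 3 * N) T') : x * g = g * y := by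
  refine PLTwo.eq_of_grid (T := 4 * B + 3 * N) (fun t ht => ?_) (fun t ht => ?_) fun j hj => ?_
  · exact (twoBdd_of_not_affAt_mul (ha.lev hNa) (hc.lev hNc) (hc.lev_symm hNc) ht).mono (by omega)
  · exact (twoBdd_of_not_affAt_mul (hc.lev hNc) (hb.lev hNb) (hb.lev_symm hNb) ht).mono (by omega)
  · obtain ⟨v, -, w, -, z, -, h1, h2, h3, h4⟩ := h j (Nat.lt_succ_iff.2 hj)
    rw [onGraph_iff ha] at h2
    rw [onGraph_iff hb] at h3
    rw [onGraph_iff hc] at h1 h4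
    change toIso _ (dyadicValue (j, 4 * B + 3 * N)) = toIso _ (dyadicValue (j, 4 * B + 3 * N))
    rw [toIso_mul, toIso_mul, ← h1.2, ← h2.2, ← h3.2, ← h4.2]

/-- Application of `g` increases the exponent of a denominator by at most `4 B`, and application of
`x` or `y` by at most `2 N`, whence the exponent `8 B + 5 N` of the values. -/
theorem commutesOnGrid_of_mul_eq {a b c : BreakpointTable} {x y g : PLTwo}
    (ha : IsBreakpointTable a x) (hb : IsBreakpointTable b y) (hc : IsBreakpointTable c g)
    {B N : ℕ} (hNa : ExpLE N a) (hNb : ExpLE N b)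
    (hNc : ExpLE (2 * B) c) (h : x * g = g * y) :
    CommutesOnGrid a b c (4 * B + 3 * N) (8 * B + 5 * N) := by
  intro j hj
  have hu1 : dyadicValue (j, 4 * B + 3 * N) ≤ 1 := by
    unfold dyadicValue
    rw [div_le_one (by positivity)]
    exact_mod_cast Nat.lt_succ_iff.1 hj
  have hum : dyadicValue (j, 4 * B + 3 * N) ∈ Icc (0 : ℝ) 1 := ⟨dyadicValue_nonneg _, hu1⟩
  have hu2 : TwoBdd (4 * B + 3 * N) (dyadicValue (j, 4 * B + 3 * N)) := by
    simpa [dyadicValue] using TwoBdd.int_div j (4 * B + 3 * N)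
  have hu3 : IsDyadic (dyadicValue (j, 4 * B + 3 * N)) := ⟨j, 4 * B + 3 * N, by simp [dyadicValue]⟩
  set u := dyadicValue (j, 4 * B + 3 * N)
  have hrep : ∀ {t : ℝ}, TwoBdd (8 * B + 5 * N) t → IsDyadic t → t ∈ Icc (0 : ℝ) 1 →
      ∃ v < 2 ^ (8 * B + 5 * N) + 1, dyadicValue (v, 8 * B + 5 * N) = t := by
    intro t h1 h2 h3
    obtain ⟨v, hv, e⟩ := h1.exists_nat_of_mem h2 h3
    exact ⟨v, Nat.lt_succ_iff.2 hv, e.symm⟩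
  have hg2 := (hc.lev hNc).twoBdd hu2
  have hg3 := (isDyadic_toIso_iff g _).2 hu3
  have hgm := toIso_mem_Icc g hum
  obtain ⟨v, hv, ev⟩ := hrep (hg2.mono (by omega)) hg3 hgm
  obtain ⟨w, hw, ew⟩ := hrep (((ha.lev hNa).twoBdd hg2).mono (by omega))
    ((isDyadic_toIso_iff x _).2 hg3) (toIso_mem_Icc x hgm)
  obtain ⟨z, hz, ez⟩ := hrep (((hb.lev hNb).twoBdd hu2).mono (by omega))
    ((isDyadic_toIso_iff y _).2 hu3) (toIso_mem_Icc y hum)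
  refine ⟨v, hv, w, hw, z, hz, (onGraph_iff hc).2 ⟨hu1, ev⟩, (onGraph_iff ha).2 ⟨?_, ?_⟩,
    (onGraph_iff hb).2 ⟨hu1, ez⟩, (onGraph_iff hc).2 ⟨?_, ?_⟩⟩
  · rw [ev]; exact hgm.2
  · rw [ev, ew]
  · rw [ez]; exact (toIso_mem_Icc y hum).2
  · rw [ez, ew, ← toIso_mul, ← toIso_mul, h]

/-! ### Correctness of the search -/

theorem gridTable_succ (B : ℕ) (G : ℕ → ℕ) (n : ℕ) :
    gridTable B G (n + 1) = gridTable B G n ++ [((n + 1, B), (G (n + 1), 2 * B))] := by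
  unfold gridTable
  rw [List.range_succ, List.map_append]
  rfl

theorem gridTable_congr {B n : ℕ} {G G' : ℕ → ℕ} (h : ∀ j ≤ n, G j = G' j) :
    gridTable B G n = gridTable B G' n := by
  refine List.map_congr_left fun j hj => ?_
  rw [h j (Nat.lt_succ_iff.1 (List.mem_range.1 hj))]

theorem mem_candidates {B : ℕ} {s : BreakpointTable × ℕ} {n : ℕ} :
    s ∈ candidates B n ↔ ∃ G : ℕ → ℕ, G 0 = 0 ∧
      (∀ j < n, ∃ e ≤ 2 * B, G (j + 1) = G j + 2 ^ e) ∧ s = (gridTable B G n, G n) := by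
  induction n generalizing s with
  | zero =>
    simp only [candidates, List.mem_singleton, gridTable]
    constructor
    · rintro rfl
      exact ⟨fun _ => 0, rfl, by simp, by simp⟩
    · rintro ⟨G, h0, -, rfl⟩
      simp [h0]
  | succ n ih =>
    simp only [candidates, List.mem_flatMap, List.mem_map, List.mem_range, ih]
    constructor
    · rintro ⟨_, ⟨G, h0, hG, rfl⟩, e, he, rfl⟩
      have hG' : ∀ j ≤ n, Function.update G (n + 1) (G n + 2 ^ e) j = G j := fun j hj =>
        Function.update_of_ne (by omega) _ _
      refine ⟨Function.update G (n + 1) (G n + 2 ^ e), ?_, fun j hj => ?_, ?_⟩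
      · rw [hG' 0 (by omega), h0]
      · rcases Nat.lt_succ_iff_lt_or_eq.1 hj with hj | rfl
        · rw [hG' j hj.le, hG' (j + 1) hj]; exact hG j hj
        · rw [hG' j le_rfl, Function.update_self]; exact ⟨e, by omega, rfl⟩
      · rw [gridTable_succ, Function.update_self, gridTable_congr hG']
    · rintro ⟨G, h0, hG, rfl⟩
      obtain ⟨e, he, h⟩ := hG n (by omega)
      exact ⟨_, ⟨G, h0, fun j hj => hG j (by omega), rfl⟩, e, by omega, by
        rw [gridTable_succ, h]⟩

/-- The size of a table, measured by its code, dominates the exponents in it. This makes the level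
of the element computable from the table. -/
theorem expLE_encode (a : BreakpointTable) : ExpLE (Encodable.encode a) a := by
  induction a with
  | nil => intro p hp; simp at hp
  | cons q a ih =>
    have h1 : Encodable.encode q ≤ Encodable.encode (q :: a) := by
      rw [Encodable.encode_list_cons]
      exact (Nat.left_le_pair _ _).trans (Nat.le_succ _)
    have h2 : Encodable.encode a ≤ Encodable.encode (q :: a) := by
      rw [Encodable.encode_list_cons]
      exact (Nat.right_le_pair _ _).trans (Nat.le_succ _)
    intro p hp
    rcases List.mem_cons.1 hp with rfl | hp
    · obtain ⟨⟨m, n⟩, ⟨m', n'⟩⟩ := p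
      simp only [Encodable.encode_prod_val, Encodable.encode_nat] at h1
      exact ⟨((Nat.right_le_pair m n).trans (Nat.left_le_pair _ _)).trans h1,
        ((Nat.right_le_pair m' n').trans (Nat.right_le_pair _ _)).trans h1⟩
    · exact ⟨(ih p hp).1.trans h2, (ih p hp).2.trans h2⟩

theorem ExpLE.mono {N M : ℕ} (h : N ≤ M) {c : BreakpointTable} (hc : ExpLE N c) : ExpLE M c :=
  fun p hp => ⟨(hc p hp).1.trans h, (hc p hp).2.trans h⟩

theorem inv_mul_mul_eq_iff_mul_eq {G : Type*} [Group G] {x y g : G} :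
    g⁻¹ * x * g = y ↔ x * g = g * y := by
  rw [mul_assoc, inv_mul_eq_iff_eq_mul]

theorem mainTheorem4 :
    EffectivelySolvableConjugacyProblem (↥PLTwo) IsBreakpointTable := by
  classical
  refine ⟨conjSearch, primrec_conjSearch.to_comp, fun a b x y ha hb => ?_⟩
  have hNa := (expLE_encode a).mono (Nat.le_add_right _ (Encodable.encode b))
  have hNb := (expLE_encode b).mono (Nat.le_add_left _ (Encodable.encode a))
  unfold conjSearch
  dsimp only
  set N := Encodable.encode a + Encodable.encode b
  set B := conjBound N
  simp only [inv_mul_mul_eq_iff_mul_eq]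
  constructor
  · rintro hnone ⟨g, hg⟩
    have S : ConjData N (toIso x) (toIso y) (toIso g) :=
      ⟨fun t => by rw [← toIso_mul, ← toIso_mul, hg], ha.lev hNa, ha.lev_symm hNa, hb.lev hNb,
        hb.lev_symm hNb⟩
    obtain ⟨g', S', hgood⟩ := exists_goodAt S
    obtain ⟨G, h0, h1, hG, hc⟩ := GoodAt.exists_gridTable hgood
    have hg' : x * g' = g' * y := toIso_injective (by
      ext t
      rw [toIso_mul, toIso_mul, S'.comm])
    rw [Option.map_eq_none_iff, List.head?_eq_none_iff, List.filter_eq_nil_iff] at hnone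
    refine hnone _ (mem_candidates.2 ⟨G, h0, hG, rfl⟩) (decide_eq_true ⟨h1, ?_⟩)
    exact commutesOnGrid_of_mul_eq ha hb hc hNa hNb (expLE_gridTable B G _) hg'
  · intro c hsome
    obtain ⟨s, hs, rfl⟩ := Option.map_eq_some_iff.1 hsome
    obtain ⟨hs1, hs2⟩ := List.mem_filter.1 (List.mem_of_mem_head? hs)
    obtain ⟨h1, hcomm⟩ := of_decide_eq_true hs2
    obtain ⟨G, h0, hG, rfl⟩ := mem_candidates.1 hs1
    obtain ⟨g, hc⟩ := exists_isBreakpointTable_gridTable h0 h1 fun j hj =>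
      let ⟨e, _, he⟩ := hG j hj
      ⟨e, he⟩
    exact ⟨g, hc, CommutesOnGrid.mul_eq ha hb hc hNa hNb (expLE_gridTable B G _) hcomm⟩
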